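/- Let $M\in\mathbb N$, $\vec N=(N_1,\dots,N_M)\in\mathbb N^M$ with all $N_k\ge 1$, $X=\prod_{k}\{0,\dots,N_k\}$, $|\vec N|=\sum_k N_k$ and $|\eta|=\sum_k\eta_k$ for $\eta\in X$. Write $\eta^{k,l}$ for $\eta$ with one particle moved from site $k$ to site $l$. **Processes.** $\mathrm{SEP}(\vec N)$ is the Markov jump process on $X$ with generator $$L_{\vec N}f(\eta)=\sum_{k=1}^{M-1}\eta_k(N_{k+1}-\eta_{k+1})[f(\eta^{k,k+1})-f(\eta)]+\eta_{k+1}(N_k-\eta_k)[f(\eta^{k+1,k})-f(\eta)].$$ For $\rho\in\mathbb R$ let $h^+_k(\xi)=\rho+\sum_{j\ge k}(2\xi_j-N_j)$. $\mathrm{SSEP}_{\mathsf R}(\vec N,\rho)$ has generator $L^{\mathsf R}_{\vec N,\rho}$, in which a particle jumps from $k$ to $k+1$ at rate $$\frac{\xi_k(N_{k+1}-\xi_{k+1})(h^+_k-\xi_k)(h^+_{k+1}-\xi_{k+1})}{h^+_{k+1}(h^+_{k+1}+1)}$$ and from $k$ to $k-1$ at rate $$\frac{\xi_k(N_{k-1}-\xi_{k-1})(h^+_k+\xi_{k-1})(h^+_{k+1}+\xi_k)}{h^+_k(h^+_k-1)}.$$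 Let $h^-_{k,0}(\eta)=\sum_{j\le k}(2\eta_j-N_j)$. A function $D:X\times X\to\mathbb R$ is a duality function between processes with generators $L$ and $L'$ if $[L D(\cdot,\xi)](\eta)=[L' D(\eta,\cdot)](\xi)$ for all $\eta,\xi$. A (possibly signed) measure is called reversible if it satisfies detailed balance. **Functions.** Let $(a)_n=a(a+1)\cdots(a+n-1)$. The Hahn and Krawtchouk polynomials are $$\hat P_n(x;\alpha,\beta,N)={}_3F_2\!\left(\begin{smallmatrix}-n,\;n+\alpha+\beta+1,\;-x\\ \alpha+1,\;-N\end{smallmatrix};1\right),\qquad \hat K_n(x;p,N)={}_2F_1\!\left(\begin{smallmatrix}-n,\;-x\\ -N\end{smallmatrix};\tfrac1p\right).$$ Put $$\hat p(n,x;\lambda,\rho,v,N)=\frac{(\frac12(\rho+\lambda-N+v+1))_x\,(n+\frac12(\lambda-\rho-N+1+v))_N}{(-x+\frac12(\lambda-\rho+N+1+v))_{x+n}}\,\hat P_x\big(n;\tfrac12(\rho+\lambda-N+v-1),\tfrac12(\rho-\lambda-N-v-1),N\big),$$ $$\hat P^v_{\mathsf R}(\eta,\xi)=\prod_{k=1}^M\hat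 p(\eta_k,\xi_k;h^-_{k-1,0}(\eta),h^+_{k+1}(\xi),v,N_k),\qquad \hat K^v(\eta,\xi)=\prod_{k=1}^M v^{-\eta_k/2}\hat K_{\eta_k}\big(\xi_k;\tfrac1{1+v},N_k\big),$$ $$\hat w(\eta)=\prod_k\binom{N_k}{\eta_k},\qquad \hat W_{\mathsf R}(\xi)=\prod_k\hat W(\xi_k;N_k,h^+_{k+1}(\xi)),\qquad \hat W(x;N,\rho)=(-1)^x\frac{2x+\rho-N}{\rho-N}\,\frac{(\rho-N)_x}{(\rho+1)_x(-\rho)_N}\binom Nx,$$ $$\hat\omega^{\mathrm p}(x)=\frac{(-1)^x(\frac12(\rho-|\vec N|+v+1))_x}{(x+\frac12(v-\rho-|\vec N|+1))_{|\vec N|-x}},\qquad \hat\omega^{\mathrm p}_{\mathsf R}(x)=\frac{(-x+\frac12(v-\rho+|\vec N|+1))_x}{(\frac12(v+\rho-|\vec N|+1))_x},\qquad \hat\omega^{\mathrm k}(x)=\frac{v^{-x}}{(1+\frac1v)^{|\vec N|}}.$$ The functions before the limit, for $q>0$, $q\ne1$, are as follows. Let $(a;q)_n=\prod_{i=0}^{n-1}(1-aq^i)$,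 let $\binom{N}{x}_{q}=\frac{(q;q)_N}{(q;q)_x(q;q)_{N-x}}$, and let ${}_3\varphi_2$ be the usual $q$-hypergeometric series. With the $q$-Hahn polynomial $P_n(x;\alpha,\beta,N;q)={}_3\varphi_2(q^{-n},\alpha\beta q^{n+1},q^{-x};\alpha q,q^{-N};q,q)$ and the $q$-Krawtchouk polynomial $K_n(x;c,N;q)={}_3\varphi_2(q^{-n},q^{-x},-cq^{x-N};q^{-N},0;q,q)$ put $$p(n,x;\lambda,\rho,v,N;q)=v^n\frac{(-vq^{\rho+\lambda-N+1};q^2)_x(vq^{2n-\rho+\lambda-N+1};q^2)_N}{q^{n(n+\rho+\lambda-N)}(vq^{-2x-\rho+\lambda+N+1};q^2)_{x+n}}P_x(n;-vq^{\rho+\lambda-N-1},v^{-1}q^{\rho-\lambda-N-1},N;q^2),$$ $$P^v_{\mathsf R}(\eta,\xi)=\prod_k p(\eta_k,\xi_k;h^-_{k-1,0}(\eta),h^+_{k+1}(\xi),v,N_k;q),$$ $$K_{\mathsf R}(\eta,\xi)=q^{-\frac12\sum_k(\eta_kN_k-2\eta_k\sum_{j\le k}N_j)}\prod_k(-1)^{\eta_k}q^{-\eta_kh^+_{k+1}(\xi)}q^{\frac12\eta_k(N_k-1)}K_{\eta_k}(\xi_k;q^{2h^+_{k+1}(\xi)},N_k;q^2),$$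 $$W(x;N,\rho;q)=\frac{1+q^{4x+2\rho-2N}}{1+q^{2\rho-2N}}\,\frac{(-q^{2\rho-2N};q^2)_x}{(-q^{2\rho+2};q^2)_x}\,\frac{q^{-x(2\rho+1+x-2N)}}{(-q^{-2\rho};q^2)_N}\binom{N}{x}_{q^2},\qquad W_{\mathsf R}(\xi)=\prod_kW(\xi_k;N_k,h^+_{k+1}(\xi);q).$$ **(i)** Let $\rho,v\in\mathbb R$ be such that no denominator vanishes in the one-site functions $\hat p$ occurring in $\hat P^v_{\mathsf R}$ and in $\hat\omega^{\mathrm p},\hat\omega^{\mathrm p}_{\mathsf R}$, i.e. $v+\rho-|\vec N|+1+2j\ne0$ for integers $0\le j<|\vec N|$, and $v-\rho-|\vec N|+1+2j\neq0$ for integers $0\le j<|\vec N|+\max_kN_k$. Then: * $\hat P^v_{\mathsf R}(\eta,\xi)=\lim_{q\to1}(1-q^2)^{|\eta|-|\vec N|}P^{iq^v}_{\mathsf R}(\eta,\xi)$ for all $\eta,\xi\in X$, where $\rho$ is replaced by $\rho+\frac{i\pi}{2\ln q}$ in $P^{iq^v}_{\mathsf R}$. * If the rates of $\mathrm{SSEP}_{\mathsf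 R}(\vec N,\rho)$ have no vanishing denominator for any jump that can occur (as is the case if $|\rho|>|\vec N|$), then $\hat P^v_{\mathsf R}$ is a duality function between $\mathrm{SEP}(\vec N)$ and $\mathrm{SSEP}_{\mathsf R}(\vec N,\rho)$. * If $\rho\notin\{-|\vec N|,-|\vec N|+1,\dots,|\vec N|\}$ (so that no denominator or factor of $\hat W_{\mathsf R}$ vanishes), then $\hat W_{\mathsf R}=\lim_{q\to1}(1-q^2)^{|\vec N|}W_{\mathsf R}$ with $\rho$ replaced by $\rho+\frac{i\pi}{2\ln q}$ in $W_{\mathsf R}$; the measures $\hat\omega^{\mathrm p}(|\eta|)\hat w(\eta)$ and $\hat\omega^{\mathrm p}_{\mathsf R}(|\xi|)\hat W_{\mathsf R}(\xi)$ are reversible for $\mathrm{SEP}(\vec N)$ and $\mathrm{SSEP}_{\mathsf R}(\vec N,\rho)$, respectively; and $$\sum_{\eta\in X}\hat P^v_{\mathsf R}(\eta,\xi)\hat P^v_{\mathsf R}(\eta,\xi')\,\hat\omega^{\mathrm p}(|\eta|)\hat w(\eta)=\frac{\delta_{\xi,\xi'}}{\hat\omega^{\mathrm p}_{\mathsf R}(|\xi|)\hat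 W_{\mathsf R}(\xi)},\qquad \sum_{\xi\in X}\hat P^v_{\mathsf R}(\eta,\xi)\hat P^v_{\mathsf R}(\eta',\xi)\,\hat\omega^{\mathrm p}_{\mathsf R}(|\xi|)\hat W_{\mathsf R}(\xi)=\frac{\delta_{\eta,\eta'}}{\hat\omega^{\mathrm p}(|\eta|)\hat w(\eta)}.$$ **(ii)** Let $v>0$. Then: * $\hat K^v(\eta,\xi)=\lim_{q\to1}(-1)^{|\eta|}K_{\mathsf R}(\eta,\xi)$ for all $\eta,\xi\in X$, where $\rho=\frac12\log_q(v)$ in $K_{\mathsf R}$. * $\hat K^v$ is a self-duality function for $\mathrm{SEP}(\vec N)$. * The measures $\hat w(\eta)$ and $\hat\omega^{\mathrm k}(|\xi|)\hat w(\xi)$ are reversible for $\mathrm{SEP}(\vec N)$, and $$\sum_{\eta\in X}\hat K^v(\eta,\xi)\hat K^v(\eta,\xi')\hat w(\eta)=\frac{\delta_{\xi,\xi'}}{\hat\omega^{\mathrm k}(|\xi|)\hat w(\xi)},\qquad \sum_{\xi\in X}\hat K^v(\eta,\xi)\hat K^v(\eta',\xi)\hat\omega^{\mathrm k}(|\xi|)\hat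 w(\xi)=\frac{\delta_{\eta,\eta'}}{\hat w(\eta)}.$$ -/

import Mathlib

open scoped Topology

noncomputable section

namespace ExclusionDuality

/-! ## Configurations and heights

The `M` sites are indexed by `Fin M`, that is by `0, …, M - 1`. -/

/-- The state space `{0, …, N_1} × ⋯ × {0, …, N_M}`. -/
abbrev Conf {M : ℕ} (N : Fin M → ℕ) : Type := (k : Fin M) → Fin (N k + 1)

/-- The total number of particles `|η|`. -/
def total {M : ℕ} {N : Fin M → ℕ} (η : Conf N) : ℕ := ∑ k, (η k : ℕ)

/-- The total capacity `|N|`. -/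
def capacity {M : ℕ} (N : Fin M → ℕ) : ℕ := ∑ k, N k

/-- The right height function: `ρ` plus the sum of `2 ξ_j - N_j` over the sites `j` with (0-based)
index at least `k`. So `hPlus ρ ξ k` is the height at the site `k : Fin M`, `hPlus ρ ξ (k + 1)` is
the height at its right neighbour, and `hPlus ρ ξ M = ρ`. -/
def hPlus {R : Type*} [Ring R] {M : ℕ} {N : Fin M → ℕ} (ρ : R) (ξ : Conf N) (k : ℕ) : R :=
  ρ + ∑ j : Fin M, if k ≤ (j : ℕ) then 2 * ((ξ j : ℕ) : R) - (N j : R) else 0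

/-- The left height function: `lam` plus the sum of `2 η_j - N_j` over the first `k` sites. So for
a site `k : Fin M`, `hMinus lam η k` is the height at its left neighbour, and
`hMinus lam η 0 = lam`. -/
def hMinus {R : Type*} [Ring R] {M : ℕ} {N : Fin M → ℕ} (lam : R) (η : Conf N) (k : ℕ) : R :=
  lam + ∑ j : Fin M, if (j : ℕ) < k then 2 * ((η j : ℕ) : R) - (N j : R) else 0

/-! ## The processes -/

/-- The configuration after one particle has moved from site `k` to site `l` (`k ≠ l`). It is
used only with a jump rate that vanishes if site `k` is empty or site `l` is full. -/
def move {M : ℕ} {N : Fin M → ℕ} (η : Conf N) (k l : Fin M) : Conf N := fun j =>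
  if j = k then ⟨(η j : ℕ) - 1, lt_of_le_of_lt (Nat.sub_le _ _) (η j).isLt⟩
  else if j = l then ⟨min ((η j : ℕ) + 1) (N j), Nat.lt_succ_of_le (min_le_right _ _)⟩
  else η j

/-- The Markov generator of the nearest neighbour particle system in which, for neighbouring sites
`l = k + 1`, a particle jumps from `k` to `l` at rate `right η k l` and from `l` to `k` at rate
`left η k l`. -/
def jumpGenerator {M : ℕ} {N : Fin M → ℕ} (right left : Conf N → Fin M → Fin M → ℝ)
    (f : Conf N → ℝ) (η : Conf N) : ℝ :=
  ∑ k : Fin M, ∑ l : Fin M,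
    if (l : ℕ) = (k : ℕ) + 1 then
      right η k l * (f (move η k l) - f η) + left η k l * (f (move η l k) - f η)
    else 0

/-- The generator of the symmetric exclusion process `SEP(N)`. -/
def sepGenerator {M : ℕ} (N : Fin M → ℕ) : (Conf N → ℝ) → Conf N → ℝ :=
  jumpGenerator
    (fun η k l => ((η k : ℕ) : ℝ) * ((N l : ℝ) - ((η l : ℕ) : ℝ)))
    (fun η k l => ((η l : ℕ) : ℝ) * ((N k : ℝ) - ((η k : ℕ) : ℝ)))

/-- The rate of `SSEP_R(N, ρ)` for a jump to the right, from `k` to `l = k + 1`. -/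
def dynRight {M : ℕ} {N : Fin M → ℕ} (ρ : ℝ) (ξ : Conf N) (k l : Fin M) : ℝ :=
  ((ξ k : ℕ) : ℝ) * ((N l : ℝ) - ((ξ l : ℕ) : ℝ)) *
    (hPlus ρ ξ k - ((ξ k : ℕ) : ℝ)) * (hPlus ρ ξ l - ((ξ l : ℕ) : ℝ)) /
    (hPlus ρ ξ l * (hPlus ρ ξ l + 1))

/-- The rate of `SSEP_R(N, ρ)` for a jump to the left, from `l = k + 1` to `k`. -/
def dynLeft {M : ℕ} {N : Fin M → ℕ} (ρ : ℝ) (ξ : Conf N) (k l : Fin M) : ℝ :=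
  ((ξ l : ℕ) : ℝ) * ((N k : ℝ) - ((ξ k : ℕ) : ℝ)) *
    (hPlus ρ ξ l + ((ξ k : ℕ) : ℝ)) * (hPlus ρ ξ ((l : ℕ) + 1) + ((ξ l : ℕ) : ℝ)) /
    (hPlus ρ ξ l * (hPlus ρ ξ l - 1))

/-- The generator of the dynamic symmetric exclusion process `SSEP_R(N, ρ)`. -/
def dynGenerator {M : ℕ} (N : Fin M → ℕ) (ρ : ℝ) : (Conf N → ℝ) → Conf N → ℝ :=
  jumpGenerator (dynRight ρ) (dynLeft ρ)

/-- The rates of `SSEP_R(N, ρ)` have no vanishing denominator for any jump that can occur. -/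
def DynRatesDefined {M : ℕ} (N : Fin M → ℕ) (ρ : ℝ) : Prop :=
  ∀ (ξ : Conf N) (k l : Fin M), (l : ℕ) = (k : ℕ) + 1 →
    (0 < (ξ k : ℕ) → (ξ l : ℕ) < N l → hPlus ρ ξ l ≠ 0 ∧ hPlus ρ ξ l + 1 ≠ 0) ∧
    (0 < (ξ l : ℕ) → (ξ k : ℕ) < N k → hPlus ρ ξ l ≠ 0 ∧ hPlus ρ ξ l - 1 ≠ 0)

/-- `D` is a duality function between the processes with generators `L` and `L'`. -/
def IsDuality {Ω Ω' : Type*} (L : (Ω → ℝ) → Ω → ℝ) (L' : (Ω' → ℝ) → Ω' → ℝ)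
    (D : Ω → Ω' → ℝ) : Prop :=
  ∀ η ξ, L (fun η' => D η' ξ) η = L' (fun ξ' => D η ξ') ξ

/-- Detailed balance: `μ` is a reversible (possibly signed) measure for the generator `L`. For
`η ≠ η'` the number `L (Pi.single η' 1) η` is the rate of the jumps from `η` to `η'`. -/
def IsReversible {Ω : Type*} [DecidableEq Ω] (L : (Ω → ℝ) → Ω → ℝ) (μ : Ω → ℝ) : Prop :=
  ∀ η η', μ η * L (Pi.single η' 1) η = μ η' * L (Pi.single η 1) η'

/-! ## Hypergeometric ingredients -/

/-- The shifted factorial `(a)_n = a (a + 1) ⋯ (a + n - 1)`. -/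
def poch (a : ℝ) (n : ℕ) : ℝ := (ascPochhammer ℝ n).eval a

/-- The Hahn polynomial, the terminating series
`₃F₂(-n, n + α + β + 1, -x; α + 1, -N; 1)`, for `n ≤ N`. -/
def hahn (n : ℕ) (x α β : ℝ) (N : ℕ) : ℝ :=
  ∑ j ∈ Finset.range (n + 1),
    poch (-(n : ℝ)) j * poch (n + α + β + 1) j * poch (-x) j /
      (poch (α + 1) j * poch (-(N : ℝ)) j * (j.factorial : ℝ))

/-- The Krawtchouk polynomial, the terminating series `₂F₁(-n, -x; -N; 1 / p)`, for `n ≤ N`. -/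
def krawtchouk (n : ℕ) (x p : ℝ) (N : ℕ) : ℝ :=
  ∑ j ∈ Finset.range (n + 1),
    poch (-(n : ℝ)) j * poch (-x) j / (poch (-(N : ℝ)) j * (j.factorial : ℝ)) * (1 / p) ^ j

/-- The `q`-shifted factorial `(a; q)_n`. -/
def qPoch {F : Type*} [Field F] (a q : F) (n : ℕ) : F := ∏ i ∈ Finset.range n, (1 - a * q ^ i)

/-- The `q`-binomial coefficient. -/
def qBinom {F : Type*} [Field F] (q : F) (n k : ℕ) : F :=
  qPoch q q n / (qPoch q q k * qPoch q q (n - k))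

/-- The `q`-Hahn polynomial `P_n(x; α, β, N; q)`, the terminating series
`₃φ₂(q^{-n}, α β q^{n+1}, q^{-x}; α q, q^{-N}; q, q)`, for `n ≤ N`. -/
def qHahn {F : Type*} [Field F] (n x : ℕ) (α β : F) (N : ℕ) (q : F) : F :=
  ∑ j ∈ Finset.range (n + 1),
    qPoch (q ^ (-(n : ℤ))) q j * qPoch (α * β * q ^ (n + 1)) q j * qPoch (q ^ (-(x : ℤ))) q j /
      (qPoch (α * q) q j * qPoch (q ^ (-(N : ℤ))) q j * qPoch q q j) * q ^ j

/-- The (dual) `q`-Krawtchouk polynomial `K_n(x; c, N; q)`, the terminating series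
`₃φ₂(q^{-n}, q^{-x}, -c q^{x-N}; q^{-N}, 0; q, q)`, for `n ≤ N`. -/
def qKrawtchouk {F : Type*} [Field F] (n x : ℕ) (c : F) (N : ℕ) (q : F) : F :=
  ∑ j ∈ Finset.range (n + 1),
    qPoch (q ^ (-(n : ℤ))) q j * qPoch (q ^ (-(x : ℤ))) q j *
        qPoch (-c * q ^ ((x : ℤ) - (N : ℤ))) q j /
      (qPoch (q ^ (-(N : ℤ))) q j * qPoch (0 : F) q j * qPoch q q j) * q ^ j

/-! ## Duality functions and weights before the limit `q → 1` -/

/-- The one-site duality function `p(n, x; lam, ρ, v, N; q)`, for complex parameters. -/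
def pSite (n x : ℕ) (lam ρ v : ℂ) (N : ℕ) (q : ℝ) : ℂ :=
  v ^ n *
    (qPoch (-v * (q : ℂ) ^ (ρ + lam - N + 1)) ((q : ℂ) ^ 2) x *
      qPoch (v * (q : ℂ) ^ (2 * n - ρ + lam - N + 1)) ((q : ℂ) ^ 2) N) /
    ((q : ℂ) ^ ((n : ℂ) * (n + ρ + lam - N)) *
      qPoch (v * (q : ℂ) ^ (-2 * x - ρ + lam + N + 1)) ((q : ℂ) ^ 2) (x + n)) *
    qHahn x n (-v * (q : ℂ) ^ (ρ + lam - N - 1)) (v⁻¹ * (q : ℂ) ^ (ρ - lam - N - 1)) N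
      ((q : ℂ) ^ 2)

/-- The duality function `P_R^v` between `ASEP(q, N)` and `ASEP_R(q, N, ρ)`, a nested product of
`q`-Hahn polynomials, for complex parameters. -/
def PR {M : ℕ} (N : Fin M → ℕ) (ρ v : ℂ) (q : ℝ) (η ξ : Conf N) : ℂ :=
  ∏ k : Fin M, pSite (η k) (ξ k) (hMinus (0 : ℂ) η k) (hPlus ρ ξ ((k : ℕ) + 1)) v (N k) q

/-- The exponent `u(η; N) = ∑_k (η_k N_k - 2 η_k ∑_{j ≤ k} N_j)`. -/
def uExp {M : ℕ} {N : Fin M → ℕ} (η : Conf N) : ℝ :=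
  ∑ k : Fin M, (((η k : ℕ) : ℝ) * (N k : ℝ) -
    2 * ((η k : ℕ) : ℝ) * ∑ j : Fin M, if j ≤ k then (N j : ℝ) else 0)

/-- The one-site duality function `k(n, x; ρ, N; q)`. -/
def kSite (n x : ℕ) (ρ : ℝ) (N : ℕ) (q : ℝ) : ℝ :=
  (-1) ^ n * q ^ (-(n : ℝ) * ρ) * q ^ ((n : ℝ) * ((N : ℝ) - 1) / 2) *
    qKrawtchouk n x (q ^ (2 * ρ)) N (q ^ 2)

/-- The duality function `K_R` between `ASEP(q, N)` and `ASEP_R(q, N, ρ)`, a nested product of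
`q`-Krawtchouk polynomials. -/
def KR {M : ℕ} (N : Fin M → ℕ) (ρ q : ℝ) (η ξ : Conf N) : ℝ :=
  q ^ (-uExp η / 2) *
    ∏ k : Fin M, kSite (η k) (ξ k) (hPlus ρ ξ ((k : ℕ) + 1)) (N k) q

/-- The one-site weight `W(x; N, ρ; q)`, for complex `ρ`. -/
def WSite (x N : ℕ) (ρ : ℂ) (q : ℝ) : ℂ :=
  (1 + (q : ℂ) ^ (4 * x + 2 * ρ - 2 * N)) / (1 + (q : ℂ) ^ (2 * ρ - 2 * N)) *
    (qPoch (-(q : ℂ) ^ (2 * ρ - 2 * N)) ((q : ℂ) ^ 2) x /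
      qPoch (-(q : ℂ) ^ (2 * ρ + 2)) ((q : ℂ) ^ 2) x) *
    ((q : ℂ) ^ (-(x : ℂ) * (2 * ρ + 1 + x - 2 * N)) /
      qPoch (-(q : ℂ) ^ (-2 * ρ)) ((q : ℂ) ^ 2) N) *
    qBinom ((q : ℂ) ^ 2) N x

/-- The reversible measure `W_R` of `ASEP_R(q, N, ρ)`, for complex `ρ`. -/
def WR {M : ℕ} (N : Fin M → ℕ) (ρ : ℂ) (q : ℝ) (ξ : Conf N) : ℂ :=
  ∏ k : Fin M, WSite (ξ k) (N k) (hPlus ρ ξ ((k : ℕ) + 1)) q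

/-- The shifted dynamic parameter `ρ + i π / (2 log q)`. It replaces `q^{2ρ}` by `-q^{2ρ}`. -/
def shiftedRho (ρ q : ℝ) : ℂ := (ρ : ℂ) + Complex.I * Real.pi / (2 * Real.log q)

/-! ## Duality functions and weights in the symmetric case -/

/-- The one-site Hahn duality function. -/
def pHat (n x : ℕ) (lam ρ v : ℝ) (N : ℕ) : ℝ :=
  poch ((ρ + lam - N + v + 1) / 2) x * poch (n + (lam - ρ - N + 1 + v) / 2) N /
      poch (-x + (lam - ρ + N + 1 + v) / 2) (x + n) *
    hahn x n ((ρ + lam - N + v - 1) / 2) ((ρ - lam - N - v - 1) / 2) N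

/-- The nested product of Hahn polynomials. -/
def PHat {M : ℕ} (N : Fin M → ℕ) (ρ v : ℝ) (η ξ : Conf N) : ℝ :=
  ∏ k : Fin M, pHat (η k) (ξ k) (hMinus (0 : ℝ) η k) (hPlus ρ ξ ((k : ℕ) + 1)) v (N k)

/-- The one-site Krawtchouk duality function. -/
def kHat (n x : ℕ) (v : ℝ) (N : ℕ) : ℝ :=
  v ^ (-(n : ℝ) / 2) * krawtchouk n x (1 / (1 + v)) N

/-- The product of Krawtchouk polynomials. -/
def KHat {M : ℕ} (N : Fin M → ℕ) (v : ℝ) (η ξ : Conf N) : ℝ :=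
  ∏ k : Fin M, kHat (η k) (ξ k) v (N k)

/-- The product of binomial coefficients, the reversible measure of `SEP(N)`. -/
def wHat {M : ℕ} (N : Fin M → ℕ) (η : Conf N) : ℝ :=
  ∏ k : Fin M, ((N k).choose (η k : ℕ) : ℝ)

/-- The one-site weight of the dynamic process. -/
def WHatSite (x N : ℕ) (ρ : ℝ) : ℝ :=
  (-1) ^ x * ((2 * x + ρ - N) / (ρ - N)) *
    (poch (ρ - N) x / (poch (ρ + 1) x * poch (-ρ) N)) * (N.choose x : ℝ)

/-- The reversible measure of `SSEP_R(N, ρ)`. -/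
def WHatR {M : ℕ} (N : Fin M → ℕ) (ρ : ℝ) (ξ : Conf N) : ℝ :=
  ∏ k : Fin M, WHatSite (ξ k) (N k) (hPlus ρ ξ ((k : ℕ) + 1))

/-- The factor in front of `wHat` in the Hahn case, as a function of the number `x` of particles
and of the capacity `S`. -/
def omegaP (S : ℕ) (ρ v : ℝ) (x : ℕ) : ℝ :=
  (-1) ^ x * poch ((ρ - S + v + 1) / 2) x / poch (x + (v - ρ - S + 1) / 2) (S - x)

/-- The factor in front of `WHatR` in the Hahn case. -/
def omegaPR (S : ℕ) (ρ v : ℝ) (x : ℕ) : ℝ :=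
  poch (-x + (v - ρ + S + 1) / 2) x / poch ((v + ρ - S + 1) / 2) x

/-- The factor in front of `wHat` in the Krawtchouk case. -/
def omegaK (S : ℕ) (v : ℝ) (x : ℕ) : ℝ := v ^ (-(x : ℤ)) / (1 + 1 / v) ^ S

/-- The parameters are such that no denominator vanishes in the one-site Hahn duality functions
and in the factors `omegaP`, `omegaPR`. -/
def HahnGeneric {M : ℕ} (N : Fin M → ℕ) (ρ v : ℝ) : Prop :=
  (∀ j : ℕ, j < capacity N → v + ρ - capacity N + 1 + 2 * j ≠ 0) ∧
  ∀ (k : Fin M) (j : ℕ), j < capacity N + N k → v - ρ - capacity N + 1 + 2 * j ≠ 0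

end ExclusionDuality

end

open ExclusionDuality

noncomputable section

namespace ExclusionDuality

/-! ## Shifted factorials -/

-- The theorem comes down to one-site identities for Hahn and Krawtchouk polynomials. The Hahn
-- polynomials enter with their denominators cleared, as `hahnQ N n x c a`, which is polynomial in
-- `c` and `a`. Identities are proved for non-integral parameters and extended by continuity
-- (`eq_of_eq_nonInt`).
--
-- Duality. In `PHat` the prefactors telescope over the sites, leaving a function of `|η|` times a
-- function of `|ξ|` times the nested product `hahnProd` (`PHat_eq_hahnProd`). Both dynamics
-- conserve particles, so only `hahnProd` matters, and a jump between two neighbouring sites changes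
-- only the two factors at these sites (`hahnProd_localChange`). What remains is a two-site
-- identity, `twoSite_duality`. At the right site, the three quantities met on the SEP side are
-- combinations of the polynomials of degrees `x + 1`, `x`, `x - 1` (`mul_hahnQ`, `mul_hahnQ_pred`,
-- `sub_mul_hahnQ_add_one`). The coefficients that result at the left site are governed by the
-- lowering relation, the difference equation and the raising relation (`hahnQ_lower`,
-- `hahnQ_difference`, `hahnQ_raise`). The dynamic rates are products of the coefficients in these
-- relations. All of them are verified coefficientwise in the basis `C(n, j) / C(N, j)`, where
-- multiplication by `n` and the weighted shifts of `n` have at most three bands. The Krawtchouk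
-- case is the same with an ordinary product (`krawQ_duality`).
--
-- Orthogonality. For one site it follows from the three-term recurrence and from orthogonality to
-- the constants (`orthogonal_of_recurrence`), the latter by Chu–Vandermonde for Hahn and by the
-- binomial theorem for Krawtchouk. For the nested product the last site is summed out: its norm
-- depends on the other sites only through their particle number, and it turns their weight into the
-- weight with the shifted parameters that the remaining factors carry (`hahnProd_orthogonal`). The
-- second relation says that a left inverse of a square matrix is a right inverse
-- (`dual_orthogonality`).
--
-- Reversibility is detailed balance across one bond. The limits hold factor by factor: a
-- `q`-shifted factorial of length `n` divided by `(1 - q^2)^n` tends to a shifted factorial, and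
-- the shift of `ρ` contributes powers of `i` that cancel those of `i q^v` (`pSite_shift`,
-- `WSite_shift`).

@[simp] lemma poch_zero (a : ℝ) : poch a 0 = 1 := by simp [poch]

@[simp] lemma poch_one (a : ℝ) : poch a 1 = a := by simp [poch]

lemma poch_succ (a : ℝ) (n : ℕ) : poch a (n + 1) = poch a n * (a + n) := by
  simp [poch, ascPochhammer_succ_eval]

lemma poch_add (a : ℝ) (m n : ℕ) : poch a (m + n) = poch a m * poch (a + m) n := by
  induction n with
  | zero => simp
  | succ n ih => rw [← add_assoc, poch_succ, poch_succ, ih]; push_cast; ring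

lemma poch_succ_left (a : ℝ) (n : ℕ) : poch a (n + 1) = a * poch (a + 1) n := by
  rw [add_comm n 1, poch_add]; simp

lemma poch_eq_prod (a : ℝ) (n : ℕ) : poch a n = ∏ i ∈ Finset.range n, (a + i) := by
  induction n with
  | zero => simp
  | succ n ih => rw [poch_succ, Finset.prod_range_succ, ih]

lemma poch_ne_zero {a : ℝ} {n : ℕ} (h : ∀ i : ℕ, i < n → a + i ≠ 0) : poch a n ≠ 0 := by
  rw [poch_eq_prod]
  exact Finset.prod_ne_zero_iff.2 fun i hi => h i (Finset.mem_range.1 hi)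

lemma poch_neg_natCast_of_lt {x n : ℕ} (h : x < n) : poch (-(x : ℝ)) n = 0 := by
  rw [poch_eq_prod]
  exact Finset.prod_eq_zero (Finset.mem_range.2 h) (by simp)

@[fun_prop] lemma continuous_poch (n : ℕ) : Continuous fun a : ℝ => poch a n :=
  (ascPochhammer ℝ n).continuous

/-- A real number that is not an integer. -/
def NonInt (a : ℝ) : Prop := ∀ z : ℤ, a ≠ z

lemma NonInt.add_int {a : ℝ} (h : NonInt a) (z : ℤ) : a + z ≠ 0 := fun e =>
  h (-z) (by push_cast; linarith)

lemma NonInt.poch_ne_zero {a : ℝ} (h : NonInt a) (n : ℕ) : poch a n ≠ 0 :=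
  ExclusionDuality.poch_ne_zero fun i _ => by exact_mod_cast h.add_int i

lemma NonInt.shift {a b : ℝ} (h : NonInt a) (z : ℤ) (hb : b = a + z) : NonInt b := fun y e =>
  h (y - z) (by push_cast; linarith)

/-- The integers are countable, so their complement is dense. This removes genericity assumptions
from identities between functions continuous in a parameter. -/
lemma eq_of_eq_nonInt {f g : ℝ → ℝ} {x : ℝ} (hf : ContinuousAt f x) (hg : ContinuousAt g x)
    (h : ∀ y, NonInt y → f y = g y) : f x = g x := by
  have hd : Dense (Set.range ((↑) : ℤ → ℝ))ᶜ := (Set.countable_range _).dense_compl ℝ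
  have hne : (𝓝[(Set.range ((↑) : ℤ → ℝ))ᶜ] x).NeBot := mem_closure_iff_nhdsWithin_neBot.1 (hd x)
  refine tendsto_nhds_unique (f := f)
    (l := 𝓝[(Set.range ((↑) : ℤ → ℝ))ᶜ] x) (hf.mono_left nhdsWithin_le_nhds)
    (Filter.Tendsto.congr' ?_ (hg.mono_left nhdsWithin_le_nhds))
  filter_upwards [self_mem_nhdsWithin] with y hy
  exact (h y fun z e => hy ⟨z, e.symm⟩).symm

/-! ## Normalized binomial coefficients as functions of the number of particles -/

/-- The function `n ↦ C(n, j) / C(N, j)`, which equals `(-n)_j / (-N)_j`. -/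
def uBasis (N n j : ℕ) : ℝ := (n.choose j : ℝ) / (N.choose j : ℝ)

@[simp] lemma uBasis_zero (N n : ℕ) : uBasis N n 0 = 1 := by simp [uBasis]

lemma uBasis_of_lt {N n j : ℕ} (h : n < j) : uBasis N n j = 0 := by
  simp [uBasis, Nat.choose_eq_zero_of_lt h]

lemma cast_choose_succ (n j : ℕ) :
    ((n.choose (j + 1) : ℕ) : ℝ) * (j + 1) = (n.choose j : ℕ) * ((n : ℝ) - j) := by
  rcases lt_or_ge n j with h | h
  · simp [Nat.choose_eq_zero_of_lt h, Nat.choose_eq_zero_of_lt (Nat.lt_succ_of_lt h)]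
  · have := Nat.choose_succ_right_eq n j
    rw [← Nat.cast_sub h]
    exact_mod_cast this

lemma choose_cast_ne_zero {N j : ℕ} (h : j ≤ N) : (N.choose j : ℝ) ≠ 0 :=
  Nat.cast_ne_zero.2 (Nat.choose_pos h).ne'

/-- The basic recursion `(N - j) u_{j+1}(n) = (n - j) u_j(n)`. -/
lemma sub_mul_uBasis_succ {N n j : ℕ} (hn : n ≤ N) (hj : j ≤ N) :
    ((N : ℝ) - j) * uBasis N n (j + 1) = ((n : ℝ) - j) * uBasis N n j := by
  rcases hj.eq_or_lt with rfl | hj'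
  · rcases hn.eq_or_lt with rfl | hn'
    · simp
    · simp [uBasis_of_lt hn']
  · have h1 := cast_choose_succ n j
    have h2 := cast_choose_succ N j
    have h3 := choose_cast_ne_zero hj
    have h4 := choose_cast_ne_zero (N := N) (j := j + 1) hj'
    have h5 : (j : ℝ) + 1 ≠ 0 := by positivity
    unfold uBasis
    field_simp
    have : ((j : ℝ) + 1) * ((N - j) * (n.choose (j + 1) : ℝ) * (N.choose j : ℝ)) =
        ((j : ℝ) + 1) * ((n.choose j : ℝ) * (n - j) * (N.choose (j + 1) : ℝ)) := by
      linear_combination ((N - j) * (N.choose j : ℝ)) * h1 - (n.choose j : ℝ) * (n - j) * h2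
    have := mul_left_cancel₀ h5 this
    linear_combination this

/-- This and the next two identities give the action of `n`, of `n` times the shift down and of `N -
n` times the shift up on the basis. The weights `n` and `N - n` vanish exactly where the shift would
leave `{0, …, N}`. -/
lemma mul_uBasis {N n j : ℕ} (hn : n ≤ N) (hj : j ≤ N) :
    (n : ℝ) * uBasis N n j = j * uBasis N n j + (N - j) * uBasis N n (j + 1) := by
  rw [sub_mul_uBasis_succ hn hj]; ring

lemma mul_uBasis_pred {N n j : ℕ} (hn : n ≤ N) (hj : j ≤ N) :
    (n : ℝ) * uBasis N (n - 1) j = (N - j) * uBasis N n (j + 1) := by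
  rw [sub_mul_uBasis_succ hn hj]
  cases n with
  | zero =>
    cases j with
    | zero => simp
    | succ j => simp [uBasis_of_lt]
  | succ n =>
    have h1 := cast_choose_succ n j
    have h2 : ((n + 1).choose (j + 1) : ℝ) * (j + 1) = (n + 1) * n.choose j := by
      exact_mod_cast (Nat.add_one_mul_choose_eq n j).symm
    have h3 := cast_choose_succ (n + 1) j
    have h4 := choose_cast_ne_zero hj
    simp only [uBasis, Nat.add_sub_cancel]
    field_simp
    push_cast at *
    linarith

lemma sub_mul_uBasis_add_one {N n j : ℕ} (hn : n ≤ N) (hj : j ≤ N) :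
    ((N : ℝ) - n) * uBasis N (n + 1) j =
      (N - 2 * j) * uBasis N n j - (N - j) * uBasis N n (j + 1) + j * uBasis N n (j - 1) := by
  rw [sub_mul_uBasis_succ hn hj]
  cases j with
  | zero => simp
  | succ j =>
    have h1 := sub_mul_uBasis_succ (j := j) hn (by omega)
    have h2 : uBasis N (n + 1) (j + 1) * (N - j) = (n + 1) * uBasis N n j := by
      have h3 : ((n + 1).choose (j + 1) : ℝ) * (j + 1) = (n + 1) * n.choose j := by
        exact_mod_cast (Nat.add_one_mul_choose_eq n j).symm
      have h4 := cast_choose_succ N j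
      have h5 := choose_cast_ne_zero (N := N) (j := j) (by omega)
      have h6 := choose_cast_ne_zero hj
      have h7 : (j : ℝ) + 1 ≠ 0 := by positivity
      unfold uBasis
      field_simp
      apply mul_left_cancel₀ h7
      linear_combination ((N : ℝ) - j) * N.choose j * h3 - (n + 1) * n.choose j * h4
    have h8 : ((N : ℝ) - j) ≠ 0 := by
      have : (j : ℝ) + 1 ≤ N := by exact_mod_cast hj
      intro h; linarith
    apply mul_left_cancel₀ h8
    simp only [Nat.add_sub_cancel]
    push_cast
    linear_combination ((N : ℝ) - n) * h2 - (N - n - j - 1) * h1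

/-- The values at `n` of the linear combination of the functions `uBasis N · j` with
coefficients `h j`. -/
def uSum (N n : ℕ) (h : ℕ → ℝ) : ℝ := ∑ j ∈ Finset.range (N + 1), h j * uBasis N n j

/-- The sequence `h` moved by one place, with a zero in front. -/
def shiftSeq (h : ℕ → ℝ) : ℕ → ℝ
  | 0 => 0
  | j + 1 => h j

@[simp] lemma shiftSeq_zero (h : ℕ → ℝ) : shiftSeq h 0 = 0 := rfl
@[simp] lemma shiftSeq_succ (h : ℕ → ℝ) (j : ℕ) : shiftSeq h (j + 1) = h j := rfl

/-- The factor `N - j` kills the term `j = N`, so raising the index does not leave the range of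
summation. -/
lemma sum_sub_mul_uBasis_succ (N n : ℕ) (h : ℕ → ℝ) :
    ∑ j ∈ Finset.range (N + 1), h j * ((N - j) * uBasis N n (j + 1)) =
      uSum N n fun j => (N - j + 1) * shiftSeq h j := by
  rw [uSum, Finset.sum_range_succ, Finset.sum_range_succ']
  simp only [sub_self, zero_mul, mul_zero, add_zero, shiftSeq_zero, shiftSeq_succ]
  refine Finset.sum_congr rfl fun j _ => ?_
  push_cast; ring

lemma mul_uSum {N n : ℕ} (hn : n ≤ N) (h : ℕ → ℝ) :
    (n : ℝ) * uSum N n h = uSum N n fun j => j * h j + (N - j + 1) * shiftSeq h j := by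
  have : uSum N n (fun j => j * h j + (N - j + 1) * shiftSeq h j) =
      uSum N n (fun j => j * h j) + uSum N n fun j => (N - j + 1) * shiftSeq h j := by
    simp only [uSum, ← Finset.sum_add_distrib, add_mul]
  rw [this, ← sum_sub_mul_uBasis_succ, uSum, uSum, Finset.mul_sum, ← Finset.sum_add_distrib]
  refine Finset.sum_congr rfl fun j hj => ?_
  have := mul_uBasis hn (Finset.mem_range_succ_iff.1 hj)
  linear_combination h j * this

lemma mul_uSum_pred {N n : ℕ} (hn : n ≤ N) (h : ℕ → ℝ) :
    (n : ℝ) * uSum N (n - 1) h = uSum N n fun j => (N - j + 1) * shiftSeq h j := by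
  rw [← sum_sub_mul_uBasis_succ, uSum, Finset.mul_sum]
  refine Finset.sum_congr rfl fun j hj => ?_
  have := mul_uBasis_pred hn (Finset.mem_range_succ_iff.1 hj)
  linear_combination h j * this

/-- Lowering the index of the basis brings in the coefficient at `N + 1`, which `h0` removes; it
vanishes for polynomials of degree at most `N`. -/
lemma sub_mul_uSum_add_one {N n : ℕ} (hn : n ≤ N) {h : ℕ → ℝ} (h0 : h (N + 1) = 0) :
    ((N : ℝ) - n) * uSum N (n + 1) h =
      uSum N n fun j => (N - 2 * j) * h j - (N - j + 1) * shiftSeq h j + (j + 1) * h (j + 1) := by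
  have e1 : uSum N n (fun j => (N - 2 * j) * h j - (N - j + 1) * shiftSeq h j +
      (j + 1) * h (j + 1)) = uSum N n (fun j => (N - 2 * j) * h j) -
      (uSum N n fun j => (N - j + 1) * shiftSeq h j) + uSum N n fun j => (j + 1) * h (j + 1) := by
    simp only [uSum, ← Finset.sum_add_distrib, ← Finset.sum_sub_distrib, add_mul, sub_mul]
  have e2 : uSum N n (fun j => (j + 1) * h (j + 1)) =
      ∑ j ∈ Finset.range (N + 1), h j * (j * uBasis N n (j - 1)) := by
    rw [uSum, Finset.sum_range_succ, Finset.sum_range_succ']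
    simp only [h0, mul_zero, zero_mul, add_zero, Nat.cast_zero, Nat.add_sub_cancel]
    refine Finset.sum_congr rfl fun j _ => ?_
    push_cast; ring
  rw [e1, e2, ← sum_sub_mul_uBasis_succ, uSum, uSum, Finset.mul_sum, ← Finset.sum_sub_distrib,
    ← Finset.sum_add_distrib]
  refine Finset.sum_congr rfl fun j hj => ?_
  have := sub_mul_uBasis_add_one hn (Finset.mem_range_succ_iff.1 hj)
  linear_combination h j * this

lemma uSum_congr {N n : ℕ} {g h : ℕ → ℝ} (e : ∀ j, g j = h j) : uSum N n g = uSum N n h := by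
  rw [funext e]

/-! ## Contiguous relations for Hahn polynomials -/

/-- The coefficients of the Hahn polynomial `x` in the basis `uBasis`, where `c = α + β + 1` and
`a = α + 1`. -/
def hahnCoeff (x c a : ℝ) (j : ℕ) : ℝ :=
  poch (-x) j * poch (x + c) j / (poch a j * (j.factorial : ℝ))

lemma hahnCoeff_zero (x c a : ℝ) : hahnCoeff x c a 0 = 1 := by simp [hahnCoeff]

lemma hahnCoeff_succ (x c a : ℝ) (j : ℕ) : hahnCoeff x c a (j + 1) =
    hahnCoeff x c a j * ((j - x) * (x + c + j) / ((a + j) * (j + 1))) := by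
  simp only [hahnCoeff, poch_succ, Nat.factorial_succ]
  push_cast
  rw [div_mul_div_comm]
  congr 1 <;> ring

lemma hahnCoeff_natCast_of_lt {x j : ℕ} (h : x < j) (c a : ℝ) : hahnCoeff x c a j = 0 := by
  simp [hahnCoeff, poch_neg_natCast_of_lt h]

/-- Every coefficient in the contiguous relations is expressed through the single number `hahnCoeff
x c a i`; the relations then become identities of rational functions. -/
lemma hahnCoeff_add_one_succ {x c : ℝ} (hc : x + c ≠ 0) (a : ℝ) (i : ℕ) :
    hahnCoeff (x + 1) c a (i + 1) = hahnCoeff x c a i *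
      (-(x + 1) * (x + c + i) * (x + c + i + 1) / ((x + c) * ((a + i) * (i + 1)))) := by
  have h1 : poch (-(x + 1)) (i + 1) = -(x + 1) * poch (-x) i := by
    rw [poch_succ_left]; ring_nf
  have h2 : poch (x + 1 + c) (i + 1) = poch (x + c) i * (x + c + i) * (x + c + i + 1) / (x + c) := by
    rw [eq_div_iff hc]
    have := poch_succ_left (x + c) (i + 1)
    rw [poch_succ, poch_succ] at this
    rw [show x + 1 + c = x + c + 1 by ring]
    push_cast at this
    linear_combination -this
  simp only [hahnCoeff, h1, h2, poch_succ a, Nat.factorial_succ]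
  push_cast
  rw [div_mul_div_comm, mul_div_assoc', div_div]
  congr 1 <;> ring

/-- The factor `x` completes `(1 - x)_{i+1}` to `-(-x)_{i+2}`, so that `x = 0` need not be excluded.
-/
lemma mul_hahnCoeff_sub_one_succ (x c a : ℝ) (i : ℕ) :
    x * hahnCoeff (x - 1) c a (i + 1) = hahnCoeff x c a i *
      (-(i - x) * (i + 1 - x) * (x - 1 + c) / ((a + i) * (i + 1))) := by
  have h1 : x * poch (-(x - 1)) (i + 1) = -(poch (-x) i * (i - x) * (i + 1 - x)) := by
    have := poch_succ_left (-x) (i + 1)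
    rw [poch_succ, poch_succ] at this
    rw [show -(x - 1) = -x + 1 by ring]
    push_cast at this
    linear_combination this
  have h2 : poch (x - 1 + c) (i + 1) = (x - 1 + c) * poch (x + c) i := by
    rw [poch_succ_left]; ring_nf
  simp only [hahnCoeff, h2, poch_succ a, Nat.factorial_succ]
  rw [mul_div_assoc', ← mul_assoc, h1, div_mul_div_comm]
  push_cast
  congr 1 <;> ring

lemma poch_add_one_eq {a : ℝ} (ha : NonInt a) (j : ℕ) :
    poch (a + 1) j = poch a j * (a + j) / a := by
  have h : a ≠ 0 := by simpa using ha.add_int 0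
  rw [eq_div_iff h, mul_comm, ← poch_succ_left, poch_succ]

lemma hahnCoeff_param_add_one {a : ℝ} (ha : NonInt a) (x c : ℝ) (j : ℕ) :
    hahnCoeff x c (a + 1) j = hahnCoeff x c a j * (a / (a + j)) := by
  have h : a ≠ 0 := by simpa using ha.add_int 0
  have h' : a + j ≠ 0 := by exact_mod_cast ha.add_int j
  have := ha.poch_ne_zero j
  rw [hahnCoeff, poch_add_one_eq ha, hahnCoeff]
  field_simp

lemma hahnCoeff_param_sub_one {a : ℝ} (ha : NonInt a) (x c : ℝ) (j : ℕ) :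
    hahnCoeff x c (a - 1) j = hahnCoeff x c a j * ((a - 1 + j) / (a - 1)) := by
  have ha' : NonInt (a - 1) := ha.shift (-1) (by push_cast; ring)
  have h : a - 1 ≠ 0 := by simpa using ha'.add_int 0
  have h' : a - 1 + j ≠ 0 := by exact_mod_cast ha'.add_int j
  have := hahnCoeff_param_add_one ha' x c j
  rw [sub_add_cancel] at this
  rw [this]
  field_simp

/-- The leading coefficient in the three-term relations. -/
def coeffUp (N x c : ℝ) : ℝ := -((N - x) * (x + c)) / ((2 * x + c) * (2 * x + c + 1))

/-- The trailing coefficient in the three-term relations. -/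
def coeffDown (N x c : ℝ) : ℝ := x * (x + c + N) / ((2 * x + c - 1) * (2 * x + c))

lemma coeffDown_mul (N x c y : ℝ) :
    coeffDown N x c * y = (x + c + N) / ((2 * x + c - 1) * (2 * x + c)) * (x * y) := by
  rw [coeffDown]; ring

section coefficients

variable {x c a : ℝ} (N : ℝ)

/-- The left sides here and in the next two lemmas are the coefficient sequences produced by
`mul_uSum`, `mul_uSum_pred` and `sub_mul_uSum_add_one`. The right sides all use the same three
degrees and the same parameter `a`, even where the left side has `a + 1` or `a - 1`. -/
lemma hahnCoeff_mul_rec (hx : x + c ≠ 0) (h0 : 2 * x + c ≠ 0) (h1 : 2 * x + c + 1 ≠ 0)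
    (h2 : 2 * x + c - 1 ≠ 0) (ha : NonInt a) (j : ℕ) :
    j * hahnCoeff x c a j + (N - j + 1) * shiftSeq (hahnCoeff x c a) j =
      coeffUp N x c * (a + x) * hahnCoeff (x + 1) c a j -
        (coeffUp N x c * (a + x) + coeffDown N x c * (a - c - x)) * hahnCoeff x c a j +
        (a - c - x) * (coeffDown N x c * hahnCoeff (x - 1) c a j) := by
  cases j with
  | zero => simp [hahnCoeff_zero]; ring
  | succ i =>
    have h : a + i ≠ 0 := by exact_mod_cast ha.add_int i
    have h' : (i : ℝ) + 1 ≠ 0 := by positivity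
    rw [coeffDown_mul N x c (hahnCoeff _ _ _ _), mul_hahnCoeff_sub_one_succ, hahnCoeff_add_one_succ hx, hahnCoeff_succ,
      shiftSeq_succ, coeffUp, coeffDown]
    generalize hahnCoeff x c a i = T
    push_cast
    -- With `D`, `E` and `b` as independent variables, each denominator factor is one variable up to
    -- an integer shift.
    generalize hD : 2 * x + c = D at *
    generalize hE : x + c = E at *
    generalize hb : a + (i : ℝ) = b at *
    obtain rfl : x = D - E := by linarith
    obtain rfl : c = 2 * E - D := by linarith
    obtain rfl : a = b - i := by linarith
    field_simp
    ring

lemma hahnCoeff_pred_rec (hx : x + c ≠ 0) (h0 : 2 * x + c ≠ 0) (h1 : 2 * x + c + 1 ≠ 0)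
    (h2 : 2 * x + c - 1 ≠ 0) (ha : NonInt a) (j : ℕ) :
    (N - j + 1) * shiftSeq (hahnCoeff x c (a + 1)) j =
      a * (coeffUp N x c * hahnCoeff (x + 1) c a j -
        (coeffUp N x c + coeffDown N x c) * hahnCoeff x c a j +
        (coeffDown N x c * hahnCoeff (x - 1) c a j)) := by
  cases j with
  | zero => simp [hahnCoeff_zero]
  | succ i =>
    have h : a + i ≠ 0 := by exact_mod_cast ha.add_int i
    have h' : (i : ℝ) + 1 ≠ 0 := by positivity
    rw [coeffDown_mul N x c (hahnCoeff _ _ _ _), mul_hahnCoeff_sub_one_succ, hahnCoeff_add_one_succ hx, hahnCoeff_succ,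
      shiftSeq_succ, coeffUp, coeffDown, hahnCoeff_param_add_one ha]
    generalize hahnCoeff x c a i = T
    push_cast
    generalize hD : 2 * x + c = D at *
    generalize hE : x + c = E at *
    generalize hb : a + (i : ℝ) = b at *
    obtain rfl : x = D - E := by linarith
    obtain rfl : c = 2 * E - D := by linarith
    obtain rfl : a = b - i := by linarith
    field_simp
    ring

lemma hahnCoeff_add_one_rec (hx : x + c ≠ 0) (h0 : 2 * x + c ≠ 0) (h1 : 2 * x + c + 1 ≠ 0)
    (h2 : 2 * x + c - 1 ≠ 0) (ha : NonInt a) (j : ℕ) :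
    (a - 1) * ((N - 2 * j) * hahnCoeff x c (a - 1) j -
        (N - j + 1) * shiftSeq (hahnCoeff x c (a - 1)) j +
        (j + 1) * hahnCoeff x c (a - 1) (j + 1)) =
      -coeffUp N x c * (a + x) * (a + x - 1) * hahnCoeff (x + 1) c a j +
        (a + x - 1) * (a - c - x - 1) * (coeffUp N x c + coeffDown N x c) * hahnCoeff x c a j -
        (a - c - x) * (a - c - x - 1) * (coeffDown N x c * hahnCoeff (x - 1) c a j) := by
  have h3 : a - 1 ≠ 0 := by simpa [sub_eq_add_neg] using ha.add_int (-1)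
  cases j with
  | zero =>
    have h : a ≠ 0 := by simpa using ha.add_int 0
    rw [hahnCoeff_param_sub_one ha, hahnCoeff_param_sub_one ha, hahnCoeff_succ]
    simp only [hahnCoeff_zero, shiftSeq_zero, coeffUp, coeffDown]
    push_cast
    generalize hD : 2 * x + c = D at *
    obtain rfl : c = D - 2 * x := by linarith
    simp only [add_zero, zero_add]
    field_simp
    ring
  | succ i =>
    have h : a + i ≠ 0 := by exact_mod_cast ha.add_int i
    have h4 : a + i + 1 ≠ 0 := by
      have := ha.add_int (i + 1); push_cast at this; rwa [← add_assoc] at this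
    have h' : (i : ℝ) + 1 ≠ 0 := by positivity
    have h'' : (i : ℝ) + 1 + 1 ≠ 0 := by positivity
    rw [coeffDown_mul N x c (hahnCoeff _ _ _ _), mul_hahnCoeff_sub_one_succ, hahnCoeff_add_one_succ hx,
      shiftSeq_succ, coeffUp, coeffDown, hahnCoeff_param_sub_one ha, hahnCoeff_param_sub_one ha,
      hahnCoeff_param_sub_one ha]
    simp only [hahnCoeff_succ]
    generalize hahnCoeff x c a i = T
    push_cast
    generalize hD : 2 * x + c = D at *
    generalize hE : x + c = E at *
    generalize hb : a + (i : ℝ) = b at *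
    obtain rfl : x = D - E := by linarith
    obtain rfl : c = 2 * E - D := by linarith
    obtain rfl : a = b - i := by linarith
    rw [show b - i + ((i : ℝ) + 1) = b + 1 by ring]
    field_simp
    ring

end coefficients

lemma uSum_add (N n : ℕ) (g h : ℕ → ℝ) :
    uSum N n (fun j => g j + h j) = uSum N n g + uSum N n h := by
  simp only [uSum, ← Finset.sum_add_distrib, add_mul]

lemma uSum_sub (N n : ℕ) (g h : ℕ → ℝ) :
    uSum N n (fun j => g j - h j) = uSum N n g - uSum N n h := by
  simp only [uSum, ← Finset.sum_sub_distrib, sub_mul]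

lemma uSum_const_mul (N n : ℕ) (r : ℝ) (h : ℕ → ℝ) :
    uSum N n (fun j => r * h j) = r * uSum N n h := by
  simp only [uSum, Finset.mul_sum, mul_assoc]

/-- The Hahn polynomial with the denominator `(α + 1)_x` cleared, where `c = α + β + 1` and
`a = α + 1`; a polynomial in `a` and `c`. -/
def hahnQ (N n x : ℕ) (c a : ℝ) : ℝ :=
  uSum N n fun j => poch (-x) j * poch (x + c) j * poch (a + j) (x - j) / (j.factorial : ℝ)

lemma Continuous.hahnQ (N n x : ℕ) {f g : ℝ → ℝ} (hf : Continuous f) (hg : Continuous g) :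
    Continuous fun r => hahnQ N n x (f r) (g r) := by
  have key : ∀ (m : ℕ) {h : ℝ → ℝ}, Continuous h → Continuous fun r => poch (h r) m :=
    fun m h hh => (continuous_poch m).comp hh
  unfold ExclusionDuality.hahnQ uSum
  refine continuous_finsetSum _ fun j _ => ?_
  exact (((continuous_const.mul (key j (continuous_const.add hf))).mul
    (key _ (hg.add continuous_const))).div_const _).mul continuous_const

lemma continuous_hahnQ_param (N n x : ℕ) (c y : ℝ) : Continuous fun a => hahnQ N n x c (a + y) :=
  Continuous.hahnQ N n x continuous_const (continuous_id.add continuous_const)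

lemma hahnQ_eq_of_poch_ne_zero {a : ℝ} (N n : ℕ) {x : ℕ} (c : ℝ) (ha : poch a x ≠ 0) :
    hahnQ N n x c a = poch a x * uSum N n (hahnCoeff x c a) := by
  rw [hahnQ, ← uSum_const_mul]
  refine uSum_congr fun j => ?_
  rcases lt_or_ge x j with h | h
  · simp [hahnCoeff_natCast_of_lt h, poch_neg_natCast_of_lt h]
  · have h1 := poch_add a j (x - j)
    rw [Nat.add_sub_cancel' h] at h1
    rw [h1] at ha ⊢
    have := left_ne_zero_of_mul ha
    rw [hahnCoeff]
    field_simp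

lemma hahnQ_generic {a : ℝ} (ha : NonInt a) (N n x : ℕ) (c : ℝ) :
    hahnQ N n x c a = poch a x * uSum N n (hahnCoeff x c a) :=
  hahnQ_eq_of_poch_ne_zero N n c (ha.poch_ne_zero x)

lemma hahnQ_generic_succ {a : ℝ} (ha : NonInt a) (N n x : ℕ) (c : ℝ) :
    hahnQ N n (x + 1) c a = poch a x * (a + x) * uSum N n (hahnCoeff (x + 1) c a) := by
  rw [hahnQ_generic ha, poch_succ]; push_cast; rfl

lemma hahnQ_generic_pred {a : ℝ} (ha : NonInt a) (N n x : ℕ) (c : ℝ) :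
    (x : ℝ) * ((a + x - 1) * hahnQ N n (x - 1) c a) =
      x * (poch a x * uSum N n (hahnCoeff (x - 1) c a)) := by
  cases x with
  | zero => simp
  | succ x => rw [Nat.add_sub_cancel, hahnQ_generic ha, poch_succ]; push_cast; ring_nf

lemma hahnQ_generic_add_one {a : ℝ} (ha : NonInt a) (N n x : ℕ) (c : ℝ) :
    a * hahnQ N n x c (a + 1) = poch a x * (a + x) * uSum N n (hahnCoeff x c (a + 1)) := by
  have ha' : NonInt (a + 1) := ha.shift 1 (by push_cast; ring)
  rw [hahnQ_generic ha', ← mul_assoc, ← poch_succ_left, poch_succ]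

lemma hahnQ_generic_sub_one {a : ℝ} (ha : NonInt a) (N n x : ℕ) (c : ℝ) :
    (a + x - 1) * hahnQ N n x c (a - 1) =
      poch a x * ((a - 1) * uSum N n (hahnCoeff x c (a - 1))) := by
  have ha' : NonInt (a - 1) := ha.shift (-1) (by push_cast; ring)
  have := poch_succ_left (a - 1) x
  rw [poch_succ, sub_add_cancel] at this
  rw [hahnQ_generic ha']
  linear_combination uSum N n (hahnCoeff x c (a - 1)) * this

/-- `coeffDown` contains the factor `x`, so it hides whatever the truncated degree `x - 1` means at
`x = 0`. -/
lemma coeffDown_mul_congr {N x c y z : ℝ} (h : x * y = x * z) :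
    coeffDown N x c * y = coeffDown N x c * z := by
  rw [coeffDown_mul, coeffDown_mul, h]

section relations

variable {N n x : ℕ} {c : ℝ}

/-- The three-term recurrence. -/
lemma mul_hahnQ (hn : n ≤ N) (hx : x + c ≠ 0) (h0 : 2 * x + c ≠ 0) (h1 : 2 * x + c + 1 ≠ 0)
    (h2 : 2 * x + c - 1 ≠ 0) (a : ℝ) :
    n * hahnQ N n x c a = coeffUp N x c * hahnQ N n (x + 1) c a -
      (coeffUp N x c * (a + x) + coeffDown N x c * (a - c - x)) * hahnQ N n x c a +
      coeffDown N x c * ((a - c - x) * (a + x - 1) * hahnQ N n (x - 1) c a) := by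
  have hcont := fun m k => Continuous.hahnQ N m k (continuous_const (y := c)) continuous_id
  simp only [id] at hcont
  -- Both sides are continuous in `a`, so `a` may be taken non-integral; then `(a)_x` can be split
  -- off and the relation between coefficients applies.
  refine eq_of_eq_nonInt (x := a)
    (f := fun a => n * hahnQ N n x c a)
    (g := fun a => coeffUp N x c * hahnQ N n (x + 1) c a -
      (coeffUp N x c * (a + x) + coeffDown N x c * (a - c - x)) * hahnQ N n x c a +
      coeffDown N x c * ((a - c - x) * (a + x - 1) * hahnQ N n (x - 1) c a))
    (Continuous.continuousAt (by have := hcont n x; fun_prop))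
    (Continuous.continuousAt (by
      have := hcont n x; have := hcont n (x + 1); have := hcont n (x - 1); fun_prop)) ?_
  intro a ha
  have e := mul_uSum hn (hahnCoeff x c a)
  rw [uSum_congr (hahnCoeff_mul_rec (N : ℝ) hx h0 h1 h2 ha)] at e
  simp only [uSum_add, uSum_sub, uSum_const_mul] at e
  have e3 := coeffDown_mul_congr (N := N) (c := c) (hahnQ_generic_pred ha N n x c)
  rw [hahnQ_generic_succ ha, hahnQ_generic ha N n x]
  linear_combination poch a x * e - (a - c - x) * e3

/-- The parameter rises to `a + 1` because in the nested product the right site has parameter `A +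
n₁`, and a particle leaving it enters the left site. -/
lemma mul_hahnQ_pred (hn : n ≤ N) (hx : x + c ≠ 0) (h0 : 2 * x + c ≠ 0) (h1 : 2 * x + c + 1 ≠ 0)
    (h2 : 2 * x + c - 1 ≠ 0) (a : ℝ) :
    n * hahnQ N (n - 1) x c (a + 1) = coeffUp N x c * hahnQ N n (x + 1) c a -
      (a + x) * (coeffUp N x c + coeffDown N x c) * hahnQ N n x c a +
      coeffDown N x c * ((a + x) * (a + x - 1) * hahnQ N n (x - 1) c a) := by
  have hcont := fun m k => Continuous.hahnQ N m k (continuous_const (y := c)) continuous_id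
  simp only [id] at hcont
  refine eq_of_eq_nonInt (x := a)
    (f := fun a => n * hahnQ N (n - 1) x c (a + 1))
    (g := fun a => coeffUp N x c * hahnQ N n (x + 1) c a -
      (a + x) * (coeffUp N x c + coeffDown N x c) * hahnQ N n x c a +
      coeffDown N x c * ((a + x) * (a + x - 1) * hahnQ N n (x - 1) c a))
    (Continuous.continuousAt (by have := continuous_hahnQ_param N (n - 1) x c 1; fun_prop))
    (Continuous.continuousAt (by
      have := hcont n x; have := hcont n (x + 1); have := hcont n (x - 1); fun_prop)) ?_
  intro a ha
  have h : a ≠ 0 := by simpa using ha.add_int 0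
  have e := mul_uSum_pred hn (hahnCoeff x c (a + 1))
  rw [uSum_congr (hahnCoeff_pred_rec (N : ℝ) hx h0 h1 h2 ha)] at e
  simp only [uSum_add, uSum_sub, uSum_const_mul] at e
  have e3 := coeffDown_mul_congr (N := N) (c := c) (hahnQ_generic_pred ha N n x c)
  have e4 := hahnQ_generic_add_one ha N (n - 1) x c
  rw [hahnQ_generic_succ ha, hahnQ_generic ha N n x]
  apply mul_left_cancel₀ h
  linear_combination poch a x * (a + x) * e - (a + x) * a * e3 + n * e4

/-- The opposite jump, with `a - 1`. The bound `x ≤ N` makes the coefficient at `N + 1` vanish. -/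
lemma sub_mul_hahnQ_add_one (hn : n ≤ N) (hxN : x ≤ N) (hx : x + c ≠ 0) (h0 : 2 * x + c ≠ 0)
    (h1 : 2 * x + c + 1 ≠ 0) (h2 : 2 * x + c - 1 ≠ 0) (a : ℝ) :
    ((N : ℝ) - n) * hahnQ N (n + 1) x c (a - 1) = -coeffUp N x c * hahnQ N n (x + 1) c a +
      (a - c - x - 1) * (coeffUp N x c + coeffDown N x c) * hahnQ N n x c a -
      coeffDown N x c * ((a - c - x) * (a - c - x - 1) * hahnQ N n (x - 1) c a) := by
  have hcont := fun m k => Continuous.hahnQ N m k (continuous_const (y := c)) continuous_id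
  simp only [id] at hcont
  refine eq_of_eq_nonInt (x := a)
    (f := fun a => ((N : ℝ) - n) * hahnQ N (n + 1) x c (a - 1))
    (g := fun a => -coeffUp N x c * hahnQ N n (x + 1) c a +
      (a - c - x - 1) * (coeffUp N x c + coeffDown N x c) * hahnQ N n x c a -
      coeffDown N x c * ((a - c - x) * (a - c - x - 1) * hahnQ N n (x - 1) c a))
    (Continuous.continuousAt (by
      have := continuous_hahnQ_param N (n + 1) x c (-1); simp only [← sub_eq_add_neg] at this
      fun_prop))
    (Continuous.continuousAt (by
      have := hcont n x; have := hcont n (x + 1); have := hcont n (x - 1); fun_prop)) ?_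
  intro a ha
  have h : a + x - 1 ≠ 0 := by
    have := ha.add_int (x - 1); push_cast at this; rwa [← add_sub_assoc] at this
  have e := sub_mul_uSum_add_one hn
    (hahnCoeff_natCast_of_lt (Nat.lt_succ_of_le hxN) c (a - 1))
  have e' := congrArg (fun g => uSum N n g)
    (funext (hahnCoeff_add_one_rec (N : ℝ) hx h0 h1 h2 ha))
  beta_reduce at e'
  rw [uSum_const_mul, ← e] at e'
  simp only [uSum_add, uSum_sub, uSum_const_mul] at e'
  have e3 := coeffDown_mul_congr (N := N) (c := c) (hahnQ_generic_pred ha N n x c)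
  have e4 := hahnQ_generic_sub_one ha N (n + 1) x c
  rw [hahnQ_generic_succ ha, hahnQ_generic ha N n x]
  apply mul_left_cancel₀ h
  linear_combination poch a x * e' + (a - c - x) * (a - c - x - 1) * e3 +
    (N - n) * e4

/-- The terms with `shiftSeq` cancel between the shift up and the multiplication by `n`. Together
with the diagonal backward difference of `mul_uSum_diff`, this is the building block of the
lowering, raising and difference relations. -/
lemma sub_mul_uSum_diff (hn : n ≤ N) {h : ℕ → ℝ} (h0 : h (N + 1) = 0) :
    ((N : ℝ) - n) * (uSum N (n + 1) h - uSum N n h) =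
      uSum N n fun j => (j + 1) * h (j + 1) - j * h j := by
  have e1 := sub_mul_uSum_add_one hn h0
  have e2 := mul_uSum hn h
  have e3 : uSum N n (fun j => (N - 2 * j) * h j - (N - j + 1) * shiftSeq h j +
      (j + 1) * h (j + 1)) + uSum N n (fun j => j * h j + (N - j + 1) * shiftSeq h j) =
      N * uSum N n h + uSum N n fun j => (j + 1) * h (j + 1) - j * h j := by
    rw [← uSum_add, ← uSum_const_mul, ← uSum_add]
    refine uSum_congr fun j => ?_
    ring
  linear_combination e1 + e2 + e3

lemma mul_uSum_diff (hn : n ≤ N) (h : ℕ → ℝ) :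
    (n : ℝ) * (uSum N (n - 1) h - uSum N n h) = -uSum N n fun j => j * h j := by
  have e1 := mul_uSum_pred hn h
  have e2 := mul_uSum hn h
  rw [uSum_add] at e2
  linear_combination e1 - e2

/-- The lowering relation. -/
lemma hahnQ_lower (hn : n ≤ N) (hxN : x ≤ N) (c a : ℝ) :
    -(n * hahnQ N (n - 1) x c a) + (N - n) * hahnQ N (n + 1) x c a -
      (N - 2 * n) * hahnQ N n x c a =
      -(x * ((x + c) * hahnQ N n (x - 1) (c + 2) (a + 1))) := by
  have hcont := fun m k => Continuous.hahnQ N m k (continuous_const (y := c)) continuous_id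
  simp only [id] at hcont
  refine eq_of_eq_nonInt (x := a)
    (f := fun a => -(n * hahnQ N (n - 1) x c a) + (N - n) * hahnQ N (n + 1) x c a -
      (N - 2 * n) * hahnQ N n x c a)
    (g := fun a => -(x * ((x + c) * hahnQ N n (x - 1) (c + 2) (a + 1))))
    (Continuous.continuousAt (by
      have := hcont n x; have := hcont (n + 1) x; have := hcont (n - 1) x; fun_prop))
    (Continuous.continuousAt (by
      have := continuous_hahnQ_param N n (x - 1) (c + 2) 1; fun_prop)) ?_
  intro a ha
  have h : a ≠ 0 := by simpa using ha.add_int 0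
  have ha' : NonInt (a + 1) := ha.shift 1 (by push_cast; ring)
  rw [hahnQ_generic ha, hahnQ_generic ha, hahnQ_generic ha]
  have e1 := sub_mul_uSum_diff hn (hahnCoeff_natCast_of_lt (Nat.lt_succ_of_le hxN) c a)
  have e2 := mul_uSum_diff hn (hahnCoeff x c a)
  rw [uSum_sub] at e1
  cases x with
  | zero =>
    have e3 : uSum N n (fun j => ((j : ℝ) + 1) * hahnCoeff (0 : ℕ) c a (j + 1)) = 0 := by
      refine Finset.sum_eq_zero fun j _ => ?_
      beta_reduce
      rw [hahnCoeff_natCast_of_lt (x := 0) (j := j + 1) (Nat.succ_pos j), mul_zero, zero_mul]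
    simp only [Nat.cast_zero, zero_mul, neg_zero] at *
    linear_combination poch a 0 * (e1 - e2 + e3)
  | succ x =>
    -- The operation `h ↦ (j + 1) h (j + 1)` acts as differentiation does on a hypergeometric
    -- series: it lowers the degree and raises all parameters by one, hence `c` by two.
    have e3 : uSum N n (fun j => ((j : ℝ) + 1) * hahnCoeff (x + 1 : ℕ) c a (j + 1)) =
        -(((x : ℝ) + 1) * (x + 1 + c) / a) * uSum N n (hahnCoeff x (c + 2) (a + 1)) := by
      rw [← uSum_const_mul]
      refine uSum_congr fun j => ?_
      have h3 : (j : ℝ) + 1 ≠ 0 := by positivity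
      have h4 := ha'.poch_ne_zero j
      simp only [hahnCoeff]
      rw [poch_succ_left (-((x + 1 : ℕ) : ℝ)), poch_succ_left (((x + 1 : ℕ) : ℝ) + c),
        poch_succ_left a, Nat.factorial_succ]
      push_cast
      rw [show -((x : ℝ) + 1) + 1 = -x by ring, show (x : ℝ) + 1 + c + 1 = x + (c + 2) by ring]
      field_simp
    rw [Nat.add_sub_cancel, hahnQ_generic ha', poch_succ_left a]
    have e4 : a * uSum N n (fun j => ((j : ℝ) + 1) * hahnCoeff (x + 1 : ℕ) c a (j + 1)) =
        -(((x : ℝ) + 1) * (x + 1 + c)) * uSum N n (hahnCoeff x (c + 2) (a + 1)) := by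
      rw [e3]; field_simp
    push_cast at *
    linear_combination poch (a + 1) x * (a * (e1 - e2) + e4)

/-- The difference equation. -/
lemma hahnQ_difference (hn : n ≤ N) (hxN : x ≤ N) (c a : ℝ) :
    -((a + n) * ((N - n) * hahnQ N (n + 1) x c a)) +
      (n + (a - c - N) - 1) * (n * hahnQ N (n - 1) x c a) =
      (x * (x + c) - (a + n) * (N - n) + n * (n + (a - c - N) - 1)) * hahnQ N n x c a := by
  have hcont := fun m k => Continuous.hahnQ N m k (continuous_const (y := c)) continuous_id
  simp only [id] at hcont
  refine eq_of_eq_nonInt (x := a)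
    (f := fun a => -((a + n) * ((N - n) * hahnQ N (n + 1) x c a)) +
      (n + (a - c - N) - 1) * (n * hahnQ N (n - 1) x c a))
    (g := fun a =>
      (x * (x + c) - (a + n) * (N - n) + n * (n + (a - c - N) - 1)) * hahnQ N n x c a)
    (Continuous.continuousAt (by
      have := hcont n x; have := hcont (n + 1) x; have := hcont (n - 1) x; fun_prop))
    (Continuous.continuousAt (by have := hcont n x; fun_prop)) ?_
  intro a ha
  rw [hahnQ_generic ha, hahnQ_generic ha, hahnQ_generic ha]
  set h := hahnCoeff x c a with hh
  have e1 := sub_mul_uSum_diff hn (h := h) (hahnCoeff_natCast_of_lt (Nat.lt_succ_of_le hxN) c a)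
  have e2 := mul_uSum_diff hn h
  have e3 := mul_uSum hn fun j => (j + 1) * h (j + 1) - j * h j
  have e4 := mul_uSum hn fun j => j * h j
  -- On coefficients the difference equation is the first-order recursion `h6` of the hypergeometric
  -- series.
  have e5 : -a * uSum N n (fun j => (j + 1) * h (j + 1) - j * h j) -
      uSum N n (fun j => j * ((j + 1) * h (j + 1) - j * h j) +
        (N - j + 1) * shiftSeq (fun j => (j + 1) * h (j + 1) - j * h j) j) -
      (a - c - N - 1) * uSum N n (fun j => j * h j) -
      uSum N n (fun j => j * (j * h j) + (N - j + 1) * shiftSeq (fun j => j * h j) j) =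
      x * (x + c) * uSum N n h := by
    rw [← uSum_const_mul, ← uSum_const_mul, ← uSum_const_mul, ← uSum_sub, ← uSum_sub, ← uSum_sub]
    refine uSum_congr fun j => ?_
    have h3 : (j : ℝ) + 1 ≠ 0 := by positivity
    have h4 : a + j ≠ 0 := by exact_mod_cast ha.add_int j
    have h6 : (a + j) * ((j + 1) * h (j + 1)) = h j * ((j - x) * (x + c + j)) := by
      rw [hh, hahnCoeff_succ]; field_simp
    cases j with
    | zero => simp only [shiftSeq_zero]; push_cast at *; linear_combination -h6
    | succ j => simp only [shiftSeq_succ]; push_cast at *; linear_combination -h6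
  linear_combination poch a x * (-(a + n) * e1 + (n + (a - c - N) - 1) * e2 - e3 - e4 + e5)

end relations

lemma hahnCoeff_raise_succ {a : ℝ} (ha : NonInt a) (x c : ℝ) (i : ℕ) :
    hahnCoeff (x + 1) (c - 2) (a - 1) (i + 1) =
      hahnCoeff x c a i * (-(x + 1) * (x - 1 + c) / ((a - 1) * (i + 1))) := by
  have h4 := ha.poch_ne_zero i
  have h3 : a - 1 ≠ 0 := by simpa [sub_eq_add_neg] using ha.add_int (-1)
  have h5 : (i : ℝ) + 1 ≠ 0 := by positivity
  simp only [hahnCoeff]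
  rw [poch_succ_left (-(x + 1)), poch_succ_left (x + 1 + (c - 2)), poch_succ_left (a - 1),
    Nat.factorial_succ, show -(x + 1) + 1 = -x by ring, show x + 1 + (c - 2) + 1 = x + c by ring,
    show a - 1 + 1 = a by ring]
  push_cast
  field_simp
  ring

/-- The raising relation. -/
lemma hahnQ_raise {N n x : ℕ} (hn : n ≤ N) (hxN : x ≤ N) (c a : ℝ) :
    (c + N - 1) * (a + n) * ((N - n) * hahnQ N (n + 1) x c a) -
      (a - c - N + n) * (x * (x + c) - N - (c + N - 1) * n) * hahnQ N n x c a =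
      (N - x) * (c + N + x) * hahnQ N n (x + 1) (c - 2) (a - 1) := by
  have hcont := fun m k => Continuous.hahnQ N m k (continuous_const (y := c)) continuous_id
  simp only [id] at hcont
  refine eq_of_eq_nonInt (x := a)
    (f := fun a => (c + N - 1) * (a + n) * ((N - n) * hahnQ N (n + 1) x c a) -
      (a - c - N + n) * (x * (x + c) - N - (c + N - 1) * n) * hahnQ N n x c a)
    (g := fun a => (N - x) * (c + N + x) * hahnQ N n (x + 1) (c - 2) (a - 1))
    (Continuous.continuousAt (by
      have := hcont n x; have := hcont (n + 1) x; fun_prop))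
    (Continuous.continuousAt (by
      have := continuous_hahnQ_param N n (x + 1) (c - 2) (-1); simp only [← sub_eq_add_neg] at this
      fun_prop)) ?_
  intro a ha
  have ha' : NonInt (a - 1) := ha.shift (-1) (by push_cast; ring)
  have h3 : a - 1 ≠ 0 := by simpa using ha'.add_int 0
  rw [hahnQ_generic ha, hahnQ_generic ha, hahnQ_generic ha', poch_succ_left, sub_add_cancel]
  set h := hahnCoeff x c a with hh
  set k := hahnCoeff (x + 1 : ℕ) (c - 2) (a - 1) with hk
  have e1 := sub_mul_uSum_diff hn (h := h) (hahnCoeff_natCast_of_lt (Nat.lt_succ_of_le hxN) c a)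
  have e2 := mul_uSum hn h
  have e3 := mul_uSum hn fun j => (j + 1) * h (j + 1) - j * h j
  -- Once the forward difference is split off, the terms in `n ^ 2` cancel. The last two prefactors
  -- on the left are the coefficients of `n` and of `1` that remain in front of the polynomial.
  have e5 : (c + N - 1) * (a * uSum N n (fun j => (j + 1) * h (j + 1) - j * h j) +
        uSum N n (fun j => j * ((j + 1) * h (j + 1) - j * h j) +
          (N - j + 1) * shiftSeq (fun j => (j + 1) * h (j + 1) - j * h j) j)) +
      (-x * (x + c) + N - (c + N - 1) * c) *
        uSum N n (fun j => j * h j + (N - j + 1) * shiftSeq h j) +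
      ((c + N - 1) * a * N - (a - c - N) * (x * (x + c) - N)) * uSum N n h =
      (N - x) * (c + N + x) * (a - 1) * uSum N n k := by
    simp only [← uSum_const_mul, ← uSum_add]
    refine uSum_congr fun j => ?_
    cases j with
    | zero =>
      have h4 : a ≠ 0 := by simpa using ha.add_int 0
      rw [hh, hk, hahnCoeff_succ]
      simp only [hahnCoeff_zero, shiftSeq_zero]
      push_cast
      simp only [add_zero, zero_add]
      field_simp
      ring
    | succ i =>
      have h4 : a + i ≠ 0 := by exact_mod_cast ha.add_int i
      have h5 : a + i + 1 ≠ 0 := by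
        have := ha.add_int (i + 1); push_cast at this; rwa [← add_assoc] at this
      have h' : (i : ℝ) + 1 ≠ 0 := by positivity
      have h'' : (i : ℝ) + 1 + 1 ≠ 0 := by positivity
      rw [hk, hh]
      push_cast
      simp only [shiftSeq_succ]
      rw [hahnCoeff_raise_succ ha, hahnCoeff_succ x c a (i + 1), hahnCoeff_succ x c a i]
      generalize hahnCoeff x c a i = T
      push_cast
      generalize hb : a + (i : ℝ) = b at *
      obtain rfl : a = b - i := by linarith
      rw [show b - i + ((i : ℝ) + 1) = b + 1 by ring]
      field_simp
      ring
  linear_combination poch a x * ((c + N - 1) * (a + n) * e1 + (c + N - 1) * e3 +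
    (-x * (x + c) + N - (c + N - 1) * c) * e2 + e5)

/-! ## The duality relation for two sites -/

/-- The duality function for two neighbouring sites, up to factors that depend only on the total
numbers of particles. -/
def twoSite (N₁ N₂ : ℕ) (A r : ℝ) (x₁ x₂ n₁ n₂ : ℕ) : ℝ :=
  hahnQ N₁ n₁ x₁ (r + 2 * x₂ - N₂ - N₁) (A + x₂) * hahnQ N₂ n₂ x₂ (r - N₂) (A + n₁)

/-- In the two-site identity one diagonal term is proportional to the capacity of the right site;
this rewrites it through the two recurrence coefficients. -/
lemma coeff_relation (N : ℝ) {x c : ℝ} (h0 : 2 * x + c ≠ 0) (h1 : 2 * x + c + 1 ≠ 0)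
    (h2 : 2 * x + c - 1 ≠ 0) :
    -coeffUp N x c * (2 * x + c + 1) + coeffDown N x c * (2 * x + c - 1) = N := by
  unfold coeffUp coeffDown
  generalize hD : 2 * x + c = D at *
  obtain rfl : c = D - 2 * x := by linarith
  field_simp
  ring

/-- The right site turns the SEP side into a combination of its polynomials of degrees `x₂ + 1`,
`x₂` and `x₂ - 1`. Their coefficients are operators in `n₁` acting on the polynomial of the left
site: the one at `x₂ + 1` lowers its degree, the one at `x₂ - 1` raises it, and the one at `x₂` is
diagonal. -/
lemma twoSite_duality_generic {N₁ N₂ x₁ x₂ n₁ n₂ : ℕ} (hx₁ : x₁ ≤ N₁) (hx₂ : x₂ ≤ N₂)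
    (hn₁ : n₁ ≤ N₁) (hn₂ : n₂ ≤ N₂) (A : ℝ) {r h : ℝ} (hr : NonInt r) (hh : h = r + 2 * x₂ - N₂) :
    n₁ * ((N₂ : ℝ) - n₂) * (twoSite N₁ N₂ A r x₁ x₂ (n₁ - 1) (n₂ + 1) -
        twoSite N₁ N₂ A r x₁ x₂ n₁ n₂) +
      n₂ * ((N₁ : ℝ) - n₁) * (twoSite N₁ N₂ A r x₁ x₂ (n₁ + 1) (n₂ - 1) -
        twoSite N₁ N₂ A r x₁ x₂ n₁ n₂) =
    x₁ * ((N₂ : ℝ) - x₂) * (h + (2 * x₁ - N₁) - x₁) * (h - x₂) / (h * (h + 1)) *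
        (twoSite N₁ N₂ A r (x₁ - 1) (x₂ + 1) n₁ n₂ - twoSite N₁ N₂ A r x₁ x₂ n₁ n₂) +
      x₂ * ((N₁ : ℝ) - x₁) * (h + x₁) * (r + x₂) / (h * (h - 1)) *
        (twoSite N₁ N₂ A r (x₁ + 1) (x₂ - 1) n₁ n₂ - twoSite N₁ N₂ A r x₁ x₂ n₁ n₂) := by
  have hx : (x₂ : ℝ) + (r - N₂) ≠ 0 := by
    have := hr.add_int (x₂ - N₂); push_cast at this; contrapose! this; linarith
  have h0 : 2 * (x₂ : ℝ) + (r - N₂) ≠ 0 := by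
    have := hr.add_int (2 * x₂ - N₂); push_cast at this; contrapose! this; linarith
  have h1 : 2 * (x₂ : ℝ) + (r - N₂) + 1 ≠ 0 := by
    have := hr.add_int (2 * x₂ - N₂ + 1); push_cast at this; contrapose! this; linarith
  have h2 : 2 * (x₂ : ℝ) + (r - N₂) - 1 ≠ 0 := by
    have := hr.add_int (2 * x₂ - N₂ - 1); push_cast at this; contrapose! this; linarith
  have hD : h = 2 * (x₂ : ℝ) + (r - N₂) := by rw [hh]; ring
  -- The dynamic rates factor into a recurrence coefficient of the right site and the constant of
  -- the lowering or raising relation of the left site.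
  have hright : x₁ * ((N₂ : ℝ) - x₂) * (h + (2 * x₁ - N₁) - x₁) * (h - x₂) / (h * (h + 1)) =
      -coeffUp N₂ x₂ (r - N₂) * (x₁ * (x₁ + (r + 2 * x₂ - N₂ - N₁))) := by
    rw [coeffUp, ← hD, neg_div, neg_neg, div_mul_eq_mul_div]
    congr 1
    rw [hh]; ring
  have hleft : x₂ * ((N₁ : ℝ) - x₁) * (h + x₁) * (r + x₂) / (h * (h - 1)) =
      coeffDown N₂ x₂ (r - N₂) * ((N₁ - x₁) * ((r + 2 * x₂ - N₂ - N₁) + N₁ + x₁)) := by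
    rw [coeffDown, ← hD, div_mul_eq_mul_div, mul_comm h (h - 1)]
    congr 1
    rw [hh]; ring
  have hN := coeff_relation N₂ h0 h1 h2
  have hT := sub_mul_hahnQ_add_one hn₂ hx₂ hx h0 h1 h2 (A + n₁)
  have hS := mul_hahnQ_pred hn₂ hx h0 h1 h2 (A + n₁)
  have hM := mul_hahnQ hn₂ hx h0 h1 h2 (A + n₁)
  have hL := hahnQ_lower hn₁ hx₁ (r + 2 * x₂ - N₂ - N₁) (A + x₂)
  have hR := hahnQ_raise hn₁ hx₁ (r + 2 * x₂ - N₂ - N₁) (A + x₂)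
  have hE := hahnQ_difference hn₁ hx₁ (r + 2 * x₂ - N₂ - N₁) (A + x₂)
  -- The factor `n₁` makes the truncated subtraction harmless; in `t4` the factor `x₂` inside
  -- `coeffDown` does the same.
  have t1 : (n₁ : ℝ) * twoSite N₁ N₂ A r x₁ x₂ (n₁ - 1) (n₂ + 1) =
      n₁ * hahnQ N₁ (n₁ - 1) x₁ (r + 2 * x₂ - N₂ - N₁) (A + x₂) *
        hahnQ N₂ (n₂ + 1) x₂ (r - N₂) (A + n₁ - 1) := by
    cases n₁ with
    | zero => simp
    | succ n₁ => rw [twoSite]; push_cast; ring_nf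
  have t2 : twoSite N₁ N₂ A r x₁ x₂ (n₁ + 1) (n₂ - 1) =
      hahnQ N₁ (n₁ + 1) x₁ (r + 2 * x₂ - N₂ - N₁) (A + x₂) *
        hahnQ N₂ (n₂ - 1) x₂ (r - N₂) (A + n₁ + 1) := by
    rw [twoSite]; push_cast; ring_nf
  have t3 : twoSite N₁ N₂ A r (x₁ - 1) (x₂ + 1) n₁ n₂ =
      hahnQ N₁ n₁ (x₁ - 1) (r + 2 * x₂ - N₂ - N₁ + 2) (A + x₂ + 1) *
        hahnQ N₂ n₂ (x₂ + 1) (r - N₂) (A + n₁) := by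
    rw [twoSite]; push_cast; ring_nf
  have t4 : coeffDown N₂ x₂ (r - N₂) * twoSite N₁ N₂ A r (x₁ + 1) (x₂ - 1) n₁ n₂ =
      coeffDown N₂ x₂ (r - N₂) * (hahnQ N₁ n₁ (x₁ + 1) (r + 2 * x₂ - N₂ - N₁ - 2) (A + x₂ - 1) *
        hahnQ N₂ n₂ (x₂ - 1) (r - N₂) (A + n₁)) := by
    apply coeffDown_mul_congr
    cases x₂ with
    | zero => simp
    | succ x₂ => rw [twoSite]; push_cast; ring_nf
  rw [hright, hleft, t3]
  rw [show twoSite N₁ N₂ A r x₁ x₂ n₁ n₂ = hahnQ N₁ n₁ x₁ (r + 2 * x₂ - N₂ - N₁) (A + x₂) *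
    hahnQ N₂ n₂ x₂ (r - N₂) (A + n₁) from rfl]
  generalize twoSite N₁ N₂ A r x₁ x₂ (n₁ - 1) (n₂ + 1) = g1 at *
  generalize twoSite N₁ N₂ A r x₁ x₂ (n₁ + 1) (n₂ - 1) = g2 at *
  generalize twoSite N₁ N₂ A r (x₁ + 1) (x₂ - 1) n₁ n₂ = g4 at *
  generalize hahnQ N₁ n₁ (x₁ - 1) (r + 2 * x₂ - N₂ - N₁ + 2) (A + x₂ + 1) = L at *
  generalize hahnQ N₁ n₁ (x₁ + 1) (r + 2 * x₂ - N₂ - N₁ - 2) (A + x₂ - 1) = R at *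
  generalize hahnQ N₁ n₁ x₁ (r + 2 * x₂ - N₂ - N₁) (A + x₂) = q at *
  generalize hahnQ N₁ (n₁ + 1) x₁ (r + 2 * x₂ - N₂ - N₁) (A + x₂) = qp at *
  generalize hahnQ N₁ (n₁ - 1) x₁ (r + 2 * x₂ - N₂ - N₁) (A + x₂) = qm at *
  generalize hahnQ N₂ n₂ x₂ (r - N₂) (A + n₁) = p at *
  generalize hahnQ N₂ n₂ (x₂ + 1) (r - N₂) (A + n₁) = pp at *
  generalize hahnQ N₂ n₂ (x₂ - 1) (r - N₂) (A + n₁) = pm at *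
  generalize hahnQ N₂ (n₂ + 1) x₂ (r - N₂) (A + n₁ - 1) = s at *
  generalize hahnQ N₂ (n₂ - 1) x₂ (r - N₂) (A + n₁ + 1) = t at *
  generalize coeffUp N₂ x₂ (r - N₂) = U at *
  generalize coeffDown N₂ x₂ (r - N₂) = K at *
  clear hright hleft hx h0 h1 h2 hD hr hh
  subst t2
  -- `hT`, `hS`, `hM` eliminate everything but `pp`, `p`, `pm`. The coefficient of `pp` is the
  -- lowering relation, that of `pm` the raising relation up to a multiple of the difference
  -- equation, and that of `p` the difference equation together with `hN`.
  linear_combination (N₂ - n₂) * t1 - ((N₁ - x₁) * ((r + 2 * x₂ - N₂ - N₁) + N₁ + x₁)) * t4 +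
    n₁ * qm * hT + (N₁ - n₁) * qp * hS - (N₁ - 2 * n₁) * q * hM + U * pp * hL + K * pm * hR +
    ((U + K) * p - K * pm * (A + n₁ - (r - N₂) - x₂)) * hE + n₁ * p * q * hN

/-! ## Local changes of configurations -/

section machinery

variable {M : ℕ} {N : Fin M → ℕ}

/-- The configuration `η'` arises from `η` by moving particles between the sites `k` and `l`. -/
def LocalChange (k l : Fin M) (η η' : Conf N) : Prop :=
  (∀ j, j ≠ k → j ≠ l → η' j = η j) ∧ (η' k : ℕ) + η' l = (η k : ℕ) + η l

lemma LocalChange.refl (k l : Fin M) (η : Conf N) : LocalChange k l η η :=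
  ⟨fun _ _ _ => rfl, rfl⟩

lemma LocalChange.comm {k l : Fin M} {η η' : Conf N} (h : LocalChange k l η η') :
    LocalChange l k η η' :=
  ⟨fun j h1 h2 => h.1 j h2 h1, by rw [add_comm, h.2, add_comm]⟩

lemma move_apply_source (η : Conf N) (k l : Fin M) : (move η k l k : ℕ) = η k - 1 := by
  simp [move]

lemma move_apply_target {η : Conf N} {k l : Fin M} (hkl : k ≠ l) (hl : (η l : ℕ) < N l) :
    (move η k l l : ℕ) = η l + 1 := by
  simp only [move, hkl.symm, if_false, if_true]
  exact min_eq_left hl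

lemma localChange_move {η : Conf N} {k l : Fin M} (hkl : k ≠ l) (hk : 0 < (η k : ℕ))
    (hl : (η l : ℕ) < N l) : LocalChange k l η (move η k l) := by
  refine ⟨fun j h1 h2 => by simp [move, h1, h2], ?_⟩
  rw [move_apply_source, move_apply_target hkl hl]
  omega

lemma move_move {η : Conf N} {k l : Fin M} (hkl : k ≠ l) (hk : 0 < (η k : ℕ))
    (hl : (η l : ℕ) < N l) : move (move η k l) l k = η := by
  have h1 := move_apply_source η k l
  have h2 := move_apply_target hkl hl
  funext j
  apply Fin.ext
  by_cases hjl : j = l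
  · subst hjl
    rw [move_apply_source, h2, Nat.add_sub_cancel]
  by_cases hjk : j = k
  · subst hjk
    rw [move_apply_target hkl.symm (by rw [h1]; have := (η j).isLt; omega), h1]
    omega
  · simp [move, hjl, hjk]

lemma prod_eq_mul_mul_prod_erase {R : Type*} [CommMonoid R] {k l : Fin M} (hkl : k ≠ l)
    (f : Fin M → R) :
    ∏ j, f j = f k * f l * ∏ j ∈ (Finset.univ.erase k).erase l, f j := by
  rw [← Finset.mul_prod_erase _ f (Finset.mem_univ k),
    ← Finset.mul_prod_erase (Finset.univ.erase k) f
      (Finset.mem_erase.2 ⟨hkl.symm, Finset.mem_univ l⟩), mul_assoc]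

lemma sum_eq_of_eq_off_pair {R : Type*} [AddCommMonoid R] {k l : Fin M} (hkl : k ≠ l)
    {f g : Fin M → R} (h : ∀ j, j ≠ k → j ≠ l → f j = g j) (h' : f k + f l = g k + g l) :
    ∑ j, f j = ∑ j, g j := by
  have split : ∀ f : Fin M → R,
      ∑ j, f j = f k + f l + ∑ j ∈ (Finset.univ.erase k).erase l, f j := fun f => by
    rw [← Finset.add_sum_erase _ f (Finset.mem_univ k),
      ← Finset.add_sum_erase (Finset.univ.erase k) f
        (Finset.mem_erase.2 ⟨hkl.symm, Finset.mem_univ l⟩), add_assoc]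
  rw [split f, split g, h']
  congr 1
  refine Finset.sum_congr rfl fun j hj => ?_
  simp only [Finset.mem_erase] at hj
  exact h j hj.2.1 hj.1

lemma LocalChange.total_eq {k l : Fin M} (hkl : k ≠ l) {η η' : Conf N}
    (h : LocalChange k l η η') : total η' = total η :=
  sum_eq_of_eq_off_pair hkl (fun j h1 h2 => by rw [h.1 j h1 h2]) h.2

/-- The rates vanish for jumps from an empty site or to a full site. -/
def ProperRates (right left : Conf N → Fin M → Fin M → ℝ) : Prop :=
  ∀ η k l, ((η k : ℕ) = 0 ∨ (η l : ℕ) = N l → right η k l = 0) ∧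
    ((η l : ℕ) = 0 ∨ (η k : ℕ) = N k → left η k l = 0)

lemma conf_le (η : Conf N) (k : Fin M) : (η k : ℕ) ≤ N k := Nat.lt_succ_iff.1 (η k).isLt

/-- Where `move` is truncated or capped the rate vanishes, so boundary cases never reach the
algebra. -/
lemma jump_term {k l : Fin M} (hkl : k ≠ l) (η : Conf N) {r : ℝ} {f : Conf N → ℝ}
    {t : ℕ → ℕ → ℝ} (hr : (η k : ℕ) = 0 ∨ (η l : ℕ) = N l → r = 0)
    (ht : ∀ η', LocalChange k l η η' → f η' = t (η' k) (η' l)) :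
    r * (f (move η k l) - f η) = r * (t (η k - 1) (η l + 1) - t (η k) (η l)) := by
  by_cases h : (η k : ℕ) = 0 ∨ (η l : ℕ) = N l
  · rw [hr h, zero_mul, zero_mul]
  · push Not at h
    have hl : (η l : ℕ) < N l := lt_of_le_of_ne (conf_le η l) h.2
    rw [ht _ (localChange_move hkl (Nat.pos_of_ne_zero h.1) hl), ht _ (LocalChange.refl k l η),
      move_apply_source, move_apply_target hkl hl]

/-- A function that is, up to a constant, a function of the numbers of particles at two
neighbouring sites whenever all other sites are frozen is a duality function as soon as it is one
for each such pair of sites. -/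
lemma isDuality_of_local {r₁ l₁ r₂ l₂ : Conf N → Fin M → Fin M → ℝ} {D : Conf N → Conf N → ℝ}
    (h₁ : ProperRates r₁ l₁) (h₂ : ProperRates r₂ l₂)
    (hD : ∀ (η ξ : Conf N) (k l : Fin M), (l : ℕ) = (k : ℕ) + 1 →
      ∃ (C : ℝ) (t : ℕ → ℕ → ℕ → ℕ → ℝ),
        (∀ η' ξ', LocalChange k l η η' → LocalChange k l ξ ξ' →
          D η' ξ' = C * t (ξ' k) (ξ' l) (η' k) (η' l)) ∧
        r₁ η k l * (t (ξ k) (ξ l) (η k - 1) (η l + 1) - t (ξ k) (ξ l) (η k) (η l)) +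
          l₁ η k l * (t (ξ k) (ξ l) (η k + 1) (η l - 1) - t (ξ k) (ξ l) (η k) (η l)) =
        r₂ ξ k l * (t (ξ k - 1) (ξ l + 1) (η k) (η l) - t (ξ k) (ξ l) (η k) (η l)) +
          l₂ ξ k l * (t (ξ k + 1) (ξ l - 1) (η k) (η l) - t (ξ k) (ξ l) (η k) (η l))) :
    IsDuality (jumpGenerator r₁ l₁) (jumpGenerator r₂ l₂) D := by
  intro η ξ
  unfold jumpGenerator
  refine Finset.sum_congr rfl fun k _ => Finset.sum_congr rfl fun l _ => ?_
  split_ifs with hl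
  swap
  · rfl
  have hkl : k ≠ l := fun e => by rw [e] at hl; omega
  obtain ⟨C, t, hC, ht⟩ := hD η ξ k l hl
  rw [jump_term (f := fun η' => D η' ξ) (t := fun m n => C * t (ξ k) (ξ l) m n) hkl η
      (h₁ η k l).1 fun η' h => hC η' ξ h (.refl k l ξ),
    -- A jump to the left is a jump from `l` to `k`, so the two sites and the matching arguments of
    -- `t` trade places.
    jump_term (f := fun η' => D η' ξ) (t := fun m n => C * t (ξ k) (ξ l) n m) hkl.symm η
      (h₁ η k l).2 fun η' h => hC η' ξ h.comm (.refl k l ξ),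
    jump_term (f := fun ξ' => D η ξ') (t := fun m n => C * t m n (η k) (η l)) hkl ξ
      (h₂ ξ k l).1 fun ξ' h => hC η ξ' (.refl k l η) h,
    jump_term (f := fun ξ' => D η ξ') (t := fun m n => C * t n m (η k) (η l)) hkl.symm ξ
      (h₂ ξ k l).2 fun ξ' h => hC η ξ' (.refl k l η) h.comm]
  linear_combination C * ht

lemma jumpGenerator_single_of_ne (right left : Conf N → Fin M → Fin M → ℝ) {η η' : Conf N}
    (h : η ≠ η') :
    jumpGenerator right left (Pi.single η' 1) η =
      (∑ k : Fin M, ∑ l : Fin M, if (l : ℕ) = (k : ℕ) + 1 then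
        (if move η k l = η' then right η k l else 0) else 0) +
      ∑ k : Fin M, ∑ l : Fin M, if (l : ℕ) = (k : ℕ) + 1 then
        (if move η l k = η' then left η k l else 0) else 0 := by
  unfold jumpGenerator
  rw [← Finset.sum_add_distrib]
  refine Finset.sum_congr rfl fun k _ => ?_
  rw [← Finset.sum_add_distrib]
  refine Finset.sum_congr rfl fun l _ => ?_
  split_ifs with h1 h2 h3 h3 <;> simp_all

/-- Detailed balance has to be checked only for the jumps to the right. -/
lemma isReversible_of_detailed_balance {right left : Conf N → Fin M → Fin M → ℝ}
    (hp : ProperRates right left) {μ : Conf N → ℝ}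
    (hμ : ∀ (η : Conf N) (k l : Fin M), (l : ℕ) = (k : ℕ) + 1 → 0 < (η k : ℕ) →
      (η l : ℕ) < N l → μ η * right η k l = μ (move η k l) * left (move η k l) k l) :
    IsReversible (jumpGenerator right left) μ := by
  -- A genuine jump to the right across a bond is undone exactly by the jump to the left across the
  -- same bond. If only one of the two `move`s connects the configurations, it is not a genuine jump
  -- and has rate zero.
  have key : ∀ (η η' : Conf N) (k l : Fin M), (l : ℕ) = (k : ℕ) + 1 →
      μ η * (if move η k l = η' then right η k l else 0) =
        μ η' * (if move η' l k = η then left η' k l else 0) := by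
    intro η η' k l hl
    have hkl : k ≠ l := fun e => by rw [e] at hl; omega
    by_cases h : (η k : ℕ) = 0 ∨ (η l : ℕ) = N l
    · rw [(hp η k l).1 h, ite_self, mul_zero]
      split_ifs with h'
      · by_cases h2 : (η' l : ℕ) = 0 ∨ (η' k : ℕ) = N k
        · rw [(hp η' k l).2 h2, mul_zero]
        · push Not at h2
          have h3 : (η' k : ℕ) < N k := lt_of_le_of_ne (conf_le η' k) h2.2
          have h4 := move_apply_source η' l k
          have h5 := move_apply_target hkl.symm h3
          rw [h'] at h4 h5
          have := conf_le η' l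
          omega
      · rw [mul_zero]
    · push Not at h
      have hk := Nat.pos_of_ne_zero h.1
      have hl' : (η l : ℕ) < N l := lt_of_le_of_ne (conf_le η l) h.2
      by_cases h1 : move η k l = η'
      · subst h1
        rw [if_pos rfl, if_pos (move_move hkl hk hl'), hμ η k l hl hk hl']
      · rw [if_neg h1, mul_zero]
        split_ifs with h2
        · by_cases h3 : (η' l : ℕ) = 0 ∨ (η' k : ℕ) = N k
          · rw [(hp η' k l).2 h3, mul_zero]
          · push Not at h3
            refine absurd ?_ h1
            rw [← h2]
            exact move_move hkl.symm (Nat.pos_of_ne_zero h3.1)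
              (lt_of_le_of_ne (conf_le η' k) h3.2)
        · rw [mul_zero]
  intro η η'
  by_cases hη : η = η'
  · rw [hη]
  rw [jumpGenerator_single_of_ne _ _ hη, jumpGenerator_single_of_ne _ _ (Ne.symm hη), mul_add,
    mul_add, add_comm]
  simp only [Finset.mul_sum]
  congr 1 <;>
  · refine Finset.sum_congr rfl fun k _ => Finset.sum_congr rfl fun l _ => ?_
    by_cases hl : (l : ℕ) = k + 1
    · simp only [if_pos hl]
      first
        | exact key η η' k l hl
        | exact (key η' η k l hl).symm
    · simp only [if_neg hl, mul_zero]

lemma properRates_sep (N : Fin M → ℕ) : ProperRates (N := N)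
    (fun η k l => ((η k : ℕ) : ℝ) * ((N l : ℝ) - ((η l : ℕ) : ℝ)))
    (fun η k l => ((η l : ℕ) : ℝ) * ((N k : ℝ) - ((η k : ℕ) : ℝ))) := by
  refine fun η k l => ⟨?_, ?_⟩ <;> rintro (h | h) <;> simp [h]

lemma properRates_dyn (N : Fin M → ℕ) (ρ : ℝ) :
    ProperRates (N := N) (dynRight ρ) (dynLeft ρ) := by
  refine fun η k l => ⟨?_, ?_⟩ <;> rintro (h | h) <;> simp [dynRight, dynLeft, h]

end machinery

-- Height functions as partial sums

section partial_sums

variable {M : ℕ} {N : Fin M → ℕ}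

/-- The sum over the sites with index smaller than `k`. -/
def sumLT (f : Fin M → ℕ) (k : ℕ) : ℕ := ∑ j : Fin M, if (j : ℕ) < k then f j else 0

/-- The sum over the sites with index at least `k`. -/
def sumGE (f : Fin M → ℕ) (k : ℕ) : ℕ := ∑ j : Fin M, if k ≤ (j : ℕ) then f j else 0

/-- The numbers of particles of a configuration. -/
def Conf.val (η : Conf N) : Fin M → ℕ := fun k => η k

@[simp] lemma Conf.val_apply (η : Conf N) (k : Fin M) : η.val k = η k := rfl

lemma sumLT_succ (f : Fin M → ℕ) (k : Fin M) : sumLT f (k + 1) = sumLT f k + f k := by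
  rw [sumLT, sumLT, show f k = ∑ j, if j = k then f j else 0 by simp, ← Finset.sum_add_distrib]
  refine Finset.sum_congr rfl fun j _ => ?_
  rcases lt_trichotomy (j : ℕ) k with h | h | h
  · rw [if_pos (by omega), if_pos h, if_neg (fun e => by rw [e] at h; omega), add_zero]
  · rw [if_pos (by omega), if_neg (by omega), if_pos (Fin.ext h), zero_add]
  · rw [if_neg (by omega), if_neg (by omega), if_neg (fun e => by rw [e] at h; omega)]

lemma sumLT_add_sumGE (f : Fin M → ℕ) (k : ℕ) : sumLT f k + sumGE f k = ∑ j, f j := by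
  rw [sumLT, sumGE, ← Finset.sum_add_distrib]
  refine Finset.sum_congr rfl fun j _ => ?_
  by_cases h : (j : ℕ) < k
  · rw [if_pos h, if_neg (by omega), add_zero]
  · rw [if_neg h, if_pos (by omega), zero_add]

lemma sumGE_eq (f : Fin M → ℕ) (k : Fin M) : sumGE f k = f k + sumGE f (k + 1) := by
  have h1 := sumLT_add_sumGE f k
  have h2 := sumLT_add_sumGE f (k + 1)
  rw [sumLT_succ] at h2
  omega

@[simp] lemma sumLT_zero (f : Fin M → ℕ) : sumLT f 0 = 0 := by simp [sumLT]

@[simp] lemma sumGE_zero (f : Fin M → ℕ) : sumGE f 0 = ∑ j, f j := by simp [sumGE]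

@[simp] lemma sumGE_self (f : Fin M → ℕ) : sumGE f M = 0 := by
  rw [sumGE]
  exact Finset.sum_eq_zero fun j _ => if_neg (by omega)

@[simp] lemma sumLT_self (f : Fin M → ℕ) : sumLT f M = ∑ j, f j := by
  have := sumLT_add_sumGE f M
  rwa [sumGE_self, add_zero] at this

lemma sumLT_mono {f g : Fin M → ℕ} (h : ∀ j, f j ≤ g j) (k : ℕ) : sumLT f k ≤ sumLT g k :=
  Finset.sum_le_sum fun j _ => by split_ifs; exacts [h j, le_rfl]

lemma sumGE_mono {f g : Fin M → ℕ} (h : ∀ j, f j ≤ g j) (k : ℕ) : sumGE f k ≤ sumGE g k :=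
  Finset.sum_le_sum fun j _ => by split_ifs; exacts [h j, le_rfl]

lemma hPlus_eq (ρ : ℝ) (ξ : Conf N) (k : ℕ) :
    hPlus ρ ξ k = ρ + 2 * sumGE ξ.val k - sumGE N k := by
  simp only [hPlus, sumGE, Nat.cast_sum, Finset.mul_sum, add_sub_assoc, ← Finset.sum_sub_distrib]
  congr 1
  refine Finset.sum_congr rfl fun j _ => ?_
  split_ifs <;> simp

lemma hMinus_eq (lam : ℝ) (η : Conf N) (k : ℕ) :
    hMinus lam η k = lam + 2 * sumLT η.val k - sumLT N k := by
  simp only [hMinus, sumLT, Nat.cast_sum, Finset.mul_sum, add_sub_assoc, ← Finset.sum_sub_distrib]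
  congr 1
  refine Finset.sum_congr rfl fun j _ => ?_
  split_ifs <;> simp

/-- Unless the cut is at `l`, the sites `k` and `l = k + 1` lie on the same side of it. -/
lemma LocalChange.sumGE_eq {k l : Fin M} (hl : (l : ℕ) = k + 1) {ξ ξ' : Conf N}
    (h : LocalChange k l ξ ξ') {i : ℕ} (hi : i ≠ l) : sumGE ξ'.val i = sumGE ξ.val i := by
  have hkl : k ≠ l := fun e => by rw [e] at hl; omega
  refine sum_eq_of_eq_off_pair hkl (fun j h1 h2 => by simp [h.1 j h1 h2]) ?_
  by_cases h1 : i ≤ k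
  · rw [if_pos h1, if_pos h1, if_pos (by omega), if_pos (by omega)]
    exact h.2
  · rw [if_neg h1, if_neg h1, if_neg (by omega), if_neg (by omega)]

lemma LocalChange.sumLT_eq {k l : Fin M} (hl : (l : ℕ) = k + 1) {ξ ξ' : Conf N}
    (h : LocalChange k l ξ ξ') {i : ℕ} (hi : i ≠ l) : sumLT ξ'.val i = sumLT ξ.val i := by
  have hkl : k ≠ l := fun e => by rw [e] at hl; omega
  have h1 := sumLT_add_sumGE ξ.val i
  have h2 := sumLT_add_sumGE ξ'.val i
  rw [h.sumGE_eq hl hi] at h2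
  have h3 : ∑ j, ξ'.val j = ∑ j, ξ.val j := h.total_eq hkl
  omega

lemma LocalChange.hPlus_eq {k l : Fin M} (hl : (l : ℕ) = k + 1) {ξ ξ' : Conf N}
    (h : LocalChange k l ξ ξ') (ρ : ℝ) {i : ℕ} (hi : i ≠ l) : hPlus ρ ξ' i = hPlus ρ ξ i := by
  rw [ExclusionDuality.hPlus_eq, ExclusionDuality.hPlus_eq, h.sumGE_eq hl hi]

lemma hPlus_succ (ρ : ℝ) (ξ : Conf N) (l : Fin M) :
    hPlus ρ ξ l = hPlus ρ ξ (l + 1) + (2 * ((ξ l : ℕ) : ℝ) - N l) := by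
  rw [hPlus_eq, hPlus_eq, sumGE_eq, sumGE_eq N, Conf.val_apply]
  push_cast
  ring

end partial_sums

/-! ## Duality of the nested product of Hahn polynomials -/

lemma twoSite_continuous (N₁ N₂ : ℕ) (A : ℝ) (x₁ x₂ n₁ n₂ : ℕ) :
    Continuous fun r => twoSite N₁ N₂ A r x₁ x₂ n₁ n₂ :=
  (Continuous.hahnQ N₁ n₁ x₁ (f := fun r => r + 2 * x₂ - N₂ - N₁) (by fun_prop)
    continuous_const).mul
    (Continuous.hahnQ N₂ n₂ x₂ (f := fun r => r - N₂) (by fun_prop) continuous_const)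

/-- Continuity in `r` extends the generic case. For an impossible jump the rate is zero for every
`r`, hence continuous even where its denominator vanishes. -/
lemma twoSite_duality {N₁ N₂ x₁ x₂ n₁ n₂ : ℕ} (hx₁ : x₁ ≤ N₁) (hx₂ : x₂ ≤ N₂)
    (hn₁ : n₁ ≤ N₁) (hn₂ : n₂ ≤ N₂) (A : ℝ) {r h : ℝ} (hh : h = r + 2 * x₂ - N₂)
    (hright : 0 < x₁ → x₂ < N₂ → h ≠ 0 ∧ h + 1 ≠ 0)
    (hleft : 0 < x₂ → x₁ < N₁ → h ≠ 0 ∧ h - 1 ≠ 0) :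
    n₁ * ((N₂ : ℝ) - n₂) * (twoSite N₁ N₂ A r x₁ x₂ (n₁ - 1) (n₂ + 1) -
        twoSite N₁ N₂ A r x₁ x₂ n₁ n₂) +
      n₂ * ((N₁ : ℝ) - n₁) * (twoSite N₁ N₂ A r x₁ x₂ (n₁ + 1) (n₂ - 1) -
        twoSite N₁ N₂ A r x₁ x₂ n₁ n₂) =
    x₁ * ((N₂ : ℝ) - x₂) * (h + (2 * x₁ - N₁) - x₁) * (h - x₂) / (h * (h + 1)) *
        (twoSite N₁ N₂ A r (x₁ - 1) (x₂ + 1) n₁ n₂ - twoSite N₁ N₂ A r x₁ x₂ n₁ n₂) +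
      x₂ * ((N₁ : ℝ) - x₁) * (h + x₁) * (r + x₂) / (h * (h - 1)) *
        (twoSite N₁ N₂ A r (x₁ + 1) (x₂ - 1) n₁ n₂ - twoSite N₁ N₂ A r x₁ x₂ n₁ n₂) := by
  subst hh
  have hc := fun y₁ y₂ m₁ m₂ => twoSite_continuous N₁ N₂ A y₁ y₂ m₁ m₂
  have h1 : ContinuousAt (fun r : ℝ => x₁ * ((N₂ : ℝ) - x₂) *
      ((r + 2 * x₂ - N₂) + (2 * x₁ - N₁) - x₁) * ((r + 2 * x₂ - N₂) - x₂) /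
      ((r + 2 * x₂ - N₂) * ((r + 2 * x₂ - N₂) + 1))) r := by
    rcases Nat.eq_zero_or_pos x₁ with h | h
    · simp only [h, Nat.cast_zero, zero_mul, zero_div]; exact continuousAt_const
    rcases hx₂.eq_or_lt with h' | h'
    · simp only [h', sub_self, mul_zero, zero_mul, zero_div]; exact continuousAt_const
    · exact ContinuousAt.div (by fun_prop) (by fun_prop)
        (mul_ne_zero (hright h h').1 (hright h h').2)
  have h2 : ContinuousAt (fun r : ℝ => x₂ * ((N₁ : ℝ) - x₁) * ((r + 2 * x₂ - N₂) + x₁) *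
      (r + x₂) / ((r + 2 * x₂ - N₂) * ((r + 2 * x₂ - N₂) - 1))) r := by
    rcases Nat.eq_zero_or_pos x₂ with h | h
    · simp only [h, Nat.cast_zero, zero_mul, zero_div]; exact continuousAt_const
    rcases hx₁.eq_or_lt with h' | h'
    · simp only [h', sub_self, mul_zero, zero_mul, zero_div]; exact continuousAt_const
    · exact ContinuousAt.div (by fun_prop) (by fun_prop)
        (mul_ne_zero (hleft h h').1 (hleft h h').2)
  refine eq_of_eq_nonInt (x := r) ?_ ?_
    fun r hr => twoSite_duality_generic hx₁ hx₂ hn₁ hn₂ A hr rfl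
  · exact ((continuousAt_const.mul ((hc _ _ _ _).sub (hc _ _ _ _)).continuousAt).add
      (continuousAt_const.mul ((hc _ _ _ _).sub (hc _ _ _ _)).continuousAt))
  · exact (h1.mul ((hc _ _ _ _).sub (hc _ _ _ _)).continuousAt).add
      (h2.mul ((hc _ _ _ _).sub (hc _ _ _ _)).continuousAt)

variable {M : ℕ} {N : Fin M → ℕ}

/-- The nested product of Hahn polynomials with denominators cleared. -/
def hahnProd (ρ a : ℝ) (η ξ : Conf N) : ℝ :=
  ∏ k : Fin M, hahnQ (N k) (η k) (ξ k) (hPlus ρ ξ (k + 1) - N k)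
    (a + (sumLT η.val k + sumGE ξ.val (k + 1) : ℕ))

/-- Every other factor sees both sites `k`, `l` or neither, so only their conserved sum enters it.
Between the two sites, the factor at `k` sees the number of `ξ` at `l`, and the factor at `l` the
number of `η` at `k`. -/
lemma hahnProd_localChange (ρ a : ℝ) {k l : Fin M} (hl : (l : ℕ) = k + 1) {η ξ η' ξ' : Conf N}
    (hη : LocalChange k l η η') (hξ : LocalChange k l ξ ξ') :
    hahnProd ρ a η' ξ' = (∏ j ∈ (Finset.univ.erase k).erase l,
        hahnQ (N j) (η j) (ξ j) (hPlus ρ ξ (j + 1) - N j)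
          (a + (sumLT η.val j + sumGE ξ.val (j + 1) : ℕ))) *
      twoSite (N k) (N l) (a + (sumLT η.val k + sumGE ξ.val (l + 1) : ℕ)) (hPlus ρ ξ (l + 1))
        (ξ' k) (ξ' l) (η' k) (η' l) := by
  have hkl : k ≠ l := fun e => by rw [e] at hl; omega
  have e1 : sumLT η'.val l = sumLT η.val k + η' k := by
    rw [hl, sumLT_succ, hη.sumLT_eq hl (by omega), Conf.val_apply]
  have e2 : sumGE ξ'.val (k + 1) = ξ' l + sumGE ξ.val (l + 1) := by
    rw [← hl, sumGE_eq, hξ.sumGE_eq hl (by omega), Conf.val_apply]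
  have e3 : hPlus ρ ξ' (k + 1) = hPlus ρ ξ (l + 1) + (2 * ((ξ' l : ℕ) : ℝ) - N l) := by
    rw [← hl, hPlus_succ, hξ.hPlus_eq hl ρ (by omega)]
  rw [hahnProd, prod_eq_mul_mul_prod_erase hkl, mul_comm]
  congr 1
  · refine Finset.prod_congr rfl fun j hj => ?_
    simp only [Finset.mem_erase] at hj
    have h1 : (j : ℕ) ≠ l := fun e => hj.1 (Fin.ext e)
    have h2 : (j : ℕ) ≠ k := fun e => hj.2.1 (Fin.ext e)
    rw [hη.1 j hj.2.1 hj.1, hξ.1 j hj.2.1 hj.1, hη.sumLT_eq hl h1,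
      hξ.sumGE_eq hl (i := j + 1) (by omega), hξ.hPlus_eq hl ρ (i := j + 1) (by omega)]
  · rw [twoSite, e1, e2, e3, hη.sumLT_eq hl (by omega), hξ.sumGE_eq hl (i := l + 1) (by omega),
      hξ.hPlus_eq hl ρ (i := l + 1) (by omega)]
    push_cast
    congr 2 <;> ring

/-- Duality for a function that is the nested product times functions of the conserved
quantities. -/
lemma isDuality_of_eq_hahnProd {ρ : ℝ} (a : ℝ) (hρ : DynRatesDefined N ρ)
    {D : Conf N → Conf N → ℝ} (f g : ℕ → ℝ)
    (hD : ∀ η ξ, D η ξ = f (total η) * g (total ξ) * hahnProd ρ a η ξ) :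
    IsDuality (sepGenerator N) (dynGenerator N ρ) D := by
  refine isDuality_of_local (properRates_sep N) (properRates_dyn N ρ) ?_
  intro η ξ k l hl
  have hkl : k ≠ l := fun e => by rw [e] at hl; omega
  refine ⟨f (total η) * g (total ξ) * ∏ j ∈ (Finset.univ.erase k).erase l,
      hahnQ (N j) (η j) (ξ j) (hPlus ρ ξ (j + 1) - N j)
        (a + (sumLT η.val j + sumGE ξ.val (j + 1) : ℕ)),
    twoSite (N k) (N l) (a + (sumLT η.val k + sumGE ξ.val (l + 1) : ℕ)) (hPlus ρ ξ (l + 1)),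
    fun η' ξ' hη hξ => ?_, ?_⟩
  · rw [hD, hahnProd_localChange ρ a hl hη hξ, hη.total_eq hkl, hξ.total_eq hkl]
    ring
  · have e1 := hPlus_succ ρ ξ l
    have e2 := hPlus_succ ρ ξ k
    rw [← hl] at e2
    rw [twoSite_duality (conf_le ξ k) (conf_le ξ l) (conf_le η k) (conf_le η l) _
      (r := hPlus ρ ξ (l + 1)) (h := hPlus ρ ξ l) (by rw [e1]; ring) (hρ ξ k l hl).1
      (hρ ξ k l hl).2, dynRight, dynLeft, e2]

/-! ## The normalized form of the Hahn duality functions -/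

lemma poch_neg_natCast (n j : ℕ) :
    poch (-(n : ℝ)) j = (-1) ^ j * (j.factorial : ℝ) * (n.choose j : ℝ) := by
  induction j with
  | zero => simp
  | succ j ih =>
    have := cast_choose_succ n j
    rw [poch_succ, ih, Nat.factorial_succ, pow_succ]
    push_cast
    linear_combination (-1) ^ j * (j.factorial : ℝ) * this

/-- No bound on `j` is needed: for `j > N` both quotients have denominator zero and so are zero. -/
lemma poch_neg_div_poch_neg {N n j : ℕ} :
    poch (-(n : ℝ)) j / poch (-(N : ℝ)) j = uBasis N n j := by
  have h1 : ((-1 : ℝ)) ^ j * (j.factorial : ℝ) ≠ 0 :=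
    mul_ne_zero (pow_ne_zero _ (by norm_num)) (Nat.cast_ne_zero.2 j.factorial_ne_zero)
  rw [poch_neg_natCast, poch_neg_natCast, mul_div_mul_left _ _ h1, uBasis]

lemma uSum_eq_sum_range {N n x : ℕ} (hx : x ≤ N) {h : ℕ → ℝ} (h0 : ∀ j, x < j → h j = 0) :
    uSum N n h = ∑ j ∈ Finset.range (x + 1), h j * uBasis N n j := by
  symm
  refine Finset.sum_subset (Finset.range_mono (by omega)) fun j _ hj => ?_
  rw [h0 j (by simpa using hj), zero_mul]

lemma hahn_eq_uSum {N n x : ℕ} (hx : x ≤ N) (α β : ℝ) :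
    hahn x n α β N = uSum N n (hahnCoeff x (α + β + 1) (α + 1)) := by
  rw [uSum_eq_sum_range hx fun j hj => hahnCoeff_natCast_of_lt hj _ _, hahn]
  refine Finset.sum_congr rfl fun j _ => ?_
  rw [hahnCoeff, ← poch_neg_div_poch_neg, div_mul_div_comm]
  congr 1
  · ring_nf
  · ring

/-- The factor `(A)_x` clears the denominators of the Hahn polynomial. The remaining quotient
simplifies because `(B)_n (B + n)_N` and `(B)_{N-x} (B + N - x)_{x+n}` are both `(B)_{N+n}`. -/
lemma pHat_eq_hahnQ {N n x : ℕ} (hx : x ≤ N) {lam ρ v A B : ℝ}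
    (hA : (ρ + lam - N + v + 1) / 2 = A) (hB : (lam - ρ - N + 1 + v) / 2 = B)
    (hA0 : poch A x ≠ 0) (hB0 : poch B (N + n) ≠ 0) :
    pHat n x lam ρ v N = poch B (N - x) / poch B n * hahnQ N n x (ρ - N) A := by
  have e1 := poch_add B n N
  have e2 := poch_add B (N - x) (x + n)
  rw [show N - x + (x + n) = N + n by omega, Nat.cast_sub hx] at e2
  rw [add_comm n N] at e1
  have h1 : poch B n ≠ 0 := left_ne_zero_of_mul (e1 ▸ hB0)
  have h2 : poch (B + (N - x)) (x + n) ≠ 0 := right_ne_zero_of_mul (e2 ▸ hB0)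
  rw [pHat, hahn_eq_uSum hx, hA, show (n : ℝ) + (lam - ρ - N + 1 + v) / 2 = B + n by rw [← hB]; ring,
    show -(x : ℝ) + (lam - ρ + N + 1 + v) / 2 = B + (N - x) by rw [← hB]; ring,
    show (ρ + lam - N + v - 1) / 2 + (ρ - lam - N - v - 1) / 2 + 1 = ρ - N by ring,
    show (ρ + lam - N + v - 1) / 2 + 1 = A by rw [← hA]; ring, hahnQ_eq_of_poch_ne_zero N n _ hA0]
  have e3 : poch (B + n) N / poch (B + (N - x)) (x + n) = poch B (N - x) / poch B n := by
    rw [div_eq_div_iff h2 h1, ← e2, e1, mul_comm]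
  rw [mul_div_assoc, e3]
  ring

section

variable {M : ℕ} {N : Fin M → ℕ}

lemma capacity_split (k : Fin M) :
    capacity N = sumLT N k + N k + sumGE N (k + 1) := by
  rw [capacity, ← sumLT_add_sumGE N k, sumGE_eq, add_assoc]

/-- The numbers of holes of a configuration. -/
def Conf.holes (ξ : Conf N) : Fin M → ℕ := fun k => N k - ξ k

lemma sumGE_holes (ξ : Conf N) (k : ℕ) : sumGE ξ.holes k + sumGE ξ.val k = sumGE N k := by
  rw [sumGE, sumGE, sumGE, ← Finset.sum_add_distrib]
  refine Finset.sum_congr rfl fun j _ => ?_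
  split_ifs
  · exact Nat.sub_add_cancel (conf_le ξ j)
  · rfl

lemma total_le_capacity (η : Conf N) : total η ≤ capacity N :=
  Finset.sum_le_sum fun j _ => conf_le η j

lemma sum_holes (ξ : Conf N) : ∑ j, ξ.holes j = capacity N - total ξ := by
  have h := sumGE_holes ξ 0
  simp only [sumGE_zero] at h
  have h1 : ∑ j, ξ.val j = total ξ := rfl
  have h2 : ∑ j, N j = capacity N := rfl
  omega

lemma HahnGeneric.fst_ne_zero {ρ v : ℝ} (h : HahnGeneric N ρ v) {i : ℕ} (hi : i < capacity N) :
    (v + ρ - capacity N + 1) / 2 + i ≠ 0 := by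
  have := h.1 i hi
  contrapose! this
  linarith

lemma HahnGeneric.snd_ne_zero {ρ v : ℝ} (h : HahnGeneric N ρ v) (k : Fin M) {i : ℕ}
    (hi : i < capacity N + N k) : (v - ρ - capacity N + 1) / 2 + i ≠ 0 := by
  have := h.2 k i hi
  contrapose! this
  linarith

lemma HahnGeneric.poch_fst_ne_zero {ρ v : ℝ} (h : HahnGeneric N ρ v) {m n : ℕ}
    (hmn : m + n ≤ capacity N) : poch ((v + ρ - capacity N + 1) / 2 + m) n ≠ 0 :=
  poch_ne_zero fun i hi => by
    have := h.fst_ne_zero (i := m + i) (by omega)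
    push_cast at this
    rwa [← add_assoc] at this

lemma HahnGeneric.poch_snd_ne_zero {ρ v : ℝ} (h : HahnGeneric N ρ v) (k : Fin M) {m n : ℕ}
    (hmn : m + n ≤ capacity N + N k) : poch ((v - ρ - capacity N + 1) / 2 + m) n ≠ 0 :=
  poch_ne_zero fun i hi => by
    have := h.snd_ne_zero k (i := m + i) (by omega)
    push_cast at this
    rwa [← add_assoc] at this

lemma HahnGeneric.poch_snd_ne_zero' {ρ v : ℝ} (h : HahnGeneric N ρ v) {m n : ℕ}
    (hmn : m + n ≤ capacity N) : poch ((v - ρ - capacity N + 1) / 2 + m) n ≠ 0 := by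
  -- Without sites the second genericity condition is vacuous, but then the capacity is zero and the
  -- shifted factorial is empty.
  rcases Nat.eq_zero_or_pos M with rfl | hM
  · have : n = 0 := by
      have : capacity N = 0 := by simp [capacity]
      omega
    simp [this]
  · exact h.poch_snd_ne_zero ⟨0, hM⟩ (by omega)

/-- At site `k` the parameter `B` is a constant plus the number of `η`-particles to the left and of
`ξ`-holes to the right. The prefactor is therefore a quotient of one function at `k` and at `k + 1`.
-/
lemma pHat_site_eq {ρ v : ℝ} (h : HahnGeneric N ρ v) (η ξ : Conf N) (k : Fin M) :
    pHat (η k) (ξ k) (hMinus (0 : ℝ) η k) (hPlus ρ ξ ((k : ℕ) + 1)) v (N k) =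
      poch ((v - ρ - capacity N + 1) / 2) (sumLT η.val k + sumGE ξ.holes k) /
        poch ((v - ρ - capacity N + 1) / 2) (sumLT η.val (k + 1) + sumGE ξ.holes (k + 1)) *
      hahnQ (N k) (η k) (ξ k) (hPlus ρ ξ (k + 1) - N k)
        ((v + ρ - capacity N + 1) / 2 + (sumLT η.val k + sumGE ξ.val (k + 1) : ℕ)) := by
  have hS := capacity_split (N := N) k
  have hS' : (capacity N : ℝ) = sumLT N k + N k + sumGE N (k + 1) := by exact_mod_cast hS
  have hh := sumGE_holes ξ (k + 1)
  have hh' : (sumGE ξ.holes (k + 1) : ℝ) + sumGE ξ.val (k + 1) = sumGE N (k + 1) := by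
    exact_mod_cast hh
  have l1 := sumLT_mono (f := η.val) (g := N) (fun j => conf_le η j) k
  have l2 := sumGE_mono (f := ξ.val) (g := N) (fun j => conf_le ξ j) (k + 1)
  have l3 := conf_le ξ k
  have l4 := conf_le η k
  rw [pHat_eq_hahnQ (conf_le ξ k) (A := (v + ρ - capacity N + 1) / 2 +
      (sumLT η.val k + sumGE ξ.val (k + 1) : ℕ))
    (B := (v - ρ - capacity N + 1) / 2 + (sumLT η.val k + sumGE ξ.holes (k + 1) : ℕ))
    (by rw [hPlus_eq, hMinus_eq, hS']; push_cast; ring)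
    (by rw [hPlus_eq, hMinus_eq, hS']; push_cast; linear_combination -hh')
    (h.poch_fst_ne_zero (by omega)) (h.poch_snd_ne_zero k (by omega))]
  congr 1
  have e1 := poch_add ((v - ρ - capacity N + 1) / 2) (sumLT η.val k + sumGE ξ.holes (k + 1))
    (N k - ξ k)
  have e2 := poch_add ((v - ρ - capacity N + 1) / 2) (sumLT η.val k + sumGE ξ.holes (k + 1)) (η k)
  have hne : poch ((v - ρ - capacity N + 1) / 2) (sumLT η.val k + sumGE ξ.holes (k + 1)) ≠ 0 := by
    have := h.poch_snd_ne_zero k (m := 0) (n := sumLT η.val k + sumGE ξ.holes (k + 1)) (by omega)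
    simpa using this
  have e3 : sumGE ξ.holes k = (N k - ξ k) + sumGE ξ.holes (k + 1) := sumGE_eq _ k
  rw [sumLT_succ, Conf.val_apply, e3,
    show sumLT η.val k + (N k - (ξ k : ℕ) + sumGE ξ.holes (k + 1)) =
      sumLT η.val k + sumGE ξ.holes (k + 1) + (N k - ξ k) by ring,
    show sumLT η.val k + (η k : ℕ) + sumGE ξ.holes (k + 1) =
      sumLT η.val k + sumGE ξ.holes (k + 1) + η k by ring, e1, e2, mul_div_mul_left _ _ hne]

lemma prod_div_succ (F : ℕ → ℝ) (hF : ∀ k ≤ M, F k ≠ 0) :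
    ∏ k : Fin M, F k / F (k + 1) = F 0 / F M := by
  rw [Fin.prod_univ_eq_prod_range (fun k => F k / F (k + 1))]
  induction M with
  | zero => simp [hF 0 le_rfl]
  | succ M ih =>
    rw [Finset.prod_range_succ, ih fun k hk => hF k (by omega), div_mul_div_cancel₀ (hF M (by omega))]

/-- The quotients telescope to the two ends, where only the holes of `ξ` or only the particles of
`η` are counted. -/
lemma PHat_eq_hahnProd {ρ v : ℝ} (h : HahnGeneric N ρ v) (η ξ : Conf N) :
    PHat N ρ v η ξ = 1 / poch ((v - ρ - capacity N + 1) / 2) (total η) *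
      poch ((v - ρ - capacity N + 1) / 2) (capacity N - total ξ) *
      hahnProd ρ ((v + ρ - capacity N + 1) / 2) η ξ := by
  rw [PHat, Finset.prod_congr rfl fun k _ => pHat_site_eq h η ξ k, Finset.prod_mul_distrib, hahnProd,
    prod_div_succ (fun k => poch ((v - ρ - capacity N + 1) / 2)
      (sumLT η.val k + sumGE ξ.holes k))]
  · congr 1
    simp only [sumLT_zero, zero_add, sumGE_zero, sumLT_self, sumGE_self, add_zero, sum_holes]
    rw [show ∑ j, η.val j = total η from rfl]
    ring
  · intro k _
    have l1 := sumLT_mono (f := η.val) (g := N) (fun j => conf_le η j) k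
    have l2 := sumGE_mono (f := ξ.holes) (g := N) (fun j => Nat.sub_le _ _) k
    have l3 : sumLT N k + sumGE N k = capacity N := sumLT_add_sumGE N k
    have := h.poch_snd_ne_zero' (m := 0) (n := sumLT η.val k + sumGE ξ.holes k) (by omega)
    simpa using this

lemma isDuality_PHat {ρ v : ℝ} (h : HahnGeneric N ρ v) (hρ : DynRatesDefined N ρ) :
    IsDuality (sepGenerator N) (dynGenerator N ρ) (PHat N ρ v) :=
  isDuality_of_eq_hahnProd _ hρ (fun m => 1 / poch ((v - ρ - capacity N + 1) / 2) m)
    (fun m => poch ((v - ρ - capacity N + 1) / 2) (capacity N - m)) fun η ξ => PHat_eq_hahnProd h η ξ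

end

/-! ## Reversible measures -/

lemma WHatSite_succ {N x : ℕ} {ρ : ℝ}
    (h1 : poch (ρ + 1) (x + 1) ≠ 0) :
    WHatSite (x + 1) N ρ * ((2 * x + ρ - N) * (ρ + 1 + x) * (x + 1)) =
      -(WHatSite x N ρ * ((2 * x + 2 + ρ - N) * (ρ - N + x) * (N - x))) := by
  have hc := cast_choose_succ N x
  rw [poch_succ] at h1
  have h2 := left_ne_zero_of_mul h1
  have h3 := right_ne_zero_of_mul h1
  unfold WHatSite
  rw [poch_succ, poch_succ, mul_assoc (poch (ρ + 1) x), mul_comm (ρ + 1 + (x : ℝ)),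
    ← mul_assoc (poch (ρ + 1) x), ← div_mul_div_comm, pow_succ]
  have e : (ρ - N + x) / (ρ + 1 + x) * (ρ + 1 + x) = ρ - N + x := div_mul_cancel₀ _ h3
  push_cast
  linear_combination (-1) ^ x * (-1) * ((2 * (x + 1) + ρ - N) / (ρ - N)) *
    (poch (ρ - N) x / (poch (ρ + 1) x * poch (-ρ) N)) *
    ((N.choose (x + 1) : ℝ) * (x + 1) * (2 * x + ρ - N) * e +
      (2 * x + ρ - N) * (ρ - N + x) * hc)

/-- A jump from `k` to `k + 1` removes a particle at `k` and raises the height at `k + 1` by two, so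
the weight at `k` changes in both arguments. -/
lemma WHatSite_succ_shift {N y : ℕ} {h : ℝ} (h1 : h - N ≠ 0) (h2 : h + 1 - N ≠ 0)
    (h3 : h + 2 - N ≠ 0) (h4 : h + 1 ≠ 0) (h5 : h + 2 ≠ 0) (h6 : poch (h + 3) y ≠ 0)
    (h7 : poch (-h) N ≠ 0) (h8 : h + y + 2 ≠ 0) :
    WHatSite (y + 1) N h * ((h - N + y + 1) * (y + 1)) =
      -(WHatSite y N (h + 2) * ((h + y + 2) * (N - y))) := by
  have hc := cast_choose_succ N y
  have e1 : poch (h - N) (y + 1) * (h - N + y + 1) =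
      (h - N) * ((h + 1 - N) * poch (h + 2 - N) y) := by
    have := poch_succ (h - N) (y + 1)
    rw [poch_succ_left (h - N), poch_succ_left (h - N + 1), show h - N + 1 + 1 = h + 2 - N by ring]
      at this
    push_cast at this
    linear_combination -this
  have e2 : poch (h + 1) (y + 1) = (h + 1) * ((h + 2) * poch (h + 3) y) / (h + y + 2) := by
    rw [eq_div_iff h8]
    have := poch_succ (h + 1) (y + 1)
    rw [poch_succ_left (h + 1), poch_succ_left (h + 1 + 1), show h + 1 + 1 + 1 = h + 3 by ring]
      at this
    push_cast at this
    linear_combination -this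
  have e3 : poch (-(h + 2)) N = (h + 2) * (h + 1) * poch (-h) N / ((h + 2 - N) * (h + 1 - N)) := by
    rw [eq_div_iff (mul_ne_zero h3 h2)]
    have s1 := poch_succ (-(h + 2)) (N + 1)
    have s2 := poch_succ (-(h + 2)) N
    have s3 := poch_succ_left (-(h + 2)) (N + 1)
    have s4 := poch_succ_left (-(h + 2) + 1) N
    rw [show -(h + 2) + 1 + 1 = -h by ring] at s4
    push_cast at s1
    linear_combination -(N - h - 1) * s2 - s1 + s3 - (h + 2) * s4
  have e4 : poch (h - N) (y + 1) * (h - N + y + 1) / (h - N) =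
      (h + 1 - N) * poch (h + 2 - N) y := by
    rw [e1]; field_simp
  unfold WHatSite
  rw [e2, e3, show h + 2 + 1 = h + 3 by ring, pow_succ]
  push_cast
  calc _ = (-1) ^ y * (-1) * (2 * (y + 1) + h - N) * ((N.choose (y + 1) : ℝ) * (y + 1)) *
        (poch (h - N) (y + 1) * (h - N + y + 1) / (h - N)) /
          ((h + 1) * ((h + 2) * poch (h + 3) y) / (h + y + 2) * poch (-h) N) := by ring
    _ = _ := by
      rw [e4, hc]
      field_simp
      ring

/-- The two one-site ratios multiply to the ratio of the rates. The range in `h1` covers the heights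
`h` and `h + 2` before and after the jump, each with offsets up to `N₁`. -/
lemma WHatSite_detailed_balance {N₁ N₂ y x : ℕ} (hy : y + 1 ≤ N₁) (hx : x + 1 ≤ N₂) {r h : ℝ}
    (hh : h = r + 2 * x - N₂) (h1 : ∀ i : ℤ, -N₁ ≤ i → i ≤ N₁ + 2 → h + i ≠ 0)
    (h2 : ∀ i : ℤ, |i| ≤ N₂ → r + i ≠ 0) :
    WHatSite (y + 1) N₁ h * WHatSite x N₂ r *
      ((y + 1) * (N₂ - x) * (h + (2 * (y + 1) - N₁) - (y + 1)) * (h - x) / (h * (h + 1))) =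
    WHatSite y N₁ (h + 2) * WHatSite (x + 1) N₂ r *
      ((x + 1) * (N₁ - y) * (h + 2 + y) * (r + (x + 1)) / ((h + 2) * (h + 2 - 1))) := by
  have a0 : h ≠ 0 := by simpa using h1 0 (by omega) (by omega)
  have a1 : h + 1 ≠ 0 := by simpa using h1 1 (by omega) (by omega)
  have a2 : h + 2 ≠ 0 := by simpa using h1 2 (by omega) (by omega)
  have a3 : h - N₁ ≠ 0 := by simpa [sub_eq_add_neg] using h1 (-N₁) (by omega) (by omega)
  have a4 : h + 1 - N₁ ≠ 0 := by
    have := h1 (1 - N₁) (by omega) (by omega); push_cast at this; rwa [← add_sub_assoc] at this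
  have a5 : h + 2 - N₁ ≠ 0 := by
    have := h1 (2 - N₁) (by omega) (by omega); push_cast at this; rwa [← add_sub_assoc] at this
  have a6 : poch (h + 3) y ≠ 0 := poch_ne_zero fun i hi => by
    have := h1 (3 + i) (by omega) (by omega); push_cast at this; rwa [← add_assoc] at this
  have a7 : poch (-h) N₁ ≠ 0 := poch_ne_zero fun i hi => by
    have := h1 (-i) (by omega) (by omega); push_cast at this; contrapose! this; linarith
  have a8 : h + y + 2 ≠ 0 := by
    have := h1 (y + 2) (by omega) (by omega); push_cast at this; rwa [← add_assoc] at this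
  have a9 : h - N₁ + y + 1 ≠ 0 := by
    have := h1 (-N₁ + y + 1) (by omega) (by omega); push_cast at this; contrapose! this; linarith
  have e1 := WHatSite_succ_shift a3 a4 a5 a1 a2 a6 a7 a8
  have b1 : poch (r + 1) (x + 1) ≠ 0 := poch_ne_zero fun i hi => by
    have := h2 (1 + i) (by rw [abs_le]; omega); push_cast at this; rwa [← add_assoc] at this
  have b2 : r + 1 + x ≠ 0 := by rw [poch_succ] at b1; exact right_ne_zero_of_mul b1
  have e2 := WHatSite_succ (N := N₂) b1
  have c1 : (y : ℝ) + 1 ≠ 0 := by positivity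
  have c2 : (x : ℝ) + 1 ≠ 0 := by positivity
  have e1' : WHatSite (y + 1) N₁ h =
      -(WHatSite y N₁ (h + 2) * ((h + y + 2) * (N₁ - y))) / ((h - N₁ + y + 1) * (y + 1)) := by
    rw [eq_div_iff (mul_ne_zero a9 c1), e1]
  have e2' : WHatSite (x + 1) N₂ r =
      -(WHatSite x N₂ r * ((h + 2) * (h - x) * (N₂ - x))) / (h * (r + 1 + x) * (x + 1)) := by
    rw [eq_div_iff (mul_ne_zero (mul_ne_zero a0 b2) c2)]
    rw [show h + 2 = 2 * x + 2 + r - N₂ by rw [hh]; ring, show h - x = r - N₂ + x by rw [hh]; ring,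
      ← e2]
    rw [hh]; ring
  have a1' : h + 2 - 1 = h + 1 := by ring
  rw [e1', e2', a1', show r + ((x : ℝ) + 1) = r + 1 + x by ring]
  generalize hE : h - N₁ + (y : ℝ) + 1 = E at *
  rw [show h + (2 * ((y : ℝ) + 1) - N₁) - (y + 1) = E by rw [← hE]; ring]
  field_simp
  ring

section

variable {M : ℕ} {N : Fin M → ℕ}

/-- The height differs from `ρ` by an integer bounded by the capacity of the sites from `k` on,
which leaves the capacity of the sites before `k` for the offset `i`. -/
lemma hPlus_add_ne_zero {ρ : ℝ} (hρ : ∀ j : ℤ, |j| ≤ (capacity N : ℤ) → ρ ≠ j) (ξ : Conf N)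
    (k : ℕ) {i : ℤ} (hi : |i| ≤ sumLT N k) : hPlus ρ ξ k + i ≠ 0 := by
  intro h
  have l2 := sumGE_mono (f := ξ.val) (g := N) (fun j => conf_le ξ j) k
  have l3 : sumLT N k + sumGE N k = capacity N := sumLT_add_sumGE N k
  rw [hPlus_eq] at h
  rw [abs_le] at hi
  refine hρ (sumGE N k - 2 * sumGE ξ.val k - i) ?_ ?_
  · rw [abs_le]; omega
  · push_cast; linarith

lemma isReversible_sep (g : ℕ → ℝ) :
    IsReversible (sepGenerator N) fun η => g (total η) * wHat N η := by
  refine isReversible_of_detailed_balance (properRates_sep N) ?_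
  intro η k l hl hk hl'
  have hkl : k ≠ l := fun e => by rw [e] at hl; omega
  have hm := localChange_move hkl hk hl'
  have m1 := move_apply_source η k l
  have m2 := move_apply_target hkl hl'
  have e : ∀ j ∈ (Finset.univ.erase k).erase l,
      ((N j).choose (move η k l j) : ℝ) = (N j).choose (η j) := fun j hj => by
    simp only [Finset.mem_erase] at hj
    rw [hm.1 j hj.2.1 hj.1]
  rw [hm.total_eq hkl, wHat, wHat, prod_eq_mul_mul_prod_erase hkl, prod_eq_mul_mul_prod_erase hkl,
    Finset.prod_congr rfl e, m1, m2]
  obtain ⟨n, hn⟩ := Nat.exists_eq_succ_of_ne_zero hk.ne'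
  have c1 := cast_choose_succ (N k) n
  have c2 := cast_choose_succ (N l) (η l)
  rw [hn, Nat.succ_eq_add_one, Nat.add_sub_cancel]
  push_cast
  linear_combination g (total η) * (∏ j ∈ (Finset.univ.erase k).erase l, ((N j).choose (η j) : ℝ)) *
    ((N l).choose (η l) * ((N l : ℝ) - (η l : ℕ)) * c1 - (N k).choose n * ((N k : ℝ) - n) * c2)

lemma isReversible_dyn {ρ : ℝ} (hρ : ∀ j : ℤ, |j| ≤ (capacity N : ℤ) → ρ ≠ j) (g : ℕ → ℝ) :
    IsReversible (dynGenerator N ρ) fun ξ => g (total ξ) * WHatR N ρ ξ := by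
  refine isReversible_of_detailed_balance (properRates_dyn N ρ) ?_
  intro ξ k l hl hk hl'
  have hkl : k ≠ l := fun e => by rw [e] at hl; omega
  have hm := localChange_move hkl hk hl'
  have m1 := move_apply_source ξ k l
  have m2 := move_apply_target hkl hl'
  have e : ∀ j ∈ (Finset.univ.erase k).erase l,
      WHatSite (move ξ k l j) (N j) (hPlus ρ (move ξ k l) ((j : ℕ) + 1)) =
        WHatSite (ξ j) (N j) (hPlus ρ ξ ((j : ℕ) + 1)) := fun j hj => by
    simp only [Finset.mem_erase] at hj
    have h2 : (j : ℕ) ≠ k := fun e => hj.2.1 (Fin.ext e)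
    rw [hm.1 j hj.2.1 hj.1, hm.hPlus_eq hl ρ (i := j + 1) (by omega)]
  obtain ⟨n, hn⟩ := Nat.exists_eq_succ_of_ne_zero hk.ne'
  rw [hn, Nat.succ_eq_add_one, Nat.add_sub_cancel] at m1
  have p1 := hPlus_succ ρ ξ l
  have p2 := hPlus_succ ρ ξ k
  have p3 := hPlus_succ ρ (move ξ k l) l
  have p4 : hPlus ρ (move ξ k l) l = hPlus ρ ξ l + 2 := by
    rw [p3, p1, hm.hPlus_eq hl ρ (i := l + 1) (by omega), m2]; push_cast; ring
  have hlt := sumLT_succ N k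
  have hlt' := sumLT_succ N l
  rw [hm.total_eq hkl, WHatR, WHatR, prod_eq_mul_mul_prod_erase hkl, prod_eq_mul_mul_prod_erase hkl,
    Finset.prod_congr rfl e, dynRight, dynLeft, m1, m2, p2, ← hl, p4,
    hm.hPlus_eq hl ρ (i := l + 1) (by omega), hn, Nat.succ_eq_add_one]
  rw [← hl] at hlt
  have hkN : n + 1 ≤ N k := by have := conf_le ξ k; omega
  have key := WHatSite_detailed_balance (N₁ := N k) (N₂ := N l) (y := n) (x := ξ l)
    (r := hPlus ρ ξ (l + 1)) (h := hPlus ρ ξ l) hkN hl'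
    (by rw [p1]; ring) (fun i hi hi' => ?_) (fun i hi => ?_)
  · push_cast
    linear_combination g (total ξ) * (∏ j ∈ (Finset.univ.erase k).erase l,
      WHatSite (ξ j) (N j) (hPlus ρ ξ ((j : ℕ) + 1))) * key
  -- Offsets up to `N k` are handled by the height before the jump; `N k + 1` and `N k + 2` need the
  -- height after it.
  · by_cases h : i ≤ N k
    · exact hPlus_add_ne_zero hρ ξ l (by rw [abs_le]; omega)
    · have := hPlus_add_ne_zero hρ (move ξ k l) l (i := i - 2) (by rw [abs_le]; omega)
      rw [p4] at this
      push_cast at this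
      contrapose! this
      linarith
  · exact hPlus_add_ne_zero hρ ξ (l + 1) (by rw [abs_le] at hi ⊢; omega)

end

/-! ## Orthogonality from three-term recurrences -/

/-- Functions that satisfy a three-term recurrence and are orthogonal to the first one of them are
mutually orthogonal. -/
lemma orthogonal_of_recurrence {N : ℕ} {w : ℕ → ℝ} {f : ℕ → ℕ → ℝ} {p q s h : ℕ → ℝ}
    (hrec : ∀ x ≤ N, ∀ n ≤ N, n * f x n = p x * f (x + 1) n + q x * f x n + s x * f (x - 1) n)
    (hp : ∀ x < N, p x ≠ 0) (hpN : p N = 0) (hs : s 0 = 0)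
    (hbase : ∀ y ≤ N, ∑ n ∈ Finset.range (N + 1), w n * f 0 n * f y n = if 0 = y then h 0 else 0)
    (hh : ∀ x < N, p x * h (x + 1) = s (x + 1) * h x) :
    ∀ x ≤ N, ∀ y ≤ N,
      ∑ n ∈ Finset.range (N + 1), w n * f x n * f y n = if x = y then h x else 0 := by
  set B : ℕ → ℕ → ℝ := fun x y => ∑ n ∈ Finset.range (N + 1), w n * f x n * f y n with hB
  have hmul : ∀ x ≤ N, ∀ y, ∑ n ∈ Finset.range (N + 1), w n * (n * f x n) * f y n =
      p x * B (x + 1) y + q x * B x y + s x * B (x - 1) y := by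
    intro x hx y
    simp only [hB, Finset.mul_sum, ← Finset.sum_add_distrib]
    refine Finset.sum_congr rfl fun n hn => ?_
    rw [hrec x hx n (Finset.mem_range_succ_iff.1 hn)]
    ring
  have hsymm : ∀ x y, B x y = B y x := fun x y =>
    Finset.sum_congr rfl fun n _ => by ring
  -- Multiplication by `n` is symmetric for the pairing `B`. Since `p x ≠ 0`, this determines row `x
  -- + 1` of the Gram matrix from the two rows before it.
  have hkey : ∀ x ≤ N, ∀ y ≤ N, p x * B (x + 1) y + q x * B x y + s x * B (x - 1) y =
      p y * B x (y + 1) + q y * B x y + s y * B x (y - 1) := by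
    intro x hx y hy
    rw [← hmul x hx y, hsymm x (y + 1), hsymm x y, hsymm x (y - 1), ← hmul y hy x]
    exact Finset.sum_congr rfl fun n _ => by ring
  intro x
  induction x using Nat.strong_induction_on with
  | _ x ih =>
    intro hx y hy
    cases x with
    | zero => exact hbase y hy
    | succ x =>
      change B (x + 1) y = _
      have h1 : ∀ y ≤ N, B x y = if x = y then h x else 0 := ih x (by omega) (by omega)
      have h2 : ∀ y ≤ N, s x * B (x - 1) y = s x * if x - 1 = y then h (x - 1) else 0 := by
        intro y hy
        cases x with
        | zero => rw [hs, zero_mul, zero_mul]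
        | succ x => exact congrArg _ (ih x (by omega) (by omega) y hy)
      -- At `y = N` nothing is known about degree `N + 1`, but `p N = 0`.
      have h3 : p y * B x (y + 1) = p y * if x = y + 1 then h x else 0 := by
        rcases hy.eq_or_lt with rfl | h
        · rw [hpN, zero_mul, zero_mul]
        · rw [h1 (y + 1) h]
      have h4 := hkey x (by omega) y hy
      rw [h2 y hy, h3, h1 y hy, h1 (y - 1) (by omega)] at h4
      apply mul_left_cancel₀ (hp x hx)
      have h5 : p x * B (x + 1) y = p y * (if x = y + 1 then h x else 0) +
          (q y - q x) * (if x = y then h x else 0) + s y * (if x = y - 1 then h x else 0) -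
          s x * (if x - 1 = y then h (x - 1) else 0) := by linear_combination h4
      rw [h5]
      rcases Nat.lt_trichotomy y x with hyx | hyx | hyx
      · rw [if_neg (by omega : ¬x = y), if_neg (by omega : ¬x = y - 1),
          if_neg (by omega : ¬x + 1 = y)]
        by_cases h6 : x = y + 1
        · subst h6
          rw [if_pos rfl, if_pos (by omega), Nat.add_sub_cancel]
          linear_combination hh y (by omega)
        · rw [if_neg h6, if_neg (by omega)]; ring
      · subst hyx
        rw [if_neg (by omega : ¬y = y + 1), if_neg (by omega : ¬y + 1 = y)]
        cases y with
        | zero => rw [hs]; ring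
        | succ y =>
          rw [if_neg (by omega : ¬y + 1 = y + 1 - 1), if_neg (by omega : ¬y + 1 - 1 = y + 1)]
          ring
      · rw [if_neg (by omega : ¬x = y), if_neg (by omega : ¬x = y + 1),
          if_neg (by omega : ¬x - 1 = y)]
        by_cases h6 : x + 1 = y
        · subst h6
          rw [if_pos (by omega), if_pos rfl]
          linear_combination -hh x (by omega)
        · rw [if_neg (by omega), if_neg h6]; ring

/-! ## Orthogonality of Hahn polynomials -/

/-- Chu–Vandermonde. After Pascal's rule the two terms for each `j` combine to `β - α` times the
summand for `m` and `β + 1`. -/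
lemma sum_choose_poch_mul_poch (m : ℕ) : ∀ α β : ℝ,
    ∑ j ∈ Finset.range (m + 1), (m.choose j : ℝ) * ((-1) ^ j * poch α j * poch (β + j) (m - j)) =
      poch (β - α) m := by
  induction m with
  | zero => intro α β; simp
  | succ m ih =>
    intro α β
    have e := Finset.sum_choose_succ_mul
      (fun j i => (-1 : ℝ) ^ j * poch α j * poch (β + j) i) m
    beta_reduce at e
    rw [e, poch_succ_left, ← Finset.sum_add_distrib, show β - α + 1 = β + 1 - α by ring, ← ih,
      Finset.mul_sum]
    refine Finset.sum_congr rfl fun j hj => ?_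
    have hj' : j ≤ m := Finset.mem_range_succ_iff.1 hj
    rw [show m + 1 - j = (m - j) + 1 by omega, poch_succ_left, poch_succ, pow_succ]
    push_cast
    rw [show β + (j : ℝ) + 1 = β + 1 + j by ring, show β + ((j : ℝ) + 1) = β + 1 + j by ring]
    ring

/-- The weight of the Hahn polynomials with denominators cleared, with `b = -β - N`. -/
def hahnWeight (N : ℕ) (a b : ℝ) (n : ℕ) : ℝ :=
  (N.choose n : ℝ) * ((-1) ^ n * poch a n * poch (b + n) (N - n))

/-- Since `C(N, n) C(n, j) / C(N, j) = C(N - j, n - j)`, this is Chu–Vandermonde of length `N - j`.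
-/
lemma sum_hahnWeight_mul_uBasis {N j : ℕ} (hj : j ≤ N) (a b : ℝ) :
    ∑ n ∈ Finset.range (N + 1), hahnWeight N a b n * uBasis N n j =
      (-1) ^ j * poch a j * poch (b - a) (N - j) := by
  obtain ⟨m, rfl⟩ := Nat.exists_eq_add_of_le hj
  rw [add_assoc, Finset.sum_range_add, Finset.sum_eq_zero, zero_add, Nat.add_sub_cancel_left,
    show b - a = b + j - (a + j) by ring, ← sum_choose_poch_mul_poch, Finset.mul_sum]
  · refine Finset.sum_congr rfl fun i hi => ?_
    have hi' : i ≤ m := Finset.mem_range_succ_iff.1 hi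
    have h1 := Nat.choose_mul (n := j + m) (k := j + i) (s := j) (by omega)
    rw [Nat.add_sub_cancel_left, Nat.add_sub_cancel_left] at h1
    have h2 : ((j + m).choose (j + i) : ℝ) * (j + i).choose j = (j + m).choose j * m.choose i := by
      exact_mod_cast h1
    have h3 := choose_cast_ne_zero (N := j + m) (j := j) (by omega)
    have h4 : ((j + m).choose (j + i) : ℝ) * uBasis (j + m) (j + i) j = m.choose i := by
      rw [uBasis, mul_div_assoc', h2]; field_simp
    rw [hahnWeight, poch_add, pow_add, show j + m - (j + i) = m - i by omega]
    push_cast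
    rw [show b + ((j : ℝ) + i) = b + j + i by ring]
    linear_combination ((-1) ^ j * (-1) ^ i * (poch a j * poch (a + j) i) *
      poch (b + j + i) (m - i)) * h4
  · intro n hn
    rw [uBasis_of_lt (Finset.mem_range.1 hn), mul_zero]

lemma poch_neg_reflect (r : ℝ) (m : ℕ) : poch (-r) m = (-1) ^ m * poch (r - m + 1) m := by
  induction m generalizing r with
  | zero => simp
  | succ m ih =>
    have e := poch_succ (r - (m + 1) + 1) m
    rw [poch_succ_left, show -r + 1 = -(r - 1) by ring, ih, pow_succ]
    push_cast
    rw [e, show r - 1 - (m : ℝ) + 1 = r - (m + 1) + 1 by ring]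
    ring

lemma hahnQ_zero (N n : ℕ) (c a : ℝ) : hahnQ N n 0 c a = 1 := by
  rw [hahnQ, uSum_eq_sum_range (x := 0) (Nat.zero_le N) fun j hj => by
    rw [poch_neg_natCast_of_lt hj, zero_mul, zero_mul, zero_div]]
  simp

/-- Inserting the moments leaves another Chu–Vandermonde sum, of value `(1 - y)_y`, which is zero
unless `y = 0`. -/
lemma sum_hahnWeight_mul_hahnQ {N y : ℕ} (hy : y ≤ N) (ρ a : ℝ) :
    ∑ n ∈ Finset.range (N + 1), hahnWeight N a (a - ρ) n * hahnQ N n y (ρ - N) a =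
      if 0 = y then poch (-ρ) N else 0 := by
  have e1 : ∀ n, hahnQ N n y (ρ - N) a = ∑ j ∈ Finset.range (y + 1),
      poch (-y) j * poch (y + (ρ - N)) j * poch (a + j) (y - j) / (j.factorial : ℝ) *
        uBasis N n j := fun n =>
    uSum_eq_sum_range hy fun j hj => by
      rw [poch_neg_natCast_of_lt hj, zero_mul, zero_mul, zero_div]
  simp only [e1, Finset.mul_sum]
  rw [Finset.sum_comm]
  have e2 : ∀ j ∈ Finset.range (y + 1), ∑ n ∈ Finset.range (N + 1), hahnWeight N a (a - ρ) n *
      (poch (-y) j * poch (y + (ρ - N)) j * poch (a + j) (y - j) / (j.factorial : ℝ) *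
        uBasis N n j) = (-1) ^ N * poch a y * poch (ρ - N + 1 + y) (N - y) *
      ((y.choose j : ℝ) * ((-1) ^ j * poch (y + (ρ - N)) j * poch (ρ - N + 1 + j) (y - j))) := by
    intro j hj
    have hj' : j ≤ y := Finset.mem_range_succ_iff.1 hj
    have h1 := sum_hahnWeight_mul_uBasis (hj'.trans hy) a (a - ρ)
    have h2 : ∀ r : ℝ, ∑ n ∈ Finset.range (N + 1), hahnWeight N a (a - ρ) n * (r * uBasis N n j) =
        r * ∑ n ∈ Finset.range (N + 1), hahnWeight N a (a - ρ) n * uBasis N n j := fun r => by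
      rw [Finset.mul_sum]; exact Finset.sum_congr rfl fun n _ => by ring
    have h3 := poch_add a j (y - j)
    rw [Nat.add_sub_cancel' hj'] at h3
    have h4 := poch_add (ρ - N + 1 + j) (y - j) (N - y)
    rw [show y - j + (N - y) = N - j by omega, Nat.cast_sub hj',
      show ρ - N + 1 + j + ((y : ℝ) - j) = ρ - N + 1 + y by ring] at h4
    have h5 : ((-1 : ℝ)) ^ N = (-1) ^ j * (-1) ^ (N - j) := by
      rw [← pow_add, Nat.add_sub_cancel' (hj'.trans hy)]
    have h6 : ((-1 : ℝ)) ^ j * (-1) ^ j = 1 := by rw [← mul_pow]; simp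
    have h7 : (j.factorial : ℝ) ≠ 0 := Nat.cast_ne_zero.2 j.factorial_ne_zero
    rw [h2, h1, show a - ρ - a = -ρ by ring, poch_neg_reflect ρ, Nat.cast_sub (hj'.trans hy),
      show ρ - ((N : ℝ) - j) + 1 = ρ - N + 1 + j by ring, h4, poch_neg_natCast, h3, h5]
    field_simp
  rw [Finset.sum_congr rfl e2, ← Finset.mul_sum, sum_choose_poch_mul_poch]
  split_ifs with h
  · subst h
    rw [poch_neg_reflect]
    simp
  · obtain ⟨z, rfl⟩ := Nat.exists_eq_succ_of_ne_zero (Ne.symm h)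
    rw [show ρ - N + 1 - (((z.succ : ℕ) : ℝ) + (ρ - N)) = -(z : ℝ) by push_cast; ring,
      poch_neg_natCast_of_lt (Nat.lt_succ_self z), mul_zero]

/-- The squared norms. -/
def hahnNorm (N x : ℕ) (ρ a : ℝ) : ℝ :=
  poch (a - ρ + (N - x)) x * poch a x / WHatSite x N ρ

lemma WHatSite_ne_zero {N x : ℕ} (hx : x ≤ N) {ρ : ℝ} (hρ : ∀ j : ℤ, |j| ≤ (N : ℤ) → ρ ≠ j) :
    WHatSite x N ρ ≠ 0 := by
  have key : ∀ i : ℤ, |i| ≤ (N : ℤ) → ρ + i ≠ 0 := fun i hi h =>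
    hρ (-i) (by rwa [abs_neg]) (by push_cast; linarith)
  have h1 : 2 * x + ρ - N ≠ 0 := by
    have := key (2 * x - N) (by rw [abs_le]; omega)
    push_cast at this; contrapose! this; linarith
  have h2 : ρ - N ≠ 0 := by
    have := key (-N) (by rw [abs_le]; omega)
    push_cast at this; contrapose! this; linarith
  have h3 : poch (ρ - N) x ≠ 0 := poch_ne_zero fun i hi => by
    have := key (-N + i) (by rw [abs_le]; omega)
    push_cast at this; contrapose! this; linarith
  have h4 : poch (ρ + 1) x ≠ 0 := poch_ne_zero fun i hi => by
    have := key (1 + i) (by rw [abs_le]; omega)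
    push_cast at this; contrapose! this; linarith
  have h5 : poch (-ρ) N ≠ 0 := poch_ne_zero fun i hi => by
    have := key (-i) (by rw [abs_le]; omega)
    push_cast at this; contrapose! this; linarith
  have h6 := choose_cast_ne_zero hx
  unfold WHatSite
  have h7 : ((-1 : ℝ)) ^ x ≠ 0 := pow_ne_zero _ (by norm_num)
  positivity

lemma WHatSite_continuousAt {N x : ℕ} (hx : x ≤ N) {ρ : ℝ}
    (hρ : ∀ j : ℤ, |j| ≤ (N : ℤ) → ρ ≠ j) : ContinuousAt (WHatSite x N) ρ := by
  have key : ∀ i : ℤ, |i| ≤ (N : ℤ) → ρ + i ≠ 0 := fun i hi h =>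
    hρ (-i) (by rwa [abs_neg]) (by push_cast; linarith)
  have h2 : ρ - N ≠ 0 := by
    have := key (-N) (by rw [abs_le]; omega)
    push_cast at this; contrapose! this; linarith
  have h4 : poch (ρ + 1) x ≠ 0 := poch_ne_zero fun i hi => by
    have := key (1 + i) (by rw [abs_le]; omega)
    push_cast at this; contrapose! this; linarith
  have h5 : poch (-ρ) N ≠ 0 := poch_ne_zero fun i hi => by
    have := key (-i) (by rw [abs_le]; omega)
    push_cast at this; contrapose! this; linarith
  have c1 : Continuous fun r : ℝ => poch (r - N) x := (continuous_poch x).comp (by fun_prop)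
  have c2 : Continuous fun r : ℝ => poch (r + 1) x := (continuous_poch x).comp (by fun_prop)
  have c3 : Continuous fun r : ℝ => poch (-r) N := (continuous_poch N).comp (by fun_prop)
  change ContinuousAt (fun r => WHatSite x N r) ρ
  unfold WHatSite
  have d1 : ContinuousAt (fun r : ℝ => (2 * (x : ℝ) + r - N) / (r - N)) ρ :=
    ContinuousAt.div (by fun_prop) (by fun_prop) h2
  have d2 : ContinuousAt (fun r : ℝ => poch (r - N) x / (poch (r + 1) x * poch (-r) N)) ρ :=
    ContinuousAt.div c1.continuousAt (c2.mul c3).continuousAt (mul_ne_zero h4 h5)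
  exact ((continuousAt_const.mul d1).mul d2).mul continuousAt_const

/-- Non-integral `ρ` keeps the denominators of the three-term recurrence away from zero; the
extension to all admissible `ρ` is by continuity of the norms. -/
lemma hahnQ_orthogonal_generic {N : ℕ} {ρ : ℝ} (hρ : NonInt ρ) (a : ℝ) {x y : ℕ} (hx : x ≤ N)
    (hy : y ≤ N) :
    ∑ n ∈ Finset.range (N + 1), hahnWeight N a (a - ρ) n * hahnQ N n x (ρ - N) a *
      hahnQ N n y (ρ - N) a = if x = y then hahnNorm N x ρ a else 0 := by
  have hne : ∀ (e : ℝ) (z : ℤ), e = ρ + z → e ≠ 0 := fun e z h => by rw [h]; exact hρ.add_int z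
  refine orthogonal_of_recurrence (N := N) (f := fun x n => hahnQ N n x (ρ - N) a)
    (p := fun x => coeffUp N x (ρ - N))
    (q := fun x => -(coeffUp N x (ρ - N) * (a + x) + coeffDown N x (ρ - N) * (a - (ρ - N) - x)))
    (s := fun x => coeffDown N x (ρ - N) * ((a - (ρ - N) - x) * (a + x - 1)))
    (h := fun x => hahnNorm N x ρ a) ?_ ?_ ?_ ?_ ?_ ?_ x hx y hy
  · intro x hx n hn
    rw [mul_hahnQ hn (hne _ (x - N) (by push_cast; ring)) (hne _ (2 * x - N) (by push_cast; ring))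
      (hne _ (2 * x - N + 1) (by push_cast; ring)) (hne _ (2 * x - N - 1) (by push_cast; ring))]
    ring
  · intro x hx
    have h1 : (N : ℝ) - x ≠ 0 := by rw [sub_ne_zero]; exact_mod_cast hx.ne'
    exact div_ne_zero (neg_ne_zero.2 (mul_ne_zero h1 (hne _ (x - N) (by push_cast; ring))))
      (mul_ne_zero (hne _ (2 * x - N) (by push_cast; ring))
        (hne _ (2 * x - N + 1) (by push_cast; ring)))
  · simp [coeffUp]
  · simp [coeffDown]
  · intro y hy
    simp only [hahnQ_zero, mul_one]
    rw [sum_hahnWeight_mul_hahnQ hy]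
    have h1 : ρ - N ≠ 0 := hne _ (-N) (by push_cast; ring)
    simp [hahnNorm, WHatSite, h1]
  · intro x hx
    have hx' : (x : ℝ) + 1 ≠ 0 := by positivity
    have hρ' : ∀ j : ℤ, |j| ≤ (N : ℤ) → ρ ≠ j := fun j _ => hρ j
    have h1 := WHatSite_ne_zero hx.le hρ'
    have h2 := WHatSite_ne_zero (x := x + 1) hx hρ'
    have h3 := WHatSite_succ (N := N) (x := x) (ρ := ρ)
      ((hρ.shift 1 (by push_cast; ring)).poch_ne_zero _)
    have d1 : 2 * (x : ℝ) + (ρ - N) ≠ 0 := hne _ (2 * x - N) (by push_cast; ring)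
    have d2 : 2 * (x : ℝ) + (ρ - N) + 1 ≠ 0 := hne _ (2 * x - N + 1) (by push_cast; ring)
    have d3 : 2 * (x : ℝ) + (ρ - N) + 2 ≠ 0 := hne _ (2 * x - N + 2) (by push_cast; ring)
    -- The ratio of consecutive weights is the ratio of the recurrence coefficients, up to the
    -- factors that clearing denominators has introduced.
    have h4 : coeffUp N x (ρ - N) * WHatSite x N ρ =
        coeffDown N (x + 1 : ℕ) (ρ - N) * WHatSite (x + 1) N ρ := by
      rw [coeffUp, coeffDown]
      push_cast
      rw [show 2 * ((x : ℝ) + 1) + (ρ - N) - 1 = 2 * x + (ρ - N) + 1 by ring,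
        show 2 * ((x : ℝ) + 1) + (ρ - N) = 2 * x + (ρ - N) + 2 by ring]
      rw [div_mul_eq_mul_div, div_mul_eq_mul_div, div_eq_div_iff (mul_ne_zero d1 d2)
        (mul_ne_zero d2 d3)]
      linear_combination -(2 * (x : ℝ) + (ρ - N) + 1) * h3
    have h5 := poch_succ_left (a - ρ + (N - (x + 1))) x
    rw [show a - ρ + ((N : ℝ) - (x + 1)) + 1 = a - ρ + (N - x) by ring] at h5
    simp only [hahnNorm]
    rw [poch_succ a]
    push_cast at h4 ⊢
    rw [h5, mul_div_assoc', mul_div_assoc', div_eq_div_iff h2 h1]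
    linear_combination (a - ρ + (N - (x + 1))) * poch (a - ρ + (N - x)) x * poch a x * (a + x) * h4

lemma hahnQ_orthogonal {N : ℕ} {ρ : ℝ} (hρ : ∀ j : ℤ, |j| ≤ (N : ℤ) → ρ ≠ j) (a : ℝ) {x y : ℕ}
    (hx : x ≤ N) (hy : y ≤ N) :
    ∑ n ∈ Finset.range (N + 1), hahnWeight N a (a - ρ) n * hahnQ N n x (ρ - N) a *
      hahnQ N n y (ρ - N) a = if x = y then hahnNorm N x ρ a else 0 := by
  have hc : ∀ n x, Continuous fun r : ℝ => hahnQ N n x (r - N) a := fun n x =>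
    Continuous.hahnQ N n x (by fun_prop) continuous_const
  have hw : ∀ n, Continuous fun r : ℝ => hahnWeight N a (a - r) n := fun n => by
    have : Continuous fun r : ℝ => poch (a - r + n) (N - n) :=
      (continuous_poch _).comp (by fun_prop)
    unfold hahnWeight
    fun_prop
  refine eq_of_eq_nonInt (x := ρ) ?_ ?_ fun r hr => hahnQ_orthogonal_generic hr a hx hy
  · exact (continuous_finsetSum _ fun n _ => ((hw n).mul (hc n x)).mul (hc n y)).continuousAt
  · split_ifs
    · have : Continuous fun r : ℝ => poch (a - r + (N - x)) x :=
        (continuous_poch _).comp (by fun_prop)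
      unfold hahnNorm
      exact (this.mul continuous_const).continuousAt.div (WHatSite_continuousAt hx hρ)
        (WHatSite_ne_zero hx hρ)
    · exact continuousAt_const

/-! ## Orthogonality of the nested product -/

/-- The capacities of all sites but the last one. -/
abbrev initCap {M : ℕ} (N : Fin (M + 1) → ℕ) : Fin M → ℕ := fun k => N k.castSucc

section

variable {M : ℕ} {N : Fin (M + 1) → ℕ}

/-- The configuration on all sites but the last one. -/
def initConf (η : Conf N) : Conf (initCap N) := fun k => η k.castSucc

/-- The configuration with a new last site. -/
def snocConf (η : Conf (initCap N)) (n : Fin (N (Fin.last M) + 1)) : Conf N :=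
  Fin.snoc (α := fun k => Fin (N k + 1)) η n

@[simp] lemma initConf_snocConf (η : Conf (initCap N)) (n : Fin (N (Fin.last M) + 1)) :
    initConf (snocConf η n) = η := by
  funext k; simp [initConf, snocConf]

@[simp] lemma snocConf_last (η : Conf (initCap N)) (n : Fin (N (Fin.last M) + 1)) :
    snocConf η n (Fin.last M) = n := by simp [snocConf]

lemma sum_conf_succ (F : Conf N → ℝ) :
    ∑ η, F η = ∑ η : Conf (initCap N), ∑ n : Fin (N (Fin.last M) + 1), F (snocConf η n) := by
  rw [← Equiv.sum_comp (Fin.snocEquiv fun k => Fin (N k + 1)) F, Fintype.sum_prod_type_right]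
  rfl

lemma conf_ext_iff {ξ ξ' : Conf N} :
    ξ = ξ' ↔ initConf ξ = initConf ξ' ∧ ξ (Fin.last M) = ξ' (Fin.last M) := by
  refine ⟨fun h => by rw [h]; exact ⟨rfl, rfl⟩, fun ⟨h1, h2⟩ => ?_⟩
  funext k
  refine Fin.lastCases h2 (fun i => ?_) k
  exact congrFun h1 i

lemma total_succ (η : Conf N) : total η = total (initConf η) + η (Fin.last M) := by
  rw [total, Fin.sum_univ_castSucc]; rfl

lemma capacity_succ : capacity N = capacity (initCap N) + N (Fin.last M) := by
  rw [capacity, Fin.sum_univ_castSucc]; rfl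

lemma sumLT_init (η : Conf N) {k : ℕ} (hk : k ≤ M) :
    sumLT η.val k = sumLT (initConf η).val k := by
  rw [sumLT, Fin.sum_univ_castSucc, if_neg (by simpa using hk), add_zero]; rfl

lemma sumGE_init (η : Conf N) {k : ℕ} (hk : k ≤ M) :
    sumGE η.val k = sumGE (initConf η).val k + η (Fin.last M) := by
  rw [sumGE, Fin.sum_univ_castSucc, if_pos (by simpa using hk)]; rfl

lemma hPlus_init (ρ : ℝ) (ξ : Conf N) {k : ℕ} (hk : k ≤ M) :
    hPlus ρ ξ k = hPlus (ρ + 2 * ((ξ (Fin.last M) : ℕ) : ℝ) - N (Fin.last M)) (initConf ξ) k := by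
  rw [hPlus, Fin.sum_univ_castSucc, if_pos (by simpa using hk), hPlus]
  simp only [initConf, Fin.val_castSucc]
  ring

lemma hPlus_top (ρ : ℝ) (ξ : Conf N) : hPlus ρ ξ (M + 1) = ρ := by
  rw [hPlus_eq]; simp

/-- For the other sites, the last site of `ξ` acts only through a new boundary height and a shift of
`a`; the last factor sees the rest of `η` only through its particle number. -/
lemma hahnProd_succ (ρ a : ℝ) (η ξ : Conf N) :
    hahnProd ρ a η ξ = hahnProd (ρ + 2 * ((ξ (Fin.last M) : ℕ) : ℝ) - N (Fin.last M))
        (a + (ξ (Fin.last M) : ℕ)) (initConf η) (initConf ξ) *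
      hahnQ (N (Fin.last M)) (η (Fin.last M)) (ξ (Fin.last M)) (ρ - N (Fin.last M))
        (a + total (initConf η)) := by
  rw [hahnProd, Fin.prod_univ_castSucc, hahnProd]
  congr 1
  · refine Finset.prod_congr rfl fun k _ => ?_
    rw [Fin.val_castSucc, hPlus_init ρ ξ (by omega), sumLT_init η (by omega),
      sumGE_init ξ (by omega)]
    push_cast
    rw [show a + ((sumLT (initConf η).val k : ℝ) +
      (sumGE (initConf ξ).val (k + 1) + (ξ (Fin.last M) : ℕ))) = a + (ξ (Fin.last M) : ℕ) +
        (sumLT (initConf η).val k + sumGE (initConf ξ).val (k + 1)) by ring]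
    rfl
  · rw [Fin.val_last, hPlus_top, sumGE_self, sumLT_init η le_rfl, sumLT_self]
    rfl

lemma wHat_succ (η : Conf N) : wHat N η =
    wHat (initCap N) (initConf η) * ((N (Fin.last M)).choose (η (Fin.last M)) : ℝ) := by
  rw [wHat, Fin.prod_univ_castSucc]; rfl

lemma WHatR_succ (ρ : ℝ) (ξ : Conf N) : WHatR N ρ ξ =
    WHatR (initCap N) (ρ + 2 * ((ξ (Fin.last M) : ℕ) : ℝ) - N (Fin.last M)) (initConf ξ) *
      WHatSite (ξ (Fin.last M)) (N (Fin.last M)) ρ := by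
  rw [WHatR, Fin.prod_univ_castSucc, Fin.val_last, hPlus_top, WHatR]
  congr 1
  refine Finset.prod_congr rfl fun k _ => ?_
  rw [Fin.val_castSucc, hPlus_init ρ ξ (by omega)]
  rfl

end

/-- The weight on configurations with denominators cleared. -/
def hahnWeightProd {M : ℕ} (N : Fin M → ℕ) (a b : ℝ) (η : Conf N) : ℝ :=
  wHat N η * ((-1) ^ total η * poch a (total η) * poch (b + total η) (capacity N - total η))

/-- With the other sites fixed, the last site carries a one-site Hahn weight whose parameters are
shifted by their particle number, as in the last factor of `hahnProd`. -/
lemma hahnWeightProd_snoc {M : ℕ} {N : Fin (M + 1) → ℕ} (a b : ℝ) (η : Conf (initCap N))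
    (n : Fin (N (Fin.last M) + 1)) :
    hahnWeightProd N a b (snocConf η n) =
      wHat (initCap N) η * ((-1) ^ total η * poch a (total η) *
        poch (b + total η + N (Fin.last M)) (capacity (initCap N) - total η)) *
        hahnWeight (N (Fin.last M)) (a + total η) (b + total η) n := by
  have h1 := total_le_capacity η
  have h2 : (n : ℕ) ≤ N (Fin.last M) := Nat.lt_succ_iff.1 n.isLt
  have e := poch_add (b + total η + (n : ℕ)) (N (Fin.last M) - n)
    (capacity (initCap N) - total η)
  rw [show N (Fin.last M) - n + (capacity (initCap N) - total η) =
    capacity (initCap N) + N (Fin.last M) - (total η + n) by omega, Nat.cast_sub h2,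
    show b + total η + (n : ℕ) + ((N (Fin.last M) : ℝ) - (n : ℕ)) =
      b + total η + N (Fin.last M) by ring] at e
  rw [hahnWeightProd, total_succ, capacity_succ, wHat_succ, initConf_snocConf, snocConf_last,
    hahnWeight, poch_add, pow_add]
  push_cast
  rw [← add_assoc, e]
  ring

/-- Induction on the number of sites. Summing over the last site forces the last entries of `ξ` and
`ξ'` to agree, and then the remaining products share their parameters. -/
lemma hahnProd_orthogonal {M : ℕ} : ∀ {N : Fin M → ℕ} {ρ : ℝ},
    (∀ j : ℤ, |j| ≤ (capacity N : ℤ) → ρ ≠ j) → ∀ (a : ℝ) (ξ ξ' : Conf N),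
    ∑ η, hahnWeightProd N a (a - ρ) η * hahnProd ρ a η ξ * hahnProd ρ a η ξ' =
      if ξ = ξ' then poch (a - ρ + (capacity N - total ξ)) (total ξ) * poch a (total ξ) /
        WHatR N ρ ξ else 0 := by
  induction M with
  | zero =>
    intro N ρ _ a ξ ξ'
    have h : ξ = ξ' := Subsingleton.elim _ _
    rw [if_pos h]
    simp [hahnWeightProd, hahnProd, total, capacity, wHat, WHatR]
  | succ M ih =>
    intro N ρ hρ a ξ ξ'
    have hcap := capacity_succ (N := N)
    have hρ' : ∀ j : ℤ, |j| ≤ (N (Fin.last M) : ℤ) → ρ ≠ j := fun j hj => hρ j (by omega)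
    have hx := conf_le ξ (Fin.last M)
    have hx' := conf_le ξ' (Fin.last M)
    have hin : ∀ η : Conf (initCap N), ∑ n : Fin (N (Fin.last M) + 1),
        hahnWeightProd N a (a - ρ) (snocConf η n) * hahnProd ρ a (snocConf η n) ξ *
          hahnProd ρ a (snocConf η n) ξ' =
        wHat (initCap N) η * ((-1) ^ total η * poch a (total η) *
          poch (a - ρ + total η + N (Fin.last M)) (capacity (initCap N) - total η)) *
        hahnProd (ρ + 2 * ((ξ (Fin.last M) : ℕ) : ℝ) - N (Fin.last M))
          (a + (ξ (Fin.last M) : ℕ)) η (initConf ξ) *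
        hahnProd (ρ + 2 * ((ξ' (Fin.last M) : ℕ) : ℝ) - N (Fin.last M))
          (a + (ξ' (Fin.last M) : ℕ)) η (initConf ξ') *
        if (ξ (Fin.last M) : ℕ) = ξ' (Fin.last M) then
          hahnNorm (N (Fin.last M)) (ξ (Fin.last M)) ρ (a + total η) else 0 := by
      intro η
      rw [← hahnQ_orthogonal hρ' (a + total η) hx hx', Finset.mul_sum,
        ← Fin.sum_univ_eq_sum_range (fun n => _ * (hahnWeight (N (Fin.last M)) (a + total η)
          (a + total η - ρ) n * hahnQ (N (Fin.last M)) n (ξ (Fin.last M)) (ρ - N (Fin.last M))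
          (a + total η) * hahnQ (N (Fin.last M)) n (ξ' (Fin.last M)) (ρ - N (Fin.last M))
          (a + total η)))]
      refine Finset.sum_congr rfl fun n _ => ?_
      rw [hahnWeightProd_snoc, hahnProd_succ, hahnProd_succ, initConf_snocConf, snocConf_last,
        show a - ρ + total η = a + total η - ρ by ring]
      ring
    rw [sum_conf_succ, Finset.sum_congr rfl fun η _ => hin η]
    by_cases hl : (ξ (Fin.last M) : ℕ) = ξ' (Fin.last M)
    swap
    · rw [if_neg fun h => hl (by rw [h])]
      simp [hl]
    simp only [if_pos hl]
    rw [← hl]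
    -- The norm of the last site and the leftover weight recombine, by splitting shifted factorials
    -- in two ways, into the weight for the shifted `a` and `ρ` times a constant free of `η`.
    have hstep : ∀ η : Conf (initCap N),
        poch a (total η) * poch (a - ρ + total η + N (Fin.last M))
          (capacity (initCap N) - total η) *
          hahnNorm (N (Fin.last M)) (ξ (Fin.last M)) ρ (a + total η) =
        poch (a + (ξ (Fin.last M) : ℕ)) (total η) *
          poch (a + (ξ (Fin.last M) : ℕ) -
            (ρ + 2 * ((ξ (Fin.last M) : ℕ) : ℝ) - N (Fin.last M)) + total η)
            (capacity (initCap N) - total η) *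
          (poch (a - ρ + (N (Fin.last M) - (ξ (Fin.last M) : ℕ)) + capacity (initCap N))
            (ξ (Fin.last M)) * poch a (ξ (Fin.last M)) /
              WHatSite (ξ (Fin.last M)) (N (Fin.last M)) ρ) := by
      intro η
      have ht := total_le_capacity η
      have p1 := poch_add a (total η) (ξ (Fin.last M))
      have p2 := poch_add a (ξ (Fin.last M)) (total η)
      rw [add_comm (ξ (Fin.last M) : ℕ)] at p2
      have p3 := poch_add (a + total η - ρ + (N (Fin.last M) - (ξ (Fin.last M) : ℕ)))
        (ξ (Fin.last M)) (capacity (initCap N) - total η)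
      have p4 := poch_add (a + total η - ρ + (N (Fin.last M) - (ξ (Fin.last M) : ℕ)))
        (capacity (initCap N) - total η) (ξ (Fin.last M))
      rw [add_comm (capacity (initCap N) - total η), Nat.cast_sub ht] at p4
      rw [show a + total η - ρ + (N (Fin.last M) - (ξ (Fin.last M) : ℕ)) + (ξ (Fin.last M) : ℕ) =
        a - ρ + total η + N (Fin.last M) by ring] at p3
      rw [show a + total η - ρ + (N (Fin.last M) - (ξ (Fin.last M) : ℕ)) +
        ((capacity (initCap N) : ℝ) - total η) =
        a - ρ + (N (Fin.last M) - (ξ (Fin.last M) : ℕ)) + capacity (initCap N) by ring, p3] at p4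
      rw [p1] at p2
      rw [hahnNorm, show a + (ξ (Fin.last M) : ℕ) -
        (ρ + 2 * ((ξ (Fin.last M) : ℕ) : ℝ) - N (Fin.last M)) + total η =
        a + total η - ρ + (N (Fin.last M) - (ξ (Fin.last M) : ℕ)) by ring, mul_div_assoc',
        mul_div_assoc']
      congr 1
      linear_combination (poch (a - ρ + total η + N (Fin.last M))
        (capacity (initCap N) - total η) * poch (a + total η - ρ +
          (N (Fin.last M) - (ξ (Fin.last M) : ℕ))) (ξ (Fin.last M))) * p2 +
        poch a (ξ (Fin.last M)) * poch (a + (ξ (Fin.last M) : ℕ)) (total η) * p4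
    have hih := ih (N := initCap N)
      (ρ := ρ + 2 * ((ξ (Fin.last M) : ℕ) : ℝ) - N (Fin.last M)) (fun j hj h => by
        refine hρ (j - 2 * (ξ (Fin.last M) : ℕ) + N (Fin.last M)) ?_ (by push_cast; linarith)
        rw [abs_le] at hj ⊢
        omega) (a + (ξ (Fin.last M) : ℕ)) (initConf ξ) (initConf ξ')
    calc _ = (∑ η, hahnWeightProd (initCap N) (a + (ξ (Fin.last M) : ℕ))
            (a + (ξ (Fin.last M) : ℕ) -
              (ρ + 2 * ((ξ (Fin.last M) : ℕ) : ℝ) - N (Fin.last M))) η *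
            hahnProd (ρ + 2 * ((ξ (Fin.last M) : ℕ) : ℝ) - N (Fin.last M))
              (a + (ξ (Fin.last M) : ℕ)) η (initConf ξ) *
            hahnProd (ρ + 2 * ((ξ (Fin.last M) : ℕ) : ℝ) - N (Fin.last M))
              (a + (ξ (Fin.last M) : ℕ)) η (initConf ξ')) *
          (poch (a - ρ + (N (Fin.last M) - (ξ (Fin.last M) : ℕ)) + capacity (initCap N))
            (ξ (Fin.last M)) * poch a (ξ (Fin.last M)) /
              WHatSite (ξ (Fin.last M)) (N (Fin.last M)) ρ) := by
          rw [Finset.sum_mul]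
          refine Finset.sum_congr rfl fun η _ => ?_
          rw [hahnWeightProd]
          linear_combination wHat (initCap N) η * (-1) ^ total η *
            hahnProd (ρ + 2 * ((ξ (Fin.last M) : ℕ) : ℝ) - N (Fin.last M))
              (a + (ξ (Fin.last M) : ℕ)) η (initConf ξ) *
            hahnProd (ρ + 2 * ((ξ (Fin.last M) : ℕ) : ℝ) - N (Fin.last M))
              (a + (ξ (Fin.last M) : ℕ)) η (initConf ξ') * hstep η
      _ = _ := by
        rw [hih]
        by_cases hi : initConf ξ = initConf ξ'
        swap
        · rw [if_neg hi, if_neg fun h => hi (by rw [h]), zero_mul]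
        rw [if_pos hi, if_pos (conf_ext_iff.2 ⟨hi, Fin.ext hl⟩), WHatR_succ, total_succ ξ, hcap,
          div_mul_div_comm]
        congr 1
        have q1 := poch_add a (ξ (Fin.last M)) (total (initConf ξ))
        rw [add_comm (ξ (Fin.last M) : ℕ)] at q1
        have q2 := poch_add (a - ρ + ((capacity (initCap N) : ℝ) + N (Fin.last M) -
          (total (initConf ξ) + (ξ (Fin.last M) : ℕ)))) (total (initConf ξ)) (ξ (Fin.last M))
        push_cast
        rw [q1, q2, show a + ((ξ (Fin.last M) : ℕ) : ℝ) - (ρ + 2 * ((ξ (Fin.last M) : ℕ) : ℝ) -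
          N (Fin.last M)) + ((capacity (initCap N) : ℝ) - total (initConf ξ)) = a - ρ +
          ((capacity (initCap N) : ℝ) + N (Fin.last M) -
            (total (initConf ξ) + (ξ (Fin.last M) : ℕ))) by ring,
          show a - ρ + ((capacity (initCap N) : ℝ) + N (Fin.last M) -
          (total (initConf ξ) + (ξ (Fin.last M) : ℕ))) + total (initConf ξ) =
            a - ρ + (N (Fin.last M) - (ξ (Fin.last M) : ℕ)) + capacity (initCap N) by ring]
        ring

/-- For square matrices the orthogonality of the columns implies that of the rows. -/
lemma dual_orthogonality {Ω : Type*} [Fintype Ω] [DecidableEq Ω] {P : Ω → Ω → ℝ} {w W : Ω → ℝ}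
    (hW : ∀ ξ, W ξ ≠ 0)
    (h : ∀ ξ ξ', ∑ η, P η ξ * P η ξ' * w η = (if ξ = ξ' then 1 else 0) / W ξ) (η η' : Ω) :
    ∑ ξ, P η ξ * P η' ξ * W ξ = (if η = η' then 1 else 0) / w η := by
  have h1 : (Matrix.of fun ξ η => W ξ * P η ξ * w η) * (Matrix.of P : Matrix Ω Ω ℝ) = 1 := by
    ext ξ ξ'
    rw [Matrix.mul_apply, Matrix.one_apply]
    have := h ξ ξ'
    rw [eq_div_iff (hW ξ)] at this
    rw [← this, Finset.sum_mul]
    exact Finset.sum_congr rfl fun η _ => by simp only [Matrix.of_apply]; ring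
  have h2 : ∀ η η', ∑ ξ, P η ξ * P η' ξ * W ξ * w η' = if η = η' then 1 else 0 := by
    intro η η'
    have h1' : (Matrix.of P : Matrix Ω Ω ℝ) * (Matrix.of fun ξ η => W ξ * P η ξ * w η) = 1 :=
      mul_eq_one_comm.1 h1
    have := congrArg (fun A : Matrix Ω Ω ℝ => A η η') h1'
    rw [Matrix.mul_apply, Matrix.one_apply] at this
    rw [← this]
    exact Finset.sum_congr rfl fun ξ _ => by simp only [Matrix.of_apply]; ring
  -- Nonvanishing of `w` is forced by the diagonal of the inverse relation.
  have h3 : ∀ η, w η ≠ 0 := by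
    intro η h0
    have := h2 η η
    simp [h0] at this
  have h4 := h2 η η'
  rw [← Finset.sum_mul] at h4
  have h5 : ∑ ξ, P η ξ * P η' ξ * W ξ = (if η = η' then 1 else 0) / w η' := by
    rw [eq_div_iff (h3 η'), h4]
  rw [h5]
  split_ifs with e
  · rw [e]
  · simp

section

variable {M : ℕ} {N : Fin M → ℕ}

lemma WHatR_ne_zero {ρ : ℝ} (hρ : ∀ j : ℤ, |j| ≤ (capacity N : ℤ) → ρ ≠ j) (ξ : Conf N) :
    WHatR N ρ ξ ≠ 0 := by
  refine Finset.prod_ne_zero_iff.2 fun k _ => WHatSite_ne_zero (conf_le ξ k) fun j hj h => ?_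
  refine hPlus_add_ne_zero hρ ξ (k + 1) (i := -j) ?_ (by rw [h]; push_cast; ring)
  rw [abs_neg, sumLT_succ]
  push_cast
  omega

lemma omegaPR_eq (ρ v : ℝ) (ξ : Conf N) : omegaPR (capacity N) ρ v (total ξ) =
    poch ((v - ρ - capacity N + 1) / 2 + (capacity N - total ξ : ℕ)) (total ξ) /
      poch ((v + ρ - capacity N + 1) / 2) (total ξ) := by
  rw [omegaPR, Nat.cast_sub (total_le_capacity ξ)]
  congr 2
  ring

lemma omegaPR_ne_zero {ρ v : ℝ} (h : HahnGeneric N ρ v) (ξ : Conf N) :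
    omegaPR (capacity N) ρ v (total ξ) ≠ 0 := by
  have ht := total_le_capacity ξ
  rw [omegaPR_eq]
  have := h.poch_fst_ne_zero (m := 0) (n := total ξ) (by omega)
  rw [Nat.cast_zero, add_zero] at this
  exact div_ne_zero (h.poch_snd_ne_zero' (by omega)) this

/-- With `B = (v - ρ - |N| + 1) / 2`, the two prefactors `1 / (B)_{|η|}` and the denominator of
`omegaP` combine, through `(B)_{|η|} (B + |η|)_{|N|-|η|} = (B)_{|N|}`, into the polynomial weight
over a constant. -/
lemma PHat_orthogonal {ρ v : ℝ} (h : HahnGeneric N ρ v)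
    (hρ : ∀ j : ℤ, |j| ≤ (capacity N : ℤ) → ρ ≠ j) (ξ ξ' : Conf N) :
    ∑ η : Conf N, PHat N ρ v η ξ * PHat N ρ v η ξ' *
        (omegaP (capacity N) ρ v (total η) * wHat N η) =
      (if ξ = ξ' then 1 else 0) / (omegaPR (capacity N) ρ v (total ξ) * WHatR N ρ ξ) := by
  have hS := h.poch_snd_ne_zero' (m := 0) (n := capacity N) (by omega)
  rw [Nat.cast_zero, add_zero] at hS
  have horth := hahnProd_orthogonal hρ ((v + ρ - capacity N + 1) / 2) ξ ξ'
  rw [show (v + ρ - capacity N + 1) / 2 - ρ = (v - ρ - capacity N + 1) / 2 by ring] at horth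
  have hterm : ∀ η : Conf N, PHat N ρ v η ξ * PHat N ρ v η ξ' *
      (omegaP (capacity N) ρ v (total η) * wHat N η) =
      poch ((v - ρ - capacity N + 1) / 2) (capacity N - total ξ) *
        poch ((v - ρ - capacity N + 1) / 2) (capacity N - total ξ') /
        poch ((v - ρ - capacity N + 1) / 2) (capacity N) ^ 2 *
      (hahnWeightProd N ((v + ρ - capacity N + 1) / 2) ((v - ρ - capacity N + 1) / 2) η *
        hahnProd ρ ((v + ρ - capacity N + 1) / 2) η ξ *
        hahnProd ρ ((v + ρ - capacity N + 1) / 2) η ξ') := by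
    intro η
    have ht := total_le_capacity η
    have e := poch_add ((v - ρ - capacity N + 1) / 2) (total η) (capacity N - total η)
    rw [Nat.add_sub_cancel' ht] at e
    rw [e] at hS
    have h1 := left_ne_zero_of_mul hS
    have h2 := right_ne_zero_of_mul hS
    rw [PHat_eq_hahnProd h, PHat_eq_hahnProd h, omegaP, hahnWeightProd, e,
      show (ρ - capacity N + v + 1) / 2 = (v + ρ - capacity N + 1) / 2 by ring,
      add_comm (total η : ℝ)]
    field_simp
  rw [Finset.sum_congr rfl fun η _ => hterm η, ← Finset.mul_sum, horth]
  by_cases hξ : ξ = ξ'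
  · subst hξ
    have ht := total_le_capacity ξ
    rw [if_pos rfl, if_pos rfl, omegaPR_eq]
    have hW := WHatR_ne_zero hρ ξ
    have e := poch_add ((v - ρ - capacity N + 1) / 2) (capacity N - total ξ) (total ξ)
    rw [Nat.sub_add_cancel ht] at e
    rw [e] at hS
    have h1 := left_ne_zero_of_mul hS
    have h2 := right_ne_zero_of_mul hS
    rw [e, ← Nat.cast_sub ht]
    have h3 := h.poch_fst_ne_zero (m := 0) (n := total ξ) (by omega)
    rw [Nat.cast_zero, add_zero] at h3
    field_simp
  · rw [if_neg hξ, if_neg hξ, mul_zero, zero_div]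

end

/-! ## Krawtchouk polynomials -/

/-- The coefficients of the Krawtchouk polynomial in the basis `uBasis`, where `t = 1 / p`. -/
def krawCoeff (t x : ℝ) (j : ℕ) : ℝ := poch (-x) j / (j.factorial : ℝ) * t ^ j

/-- The Krawtchouk polynomial as a linear combination of the functions `uBasis`. -/
def krawQ (N n x : ℕ) (t : ℝ) : ℝ := uSum N n (krawCoeff t x)

lemma krawCoeff_zero (t x : ℝ) : krawCoeff t x 0 = 1 := by simp [krawCoeff]

lemma krawCoeff_succ (t x : ℝ) (j : ℕ) :
    krawCoeff t x (j + 1) = krawCoeff t x j * ((j - x) * t / (j + 1)) := by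
  have h : (j : ℝ) + 1 ≠ 0 := by positivity
  have h2 : (j.factorial : ℝ) ≠ 0 := Nat.cast_ne_zero.2 j.factorial_ne_zero
  rw [krawCoeff, krawCoeff, poch_succ, Nat.factorial_succ, pow_succ]
  push_cast
  field_simp
  ring

lemma krawCoeff_add_one_succ (t x : ℝ) (j : ℕ) :
    krawCoeff t (x + 1) (j + 1) = -(krawCoeff t x j * ((x + 1) * t / (j + 1))) := by
  have h : (j : ℝ) + 1 ≠ 0 := by positivity
  have h2 : (j.factorial : ℝ) ≠ 0 := Nat.cast_ne_zero.2 j.factorial_ne_zero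
  rw [krawCoeff, krawCoeff, poch_succ_left, Nat.factorial_succ, pow_succ,
    show -(x + 1) + 1 = -x by ring]
  push_cast
  field_simp

lemma krawCoeff_natCast_of_lt {x j : ℕ} (h : x < j) (t : ℝ) : krawCoeff t x j = 0 := by
  simp [krawCoeff, poch_neg_natCast_of_lt h]

lemma mul_krawCoeff_sub_one (t x : ℝ) (j : ℕ) :
    x * krawCoeff t (x - 1) j = (x - j) * krawCoeff t x j := by
  have := poch_succ_left (-x) j
  rw [poch_succ] at this
  rw [krawCoeff, krawCoeff, show -(x - 1) = -x + 1 by ring]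
  linear_combination (t ^ j / (j.factorial : ℝ)) * this

lemma krawQ_mul_pred (N n x : ℕ) (t : ℝ) :
    (x : ℝ) * krawQ N n (x - 1) t = uSum N n fun j => (x - j) * krawCoeff t x j := by
  rw [← uSum_congr fun j => mul_krawCoeff_sub_one t x j, uSum_const_mul]
  cases x with
  | zero => simp
  | succ x => rw [krawQ]; simp

lemma krawQ_succ (N n x : ℕ) (t : ℝ) : krawQ N n (x + 1) t = uSum N n (krawCoeff t (x + 1)) := by
  rw [krawQ]; push_cast; rfl

/-- This and the next two lemmas convert multiplication by `n` and the weighted shifts of `n` into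
tridiagonal operators in `x`. No parameter moves, so the sites do not interact through nested
arguments. -/
lemma krawQ_mul {N n : ℕ} (hn : n ≤ N) (x : ℕ) (v : ℝ) :
    (1 + v) * (n * krawQ N n x (1 + v)) =
      (N - x) * krawQ N n x (1 + v) - (N - x) * krawQ N n (x + 1) (1 + v) +
        (v * x * krawQ N n x (1 + v) - v * (x * krawQ N n (x - 1) (1 + v))) := by
  rw [krawQ_mul_pred, krawQ_succ, krawQ, mul_uSum hn]
  simp only [← uSum_const_mul, ← uSum_sub, ← uSum_add]
  refine uSum_congr fun j => ?_
  cases j with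
  | zero => simp [krawCoeff_zero]
  | succ i =>
    have h : (i : ℝ) + 1 ≠ 0 := by positivity
    rw [shiftSeq_succ, krawCoeff_succ, krawCoeff_add_one_succ]
    push_cast
    field_simp
    ring

lemma krawQ_mul_left {N n : ℕ} (hn : n ≤ N) (x : ℕ) (v : ℝ) :
    (1 + v) * (n * krawQ N (n - 1) x (1 + v)) =
      (N - x) * krawQ N n x (1 + v) - (N - x) * krawQ N n (x + 1) (1 + v) +
        (x * krawQ N n (x - 1) (1 + v) - x * krawQ N n x (1 + v)) := by
  rw [krawQ_mul_pred, krawQ_succ, krawQ, krawQ, mul_uSum_pred hn]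
  simp only [← uSum_const_mul, ← uSum_sub, ← uSum_add]
  refine uSum_congr fun j => ?_
  cases j with
  | zero => simp [krawCoeff_zero]
  | succ i =>
    have h : (i : ℝ) + 1 ≠ 0 := by positivity
    rw [shiftSeq_succ, krawCoeff_succ, krawCoeff_add_one_succ]
    push_cast
    field_simp
    ring

lemma krawQ_mul_right {N n x : ℕ} (hn : n ≤ N) (hx : x ≤ N) (v : ℝ) :
    (1 + v) * ((N - n) * krawQ N (n + 1) x (1 + v)) =
      (N - x) * krawQ N n (x + 1) (1 + v) + v * (N - 2 * x) * krawQ N n x (1 + v) -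
        v ^ 2 * (x * krawQ N n (x - 1) (1 + v)) := by
  rw [krawQ_mul_pred, krawQ_succ, krawQ, krawQ,
    sub_mul_uSum_add_one hn (krawCoeff_natCast_of_lt (Nat.lt_succ_of_le hx) _)]
  simp only [← uSum_const_mul, ← uSum_sub, ← uSum_add]
  refine uSum_congr fun j => ?_
  cases j with
  | zero =>
    rw [krawCoeff_succ, shiftSeq_zero, krawCoeff_zero, krawCoeff_zero]
    push_cast
    ring
  | succ i =>
    have h : (i : ℝ) + 1 ≠ 0 := by positivity
    have h' : (i : ℝ) + 1 + 1 ≠ 0 := by positivity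
    rw [krawCoeff_add_one_succ]
    simp only [shiftSeq_succ, krawCoeff_succ]
    push_cast
    field_simp
    ring

/-- The self-duality of two neighbouring sites. -/
lemma krawQ_duality {N₁ N₂ x₁ x₂ n₁ n₂ : ℕ} (hx₁ : x₁ ≤ N₁) (hx₂ : x₂ ≤ N₂)
    (hn₁ : n₁ ≤ N₁) (hn₂ : n₂ ≤ N₂) {v : ℝ} (hv : 1 + v ≠ 0) (t : ℕ → ℕ → ℕ → ℕ → ℝ)
    (ht : ∀ x₁ x₂ n₁ n₂, t x₁ x₂ n₁ n₂ = krawQ N₁ n₁ x₁ (1 + v) * krawQ N₂ n₂ x₂ (1 + v)) :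
    n₁ * ((N₂ : ℝ) - n₂) * (t x₁ x₂ (n₁ - 1) (n₂ + 1) - t x₁ x₂ n₁ n₂) +
      n₂ * ((N₁ : ℝ) - n₁) * (t x₁ x₂ (n₁ + 1) (n₂ - 1) - t x₁ x₂ n₁ n₂) =
    x₁ * ((N₂ : ℝ) - x₂) * (t (x₁ - 1) (x₂ + 1) n₁ n₂ - t x₁ x₂ n₁ n₂) +
      x₂ * ((N₁ : ℝ) - x₁) * (t (x₁ + 1) (x₂ - 1) n₁ n₂ - t x₁ x₂ n₁ n₂) := by
  have S1 := krawQ_mul_left hn₁ x₁ v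
  have S2 := krawQ_mul_left hn₂ x₂ v
  have M1 := krawQ_mul hn₁ x₁ v
  have M2 := krawQ_mul hn₂ x₂ v
  have T1 := krawQ_mul_right hn₁ hx₁ v
  have T2 := krawQ_mul_right hn₂ hx₂ v
  simp only [ht]
  have key : ∀ {y z : ℝ}, (1 + v) * y = z → y = z / (1 + v) := fun h => by
    rw [eq_div_iff hv, mul_comm, h]
  replace S1 := key S1
  replace S2 := key S2
  replace M1 := key M1
  replace M2 := key M2
  replace T1 := key T1
  replace T2 := key T2
  have e : ∀ a b c d p q r s x y : ℝ,
      a * b * (p * q - x * y) + c * d * (r * s - x * y) =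
        (a * p) * (b * q) + (d * r) * (c * s) - (a * b + c * d) * (x * y) := by intros; ring
  -- Each product is grouped so that every factor depends on one site only and is covered by a
  -- one-site relation.
  rw [e, S1, S2, T1, T2, show ((n₁ : ℝ) * ((N₂ : ℝ) - n₂) + n₂ * ((N₁ : ℝ) - n₁)) *
      (krawQ N₁ n₁ x₁ (1 + v) * krawQ N₂ n₂ x₂ (1 + v)) =
    (n₁ * krawQ N₁ n₁ x₁ (1 + v)) * (N₂ * krawQ N₂ n₂ x₂ (1 + v)) +
      (N₁ * krawQ N₁ n₁ x₁ (1 + v)) * (n₂ * krawQ N₂ n₂ x₂ (1 + v)) -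
      2 * ((n₁ * krawQ N₁ n₁ x₁ (1 + v)) * (n₂ * krawQ N₂ n₂ x₂ (1 + v))) by ring, M1, M2]
  field_simp
  ring

lemma krawQ_zero (N n : ℕ) (t : ℝ) : krawQ N n 0 t = 1 := by
  rw [krawQ, uSum_eq_sum_range (x := 0) (Nat.zero_le N) fun j hj => krawCoeff_natCast_of_lt hj t]
  simp [krawCoeff_zero]

lemma sum_binomial_mul_uBasis {N j : ℕ} (hj : j ≤ N) (z : ℝ) :
    ∑ n ∈ Finset.range (N + 1), ((N.choose n : ℝ) * z ^ n) * uBasis N n j =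
      z ^ j * (1 + z) ^ (N - j) := by
  obtain ⟨m, rfl⟩ := Nat.exists_eq_add_of_le hj
  rw [add_assoc, Finset.sum_range_add, Finset.sum_eq_zero, zero_add, Nat.add_sub_cancel_left,
    add_comm (1 : ℝ), add_pow, Finset.mul_sum]
  · refine Finset.sum_congr rfl fun i hi => ?_
    have h1 := Nat.choose_mul (n := j + m) (k := j + i) (s := j) (by omega)
    rw [Nat.add_sub_cancel_left, Nat.add_sub_cancel_left] at h1
    have h2 : ((j + m).choose (j + i) : ℝ) * (j + i).choose j = (j + m).choose j * m.choose i := by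
      exact_mod_cast h1
    have h3 := choose_cast_ne_zero (N := j + m) (j := j) (by omega)
    have h4 : ((j + m).choose (j + i) : ℝ) * uBasis (j + m) (j + i) j = m.choose i := by
      rw [uBasis, mul_div_assoc', h2]; field_simp
    rw [pow_add, one_pow]
    linear_combination (z ^ j * z ^ i) * h4
  · intro n hn
    rw [uBasis_of_lt (Finset.mem_range.1 hn), mul_zero]

/-- The `j`-th moment cancels the power `(1 + v) ^ j`, and the sum becomes `(1 + 1 / v) ^ N` times
the binomial expansion of `(-1 + 1) ^ y`. -/
lemma sum_binomial_mul_krawQ {N y : ℕ} (hy : y ≤ N) {v : ℝ} (hv : v ≠ 0) :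
    ∑ n ∈ Finset.range (N + 1), ((N.choose n : ℝ) * v⁻¹ ^ n) * krawQ N n y (1 + v) =
      if 0 = y then (1 + v⁻¹) ^ N else 0 := by
  have e1 : ∀ n, krawQ N n y (1 + v) = ∑ j ∈ Finset.range (y + 1),
      krawCoeff (1 + v) y j * uBasis N n j := fun n =>
    uSum_eq_sum_range hy fun j hj => krawCoeff_natCast_of_lt hj _
  simp only [e1, Finset.mul_sum]
  rw [Finset.sum_comm]
  have e2 : ∀ j ∈ Finset.range (y + 1), ∑ n ∈ Finset.range (N + 1), ((N.choose n : ℝ) * v⁻¹ ^ n) *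
      (krawCoeff (1 + v) y j * uBasis N n j) =
      (1 + v⁻¹) ^ N * ((-1) ^ j * 1 ^ (y - j) * (y.choose j : ℝ)) := by
    intro j hj
    have hj' : j ≤ N := (Finset.mem_range_succ_iff.1 hj).trans hy
    have h1 := sum_binomial_mul_uBasis hj' v⁻¹
    have h2 : (1 + v) ^ j * v⁻¹ ^ j = (1 + v⁻¹) ^ j := by
      rw [← mul_pow]; congr 1; field_simp; ring
    have h3 : (1 + v⁻¹) ^ N = (1 + v⁻¹) ^ j * (1 + v⁻¹) ^ (N - j) := by
      rw [← pow_add, Nat.add_sub_cancel' hj']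
    have h4 : (j.factorial : ℝ) ≠ 0 := Nat.cast_ne_zero.2 j.factorial_ne_zero
    have h5 : krawCoeff (1 + v) y j = (-1) ^ j * (y.choose j : ℝ) * (1 + v) ^ j := by
      rw [krawCoeff, poch_neg_natCast]; field_simp
    rw [h3, ← h2, h5, one_pow]
    rw [show ∑ n ∈ Finset.range (N + 1), ((N.choose n : ℝ) * v⁻¹ ^ n) *
      ((-1) ^ j * (y.choose j : ℝ) * (1 + v) ^ j * uBasis N n j) =
      ((-1) ^ j * (y.choose j : ℝ) * (1 + v) ^ j) * ∑ n ∈ Finset.range (N + 1),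
        ((N.choose n : ℝ) * v⁻¹ ^ n) * uBasis N n j by
      rw [Finset.mul_sum]; exact Finset.sum_congr rfl fun n _ => by ring, h1]
    ring
  rw [Finset.sum_congr rfl e2, ← Finset.mul_sum, ← add_pow]
  split_ifs with h
  · subst h; simp
  · rw [neg_add_cancel, zero_pow (Ne.symm h), mul_zero]

lemma krawQ_orthogonal {N x y : ℕ} (hx : x ≤ N) (hy : y ≤ N) {v : ℝ} (hv : 0 < v) :
    ∑ n ∈ Finset.range (N + 1), ((N.choose n : ℝ) * v⁻¹ ^ n) * krawQ N n x (1 + v) *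
      krawQ N n y (1 + v) = if x = y then (1 + v⁻¹) ^ N * v ^ x / (N.choose x : ℝ) else 0 := by
  have hv' : 1 + v ≠ 0 := by positivity
  refine orthogonal_of_recurrence (N := N) (f := fun x n => krawQ N n x (1 + v))
    (p := fun x => -(N - x) / (1 + v)) (q := fun x => (N - x + v * x) / (1 + v))
    (s := fun x => -(v * x) / (1 + v))
    (h := fun x => (1 + v⁻¹) ^ N * v ^ x / (N.choose x : ℝ)) ?_ ?_ ?_ ?_ ?_ ?_ x hx y hy
  · intro x hx n hn
    have := krawQ_mul hn x v
    field_simp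
    linear_combination this
  · intro x hx
    have h1 : (N : ℝ) - x ≠ 0 := by rw [sub_ne_zero]; exact_mod_cast hx.ne'
    exact div_ne_zero (neg_ne_zero.2 h1) hv'
  · simp
  · simp
  · intro y hy
    simp only [krawQ_zero, mul_one]
    rw [sum_binomial_mul_krawQ hy hv.ne']
    simp
  · intro x hx
    have h1 := choose_cast_ne_zero hx.le
    have h2 := choose_cast_ne_zero (N := N) (j := x + 1) hx
    have h3 := cast_choose_succ N x
    have h4 : (N : ℝ) - x ≠ 0 := by rw [sub_ne_zero]; exact_mod_cast hx.ne'
    have h5 : (x : ℝ) + 1 ≠ 0 := by positivity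
    have h6 : (N.choose (x + 1) : ℝ) = N.choose x * (N - x) / (x + 1) := by
      rw [eq_div_iff h5, h3]
    simp only [h6]
    push_cast
    field_simp
    ring

lemma krawtchouk_eq_krawQ {N n x : ℕ} (hn : n ≤ N) (v : ℝ) :
    krawtchouk n x (1 / (1 + v)) N = krawQ N n x (1 + v) := by
  rw [krawQ, uSum, krawtchouk]
  rw [← Finset.sum_subset (Finset.range_mono (by omega : n + 1 ≤ N + 1))]
  · refine Finset.sum_congr rfl fun j _ => ?_
    rw [krawCoeff, ← poch_neg_div_poch_neg, one_div_one_div]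
    ring
  · intro j _ hj
    rw [uBasis_of_lt (by simpa using hj), mul_zero]

section

variable {M : ℕ} {N : Fin M → ℕ}

lemma KHat_eq {v : ℝ} (hv : 0 < v) (η ξ : Conf N) : KHat N v η ξ =
    v ^ (-(total η : ℝ) / 2) * ∏ k, krawQ (N k) (η k) (ξ k) (1 + v) := by
  rw [KHat]
  simp only [kHat]
  rw [Finset.prod_mul_distrib, ← Real.rpow_sum_of_pos hv]
  congr 1
  · congr 1
    rw [total, Nat.cast_sum, ← Finset.sum_neg_distrib, Finset.sum_div]
  · exact Finset.prod_congr rfl fun k _ => krawtchouk_eq_krawQ (conf_le η k) v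

lemma isDuality_KHat {v : ℝ} (hv : 0 < v) :
    IsDuality (sepGenerator N) (sepGenerator N) (KHat N v) := by
  refine isDuality_of_local (properRates_sep N) (properRates_sep N) ?_
  intro η ξ k l hl
  have hkl : k ≠ l := fun e => by rw [e] at hl; omega
  refine ⟨v ^ (-(total η : ℝ) / 2) * ∏ j ∈ (Finset.univ.erase k).erase l,
      krawQ (N j) (η j) (ξ j) (1 + v),
    fun x₁ x₂ n₁ n₂ => krawQ (N k) n₁ x₁ (1 + v) * krawQ (N l) n₂ x₂ (1 + v),
    fun η' ξ' hη hξ => ?_, ?_⟩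
  · rw [KHat_eq hv, hη.total_eq hkl, prod_eq_mul_mul_prod_erase hkl]
    have : ∏ j ∈ (Finset.univ.erase k).erase l, krawQ (N j) (η' j) (ξ' j) (1 + v) =
        ∏ j ∈ (Finset.univ.erase k).erase l, krawQ (N j) (η j) (ξ j) (1 + v) := by
      refine Finset.prod_congr rfl fun j hj => ?_
      simp only [Finset.mem_erase] at hj
      rw [hη.1 j hj.2.1 hj.1, hξ.1 j hj.2.1 hj.1]
    rw [this]
    ring
  · exact krawQ_duality (conf_le ξ k) (conf_le ξ l) (conf_le η k) (conf_le η l)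
      (by positivity) _ fun _ _ _ _ => rfl

lemma wHat_ne_zero (η : Conf N) : wHat N η ≠ 0 :=
  Finset.prod_ne_zero_iff.2 fun k _ => choose_cast_ne_zero (conf_le η k)

lemma omegaK_ne_zero {v : ℝ} (hv : 0 < v) (S x : ℕ) : omegaK S v x ≠ 0 := by
  unfold omegaK; positivity

/-- The two prefactors multiply to `v ^ (-|η|)`, which supplies the binomial weight at each site;
the sum then factorizes over the sites. -/
lemma KHat_orthogonal {v : ℝ} (hv : 0 < v) (ξ ξ' : Conf N) :
    ∑ η : Conf N, KHat N v η ξ * KHat N v η ξ' * wHat N η =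
      (if ξ = ξ' then 1 else 0) / (omegaK (capacity N) v (total ξ) * wHat N ξ) := by
  have hterm : ∀ η : Conf N, KHat N v η ξ * KHat N v η ξ' * wHat N η =
      ∏ k, (((N k).choose (η k) : ℝ) * v⁻¹ ^ (η k : ℕ)) * krawQ (N k) (η k) (ξ k) (1 + v) *
        krawQ (N k) (η k) (ξ' k) (1 + v) := by
    intro η
    have h1 : v ^ (-(total η : ℝ) / 2) * v ^ (-(total η : ℝ) / 2) = ∏ k, v⁻¹ ^ (η k : ℕ) := by
      rw [← Real.rpow_add hv, Finset.prod_pow_eq_pow_sum, add_halves, Real.rpow_neg hv.le,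
        Real.rpow_natCast, inv_pow]
      rfl
    rw [KHat_eq hv, KHat_eq hv, wHat]
    simp only [Finset.prod_mul_distrib]
    rw [← h1]
    ring
  have hsum : ∑ η : Conf N, ∏ k, (((N k).choose (η k) : ℝ) * v⁻¹ ^ (η k : ℕ)) *
      krawQ (N k) (η k) (ξ k) (1 + v) * krawQ (N k) (η k) (ξ' k) (1 + v) =
      ∏ k, if (ξ k : ℕ) = ξ' k then (1 + v⁻¹) ^ N k * v ^ (ξ k : ℕ) / ((N k).choose (ξ k) : ℝ)
        else 0 := by
    have := Finset.prod_univ_sum (fun k : Fin M => (Finset.univ : Finset (Fin (N k + 1))))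
      fun k n => (((N k).choose n : ℝ) * v⁻¹ ^ (n : ℕ)) * krawQ (N k) n (ξ k) (1 + v) *
        krawQ (N k) n (ξ' k) (1 + v)
    rw [Fintype.piFinset_univ] at this
    rw [← this]
    refine Finset.prod_congr rfl fun k _ => ?_
    rw [← krawQ_orthogonal (conf_le ξ k) (conf_le ξ' k) hv, ← Fin.sum_univ_eq_sum_range
      (fun n => (((N k).choose n : ℝ) * v⁻¹ ^ (n : ℕ)) * krawQ (N k) n (ξ k) (1 + v) *
        krawQ (N k) n (ξ' k) (1 + v))]
  rw [Finset.sum_congr rfl fun η _ => hterm η, hsum]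
  by_cases h : ξ = ξ'
  · subst h
    simp only [if_true]
    rw [Finset.prod_div_distrib, Finset.prod_mul_distrib, Finset.prod_pow_eq_pow_sum,
      Finset.prod_pow_eq_pow_sum]
    change (1 + v⁻¹) ^ capacity N * v ^ total ξ / wHat N ξ = _
    have := wHat_ne_zero ξ
    rw [omegaK, zpow_neg, zpow_natCast, one_div v]
    have : 1 + v⁻¹ ≠ 0 := by positivity
    field_simp
  · rw [if_neg h, zero_div]
    obtain ⟨k, hk⟩ := Function.ne_iff.1 h
    exact Finset.prod_eq_zero (Finset.mem_univ k) (if_neg fun e => hk (Fin.ext e))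

end

/-! ## The limit `q → 1` -/

lemma eventually_pos_ne_one : ∀ᶠ q : ℝ in 𝓝[≠] 1, 0 < q ∧ q ≠ 1 := by
  filter_upwards [self_mem_nhdsWithin, mem_nhdsWithin_of_mem_nhds (lt_mem_nhds one_pos)]
    with q h1 h2 using ⟨h2, h1⟩

lemma one_sub_sq_ne_zero {q : ℝ} (hq : 0 < q) (h1 : q ≠ 1) : 1 - q ^ 2 ≠ 0 := by
  intro h
  have : (1 - q) * (1 + q) = 0 := by linear_combination h
  rcases mul_eq_zero.1 this with h | h
  · exact h1 (by linarith)
  · linarith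

lemma tendsto_rpow_sub_one_div (s : ℝ) :
    Filter.Tendsto (fun q : ℝ => (q ^ s - 1) / (q - 1)) (𝓝[≠] 1) (𝓝 s) := by
  have h := (Real.hasDerivAt_rpow_const (x := 1) (p := s) (Or.inl one_ne_zero)).tendsto_slope
  rw [Real.one_rpow, mul_one] at h
  refine h.congr fun q => ?_
  rw [slope_def_field, Real.one_rpow]

/-- A ratio of two difference quotients of powers of `q` at `q = 1`. -/
lemma tendsto_one_sub_rpow_div (s : ℝ) :
    Filter.Tendsto (fun q : ℝ => (1 - q ^ (2 * s)) / (1 - q ^ 2)) (𝓝[≠] 1) (𝓝 s) := by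
  have h := (tendsto_rpow_sub_one_div (2 * s)).div (tendsto_rpow_sub_one_div 2) two_ne_zero
  rw [mul_div_cancel_left₀ s two_ne_zero] at h
  refine h.congr' ?_
  filter_upwards [eventually_pos_ne_one] with q ⟨hq, h1⟩
  have h2 : q - 1 ≠ 0 := sub_ne_zero.2 h1
  simp only [Pi.div_apply]
  rw [div_div_div_cancel_right₀ h2, Real.rpow_two, ← neg_sub 1 (q ^ (2 * s)), ← neg_sub 1 (q ^ 2),
    neg_div_neg_eq]

lemma tendsto_rpow_nhds_one (s : ℝ) :
    Filter.Tendsto (fun q : ℝ => q ^ s) (𝓝[≠] 1) (𝓝 1) := by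
  have h : ContinuousAt (fun q : ℝ => q ^ s) 1 :=
    Real.continuousAt_rpow_const 1 s (Or.inl one_ne_zero)
  have := h.tendsto
  rw [Real.one_rpow] at this
  exact this.mono_left nhdsWithin_le_nhds

lemma tendsto_qPoch (s : ℝ) (n : ℕ) :
    Filter.Tendsto (fun q : ℝ => qPoch (q ^ (2 * s)) (q ^ 2) n / (1 - q ^ 2) ^ n) (𝓝[≠] 1)
      (𝓝 (poch s n)) := by
  rw [poch_eq_prod]
  refine (tendsto_finsetProd (Finset.range n) fun i _ =>
    tendsto_one_sub_rpow_div (s + i)).congr' ?_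
  filter_upwards [eventually_pos_ne_one] with q ⟨hq, _⟩
  rw [Finset.prod_div_distrib, Finset.prod_const, Finset.card_range, qPoch]
  congr 1
  refine Finset.prod_congr rfl fun i _ => ?_
  rw [mul_add, Real.rpow_add hq, ← pow_mul, ← Real.rpow_natCast q (2 * i)]
  push_cast
  rfl

lemma poch_one_eq_factorial (n : ℕ) : poch 1 n = n.factorial := by
  induction n with
  | zero => simp
  | succ n ih => rw [poch_succ, ih, Nat.factorial_succ]; push_cast; ring

lemma tendsto_qPoch_self (n : ℕ) :
    Filter.Tendsto (fun q : ℝ => qPoch (q ^ 2) (q ^ 2) n / (1 - q ^ 2) ^ n) (𝓝[≠] 1)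
      (𝓝 (n.factorial : ℝ)) := by
  rw [← poch_one_eq_factorial]
  simpa using tendsto_qPoch 1 n

lemma tendsto_qPoch_zpow (m n : ℕ) :
    Filter.Tendsto (fun q : ℝ => qPoch ((q ^ 2) ^ (-(m : ℤ))) (q ^ 2) n / (1 - q ^ 2) ^ n) (𝓝[≠] 1)
      (𝓝 (poch (-(m : ℝ)) n)) := by
  refine (tendsto_qPoch (-(m : ℝ)) n).congr' ?_
  filter_upwards [eventually_pos_ne_one] with q ⟨hq, _⟩
  congr 2
  rw [mul_neg, Real.rpow_neg hq.le, zpow_neg, zpow_natCast, ← pow_mul, ← Real.rpow_natCast]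
  push_cast
  rfl

lemma poch_ne_zero_of_le {a : ℝ} {m n : ℕ} (h : poch a n ≠ 0) (hmn : m ≤ n) : poch a m ≠ 0 := by
  rw [← Nat.add_sub_cancel' hmn, poch_add] at h
  exact left_ne_zero_of_mul h

lemma poch_neg_natCast_ne_zero {N j : ℕ} (h : j ≤ N) : poch (-(N : ℝ)) j ≠ 0 := by
  rw [poch_neg_natCast]
  exact mul_ne_zero (mul_ne_zero (pow_ne_zero _ (by norm_num))
    (Nat.cast_ne_zero.2 j.factorial_ne_zero)) (choose_cast_ne_zero h)

lemma tendsto_sq_pow (j : ℕ) :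
    Filter.Tendsto (fun q : ℝ => (q ^ 2) ^ j) (𝓝[≠] 1) (𝓝 1) := by
  have h : Continuous fun q : ℝ => (q ^ 2) ^ j := by fun_prop
  simpa using (h.tendsto 1).mono_left nhdsWithin_le_nhds

/-- Each term has three `q`-shifted factorials of length `j` above and three below, so the powers of
`1 - q^2` cancel. -/
lemma tendsto_qHahn {n N : ℕ} (hn : n ≤ N) (x : ℕ) {α β : ℝ} (h : poch (α + 1) n ≠ 0) :
    Filter.Tendsto (fun q : ℝ => qHahn n x (q ^ (2 * α)) (q ^ (2 * β)) N (q ^ 2)) (𝓝[≠] 1)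
      (𝓝 (hahn n x α β N)) := by
  refine tendsto_finsetSum _ fun j hj => ?_
  have hj' : j ≤ n := Finset.mem_range_succ_iff.1 hj
  have hd : poch (α + 1) j * poch (-(N : ℝ)) j * (j.factorial : ℝ) ≠ 0 :=
    mul_ne_zero (mul_ne_zero (poch_ne_zero_of_le h hj') (poch_neg_natCast_ne_zero (hj'.trans hn)))
      (Nat.cast_ne_zero.2 j.factorial_ne_zero)
  have := ((((tendsto_qPoch_zpow n j).mul (tendsto_qPoch (n + α + β + 1) j)).mul
    (tendsto_qPoch_zpow x j)).div (((tendsto_qPoch (α + 1) j).mul (tendsto_qPoch_zpow N j)).mul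
    (tendsto_qPoch_self j)) hd).mul (tendsto_sq_pow j)
  rw [mul_one] at this
  refine this.congr' ?_
  filter_upwards [eventually_pos_ne_one] with q ⟨hq, h1⟩
  have ht := pow_ne_zero j (one_sub_sq_ne_zero hq h1)
  have e1 : q ^ (2 * ((n : ℝ) + α + β + 1)) = q ^ (2 * α) * q ^ (2 * β) * (q ^ 2) ^ (n + 1) := by
    rw [← pow_mul, ← Real.rpow_natCast, ← Real.rpow_add hq, ← Real.rpow_add hq]
    congr 1
    push_cast
    ring
  have e2 : q ^ (2 * (α + 1)) = q ^ (2 * α) * q ^ 2 := by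
    rw [← Real.rpow_two, ← Real.rpow_add hq, mul_add, mul_one]
  simp only [Pi.div_apply]
  rw [e1, e2]
  congr 1
  simp only [div_mul_div_comm]
  rw [div_div_div_cancel_right₀ (mul_ne_zero (mul_ne_zero ht ht) ht)]

lemma tendsto_qBinom {x N : ℕ} (hx : x ≤ N) :
    Filter.Tendsto (fun q : ℝ => qBinom (q ^ 2) N x) (𝓝[≠] 1) (𝓝 (N.choose x : ℝ)) := by
  have h := (tendsto_qPoch_self N).div ((tendsto_qPoch_self x).mul (tendsto_qPoch_self (N - x)))
    (mul_ne_zero (Nat.cast_ne_zero.2 x.factorial_ne_zero)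
      (Nat.cast_ne_zero.2 (N - x).factorial_ne_zero))
  rw [← Nat.cast_choose ℝ hx] at h
  refine h.congr' ?_
  filter_upwards [eventually_pos_ne_one] with q ⟨hq, h1⟩
  have ht := pow_ne_zero N (one_sub_sq_ne_zero hq h1)
  simp only [Pi.div_apply]
  rw [div_mul_div_comm, ← pow_add, Nat.add_sub_cancel' hx, div_div_div_cancel_right₀ ht, qBinom]

/-- Only two vanishing `q`-shifted factorials stand on each side of the fraction. The third one
above has base tending to `-v` and contributes `(1 + v) ^ j`, the power of `1 / p`. -/
lemma tendsto_qKrawtchouk {n N : ℕ} (hn : n ≤ N) (x : ℕ) (v h : ℝ) :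
    Filter.Tendsto (fun q : ℝ => qKrawtchouk n x (v * q ^ (2 * h)) N (q ^ 2)) (𝓝[≠] 1)
      (𝓝 (krawtchouk n x (1 / (1 + v)) N)) := by
  refine tendsto_finsetSum _ fun j hj => ?_
  have hj' : j ≤ n := Finset.mem_range_succ_iff.1 hj
  have hd : poch (-(N : ℝ)) j * (j.factorial : ℝ) ≠ 0 :=
    mul_ne_zero (poch_neg_natCast_ne_zero (hj'.trans hn)) (Nat.cast_ne_zero.2 j.factorial_ne_zero)
  have hc : Filter.Tendsto (fun q : ℝ => (q ^ 2) ^ ((x : ℤ) - (N : ℤ))) (𝓝[≠] 1) (𝓝 1) := by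
    have : ContinuousAt (fun q : ℝ => (q ^ 2) ^ ((x : ℤ) - (N : ℤ))) 1 :=
      (continuousAt_id.pow 2).zpow₀ _ (Or.inl (by norm_num))
    simpa using this.tendsto.mono_left nhdsWithin_le_nhds
  have hp : Filter.Tendsto
      (fun q : ℝ => qPoch (-(v * q ^ (2 * h)) * (q ^ 2) ^ ((x : ℤ) - (N : ℤ))) (q ^ 2) j)
      (𝓝[≠] 1) (𝓝 ((1 + v) ^ j)) := by
    have e : (1 + v) ^ j = ∏ i ∈ Finset.range j, (1 - -(v * 1) * 1 * 1) := by simp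
    rw [e]
    exact tendsto_finsetProd _ fun i _ => tendsto_const_nhds.sub
      ((((tendsto_rpow_nhds_one (2 * h)).const_mul v).neg.mul hc).mul (tendsto_sq_pow i))
  have := ((((tendsto_qPoch_zpow n j).mul (tendsto_qPoch_zpow x j)).mul hp).div
    ((tendsto_qPoch_zpow N j).mul (tendsto_qPoch_self j)) hd).mul (tendsto_sq_pow j)
  rw [mul_one, mul_div_right_comm] at this
  rw [one_div_one_div]
  refine this.congr' ?_
  filter_upwards [eventually_pos_ne_one] with q ⟨hq, h1⟩
  have ht := pow_ne_zero j (one_sub_sq_ne_zero hq h1)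
  have e0 : qPoch (0 : ℝ) (q ^ 2) j = 1 := by simp [qPoch]
  simp only [Pi.div_apply]
  have e : ∀ a b c d f r t : ℝ, t ≠ 0 →
      a / t * (b / t) * c / (d / t * (f / t)) * r = a * b * c / (d * f) * r := by
    intro a b c d f r t ht
    rw [div_mul_div_comm, div_mul_div_comm, div_mul_eq_mul_div (a * b),
      div_div_div_cancel_right₀ (mul_ne_zero ht ht)]
  rw [e0, mul_one, e _ _ _ _ _ _ _ ht]

section

variable {M : ℕ} {N : Fin M → ℕ}

lemma hPlus_eq_add {R : Type*} [Ring R] (ρ : R) (ξ : Conf N) (k : ℕ) :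
    hPlus ρ ξ k = ρ + hPlus 0 ξ k := by simp [hPlus]

/-- The choice of `ρ` keeps `q ^ (2 ρ) = v` for all `q`, so `q ^ (-n ρ)` becomes the prefactor `v ^
(-n / 2)`, while the other prefactor powers of `q` tend to one. -/
lemma tendsto_KR {v : ℝ} (hv : 0 < v) (η ξ : Conf N) :
    Filter.Tendsto (fun q : ℝ => (-1) ^ total η * KR N (Real.logb q v / 2) q η ξ) (𝓝[≠] 1)
      (𝓝 (KHat N v η ξ)) := by
  have h1 : Filter.Tendsto (fun q : ℝ => q ^ (-uExp η / 2) * ∏ k : Fin M,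
      (v ^ (-(η k : ℝ) / 2) * (q ^ (-((η k : ℕ) : ℝ) * hPlus (0 : ℝ) ξ (k + 1)) *
        q ^ (((η k : ℕ) : ℝ) * ((N k : ℝ) - 1) / 2)) *
        qKrawtchouk (η k : ℕ) (ξ k) (v * q ^ (2 * hPlus (0 : ℝ) ξ (k + 1))) (N k) (q ^ 2))) (𝓝[≠] 1)
      (𝓝 (1 * ∏ k : Fin M, (v ^ (-(η k : ℝ) / 2) * (1 * 1)) *
        krawtchouk (η k) (ξ k) (1 / (1 + v)) (N k))) :=
    (tendsto_rpow_nhds_one _).mul (tendsto_finsetProd _ fun k _ =>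
      (((tendsto_rpow_nhds_one _).mul (tendsto_rpow_nhds_one _)).const_mul _).mul
        (tendsto_qKrawtchouk (conf_le η k) _ _ _))
  simp only [one_mul, mul_one] at h1
  refine h1.congr' ?_
  filter_upwards [eventually_pos_ne_one] with q ⟨hq, hq1⟩
  rw [KR, total, ← Finset.prod_pow_eq_pow_sum, mul_left_comm, ← Finset.prod_mul_distrib]
  congr 1
  refine Finset.prod_congr rfl fun k _ => ?_
  have hl : q ^ Real.logb q v = v := Real.rpow_logb hq hq1 hv
  have e1 : q ^ (2 * (Real.logb q v / 2 + hPlus (0 : ℝ) ξ ((k : ℕ) + 1))) =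
      v * q ^ (2 * hPlus (0 : ℝ) ξ ((k : ℕ) + 1)) := by
    rw [mul_add, mul_div_cancel₀ _ (two_ne_zero' ℝ), Real.rpow_add hq, hl]
  have e2 : q ^ (-((η k : ℕ) : ℝ) * (Real.logb q v / 2 + hPlus (0 : ℝ) ξ ((k : ℕ) + 1))) =
      v ^ (-((η k : ℕ) : ℝ) / 2) * q ^ (-((η k : ℕ) : ℝ) * hPlus (0 : ℝ) ξ ((k : ℕ) + 1)) := by
    rw [mul_add, Real.rpow_add hq, show -((η k : ℕ) : ℝ) * (Real.logb q v / 2) =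
      Real.logb q v * (-((η k : ℕ) : ℝ) / 2) by ring, Real.rpow_mul hq.le, hl]
  have e3 : ((-1 : ℝ)) ^ (η k : ℕ) * (-1) ^ (η k : ℕ) = 1 := by
    rw [← mul_pow]; simp
  rw [kSite, hPlus_eq_add (Real.logb q v / 2), e1, e2]
  linear_combination (-(v ^ (-((η k : ℕ) : ℝ) / 2) * (q ^ (-((η k : ℕ) : ℝ) * hPlus (0 : ℝ) ξ (k + 1)) *
        q ^ (((η k : ℕ) : ℝ) * ((N k : ℝ) - 1) / 2)) *
        qKrawtchouk (η k : ℕ) (ξ k) (v * q ^ (2 * hPlus (0 : ℝ) ξ (k + 1))) (N k) (q ^ 2))) * e3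

end

/-! ### The shift of the dynamic parameter -/

lemma cpow_eq_ofReal_rpow {q : ℝ} (hq : 0 < q) (s : ℝ) : (q : ℂ) ^ (s : ℂ) = ((q ^ s : ℝ) : ℂ) :=
  (Complex.ofReal_cpow hq.le s).symm

/-- The imaginary unit as a power of `q`. -/
lemma cpow_shift {q : ℝ} (hq : 0 < q) (h1 : q ≠ 1) :
    (q : ℂ) ^ (Complex.I * Real.pi / (2 * Real.log q)) = Complex.I := by
  have h0 : (q : ℂ) ≠ 0 := Complex.ofReal_ne_zero.2 hq.ne'
  have hl : (Real.log q : ℂ) ≠ 0 :=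
    Complex.ofReal_ne_zero.2 (Real.log_ne_zero_of_pos_of_ne_one hq h1)
  rw [Complex.cpow_def_of_ne_zero h0, ← Complex.ofReal_log hq.le,
    show (Real.log q : ℂ) * (Complex.I * Real.pi / (2 * Real.log q)) =
      (Real.pi / 2 : ℂ) * Complex.I by field_simp, Complex.exp_pi_div_two_mul_I]

lemma cpow_add_int_mul_shift {q : ℝ} (hq : 0 < q) (h1 : q ≠ 1) (s : ℝ) (z : ℤ) :
    (q : ℂ) ^ ((s : ℂ) + z * (Complex.I * Real.pi / (2 * Real.log q))) =
      ((q ^ s : ℝ) : ℂ) * Complex.I ^ z := by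
  have h0 : (q : ℂ) ≠ 0 := Complex.ofReal_ne_zero.2 hq.ne'
  rw [Complex.cpow_add _ _ h0, Complex.cpow_int_mul, cpow_shift hq h1, cpow_eq_ofReal_rpow hq]

lemma ofReal_qPoch (a q : ℝ) (n : ℕ) : ((qPoch a q n : ℝ) : ℂ) = qPoch (a : ℂ) (q : ℂ) n := by
  simp [qPoch]

lemma ofReal_qHahn (n x : ℕ) (α β : ℝ) (N : ℕ) (q : ℝ) :
    ((qHahn n x α β N q : ℝ) : ℂ) = qHahn n x (α : ℂ) (β : ℂ) N (q : ℂ) := by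
  simp [qHahn, ofReal_qPoch]

lemma ofReal_qBinom (q : ℝ) (n x : ℕ) : ((qBinom q n x : ℝ) : ℂ) = qBinom (q : ℂ) n x := by
  simp [qBinom, ofReal_qPoch]

/-- With the shifted parameters the one-site duality function is real. -/
lemma pSite_shift {q : ℝ} (hq : 0 < q) (h1 : q ≠ 1) (n x : ℕ) (lam ρ v : ℝ) (N : ℕ) :
    pSite n x lam (shiftedRho ρ q) (Complex.I * (q : ℂ) ^ (v : ℂ)) N q =
      ((q ^ (n * v - n * (n + ρ + lam - N)) *
        (qPoch (q ^ (2 * ((ρ + lam - N + v + 1) / 2))) (q ^ 2) x *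
          qPoch (q ^ (2 * (n + (lam - ρ - N + 1 + v) / 2))) (q ^ 2) N /
          qPoch (q ^ (2 * (-x + (lam - ρ + N + 1 + v) / 2))) (q ^ 2) (x + n)) *
        qHahn x n (q ^ (2 * ((ρ + lam - N + v - 1) / 2)))
          (q ^ (2 * ((ρ - lam - N - v - 1) / 2))) N (q ^ 2) : ℝ) : ℂ) := by
  have hI : Complex.I ≠ 0 := Complex.I_ne_zero
  have e1 : -(Complex.I * (q : ℂ) ^ (v : ℂ)) * (q : ℂ) ^ (shiftedRho ρ q + lam - N + 1) =
      ((q ^ (2 * ((ρ + lam - N + v + 1) / 2)) : ℝ) : ℂ) := by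
    rw [show shiftedRho ρ q + lam - N + 1 = ((ρ + lam - N + 1 : ℝ) : ℂ) +
        (1 : ℤ) * (Complex.I * Real.pi / (2 * Real.log q)) by rw [shiftedRho]; push_cast; ring,
      cpow_add_int_mul_shift hq h1, cpow_eq_ofReal_rpow hq, zpow_one,
      show 2 * ((ρ + lam - N + v + 1) / 2) = v + (ρ + lam - N + 1) by ring, Real.rpow_add hq v]
    push_cast
    linear_combination (-((q ^ v : ℝ) : ℂ) * ((q ^ (ρ + lam - N + 1) : ℝ) : ℂ)) * Complex.I_mul_I
  have e2 : (Complex.I * (q : ℂ) ^ (v : ℂ)) * (q : ℂ) ^ (2 * n - shiftedRho ρ q + lam - N + 1) =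
      ((q ^ (2 * (n + (lam - ρ - N + 1 + v) / 2)) : ℝ) : ℂ) := by
    rw [show 2 * n - shiftedRho ρ q + lam - N + 1 = ((2 * n - ρ + lam - N + 1 : ℝ) : ℂ) +
        (-1 : ℤ) * (Complex.I * Real.pi / (2 * Real.log q)) by rw [shiftedRho]; push_cast; ring,
      cpow_add_int_mul_shift hq h1, cpow_eq_ofReal_rpow hq, zpow_neg_one,
      show 2 * (n + (lam - ρ - N + 1 + v) / 2) = v + (2 * n - ρ + lam - N + 1) by ring, Real.rpow_add hq v]
    push_cast
    field_simp
  have e3 : (Complex.I * (q : ℂ) ^ (v : ℂ)) * (q : ℂ) ^ (-2 * x - shiftedRho ρ q + lam + N + 1) =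
      ((q ^ (2 * (-x + (lam - ρ + N + 1 + v) / 2)) : ℝ) : ℂ) := by
    rw [show -2 * x - shiftedRho ρ q + lam + N + 1 = ((-2 * x - ρ + lam + N + 1 : ℝ) : ℂ) +
        (-1 : ℤ) * (Complex.I * Real.pi / (2 * Real.log q)) by rw [shiftedRho]; push_cast; ring,
      cpow_add_int_mul_shift hq h1, cpow_eq_ofReal_rpow hq, zpow_neg_one,
      show 2 * (-x + (lam - ρ + N + 1 + v) / 2) = v + (-2 * x - ρ + lam + N + 1) by ring, Real.rpow_add hq v]
    push_cast
    field_simp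
  have e4 : -(Complex.I * (q : ℂ) ^ (v : ℂ)) * (q : ℂ) ^ (shiftedRho ρ q + lam - N - 1) =
      ((q ^ (2 * ((ρ + lam - N + v - 1) / 2)) : ℝ) : ℂ) := by
    rw [show shiftedRho ρ q + lam - N - 1 = ((ρ + lam - N - 1 : ℝ) : ℂ) +
        (1 : ℤ) * (Complex.I * Real.pi / (2 * Real.log q)) by rw [shiftedRho]; push_cast; ring,
      cpow_add_int_mul_shift hq h1, cpow_eq_ofReal_rpow hq, zpow_one,
      show 2 * ((ρ + lam - N + v - 1) / 2) = v + (ρ + lam - N - 1) by ring, Real.rpow_add hq v]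
    push_cast
    linear_combination (-((q ^ v : ℝ) : ℂ) * ((q ^ (ρ + lam - N - 1) : ℝ) : ℂ)) * Complex.I_mul_I
  have e5 : (Complex.I * (q : ℂ) ^ (v : ℂ))⁻¹ * (q : ℂ) ^ (shiftedRho ρ q - lam - N - 1) =
      ((q ^ (2 * ((ρ - lam - N - v - 1) / 2)) : ℝ) : ℂ) := by
    rw [show shiftedRho ρ q - lam - N - 1 = ((ρ - lam - N - 1 : ℝ) : ℂ) +
        (1 : ℤ) * (Complex.I * Real.pi / (2 * Real.log q)) by rw [shiftedRho]; push_cast; ring,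
      cpow_add_int_mul_shift hq h1, cpow_eq_ofReal_rpow hq, zpow_one,
      show 2 * ((ρ - lam - N - v - 1) / 2) = -v + (ρ - lam - N - 1) by ring,
      Real.rpow_add hq (-v),
      Real.rpow_neg hq.le]
    push_cast
    field_simp
  -- The factor `i ^ n` of the numerator equals the one that the shifted `ρ` puts into the power of
  -- `q` in the denominator.
  have e6 : (Complex.I * (q : ℂ) ^ (v : ℂ)) ^ n =
      ((q ^ (n * v - n * (n + ρ + lam - N)) : ℝ) : ℂ) *
        (q : ℂ) ^ ((n : ℂ) * (n + shiftedRho ρ q + lam - N)) := by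
    rw [show (n : ℂ) * (n + shiftedRho ρ q + lam - N) = ((n * (n + ρ + lam - N) : ℝ) : ℂ) +
        (n : ℤ) * (Complex.I * Real.pi / (2 * Real.log q)) by rw [shiftedRho]; push_cast; ring,
      cpow_add_int_mul_shift hq h1, cpow_eq_ofReal_rpow hq, zpow_natCast, mul_pow, ← mul_assoc,
      ← Complex.ofReal_mul, ← Real.rpow_add hq, sub_add_cancel, mul_comm (n : ℝ) v,
      Real.rpow_mul_natCast hq.le, Complex.ofReal_pow, mul_comm]
  have h0 : (q : ℂ) ^ ((n : ℂ) * (n + shiftedRho ρ q + lam - N)) ≠ 0 := by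
    rw [Complex.cpow_ne_zero_iff]
    exact Or.inl (Complex.ofReal_ne_zero.2 hq.ne')
  rw [pSite, e1, e2, e3, e4, e5, e6]
  simp only [Complex.ofReal_mul, Complex.ofReal_div, ofReal_qPoch, ofReal_qHahn, Complex.ofReal_pow]
  rw [mul_comm _ ((q : ℂ) ^ ((n : ℂ) * (n + shiftedRho ρ q + lam - N))), mul_assoc ((q : ℂ) ^ _),
    mul_div_mul_left _ _ h0, mul_div_assoc]

/-- With the shifted parameter the one-site weight is real. -/
lemma WSite_shift {q : ℝ} (hq : 0 < q) (h1 : q ≠ 1) (x N : ℕ) (ρ : ℝ) :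
    WSite x N (shiftedRho ρ q) q =
      (((1 - q ^ (2 * (2 * x + ρ - N))) / (1 - q ^ (2 * (ρ - N))) *
        (qPoch (q ^ (2 * (ρ - N))) (q ^ 2) x / qPoch (q ^ (2 * (ρ + 1))) (q ^ 2) x) *
        ((-1) ^ x * q ^ (-(x : ℝ) * (2 * ρ + 1 + x - 2 * N)) /
          qPoch (q ^ (2 * -ρ)) (q ^ 2) N) * qBinom (q ^ 2) N x : ℝ) : ℂ) := by
  have hI : Complex.I ^ (-2 : ℤ) = -1 := by
    rw [zpow_neg, zpow_ofNat, Complex.I_sq]; norm_num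
  have e1 : (q : ℂ) ^ (4 * x + 2 * shiftedRho ρ q - 2 * N) =
      -((q ^ (2 * (2 * x + ρ - N)) : ℝ) : ℂ) := by
    rw [show 4 * x + 2 * shiftedRho ρ q - 2 * N = ((2 * (2 * x + ρ - N) : ℝ) : ℂ) +
        (2 : ℤ) * (Complex.I * Real.pi / (2 * Real.log q)) by rw [shiftedRho]; push_cast; ring,
      cpow_add_int_mul_shift hq h1, zpow_ofNat, Complex.I_sq, mul_neg_one]
  have e2 : (q : ℂ) ^ (2 * shiftedRho ρ q - 2 * N) = -((q ^ (2 * (ρ - N)) : ℝ) : ℂ) := by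
    rw [show 2 * shiftedRho ρ q - 2 * N = ((2 * (ρ - N) : ℝ) : ℂ) +
        (2 : ℤ) * (Complex.I * Real.pi / (2 * Real.log q)) by rw [shiftedRho]; push_cast; ring,
      cpow_add_int_mul_shift hq h1, zpow_ofNat, Complex.I_sq, mul_neg_one]
  have e3 : (q : ℂ) ^ (2 * shiftedRho ρ q + 2) = -((q ^ (2 * (ρ + 1)) : ℝ) : ℂ) := by
    rw [show 2 * shiftedRho ρ q + 2 = ((2 * (ρ + 1) : ℝ) : ℂ) +
        (2 : ℤ) * (Complex.I * Real.pi / (2 * Real.log q)) by rw [shiftedRho]; push_cast; ring,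
      cpow_add_int_mul_shift hq h1, zpow_ofNat, Complex.I_sq, mul_neg_one]
  have e4 : (q : ℂ) ^ (-2 * shiftedRho ρ q) = -((q ^ (2 * -ρ) : ℝ) : ℂ) := by
    rw [show -2 * shiftedRho ρ q = ((2 * -ρ : ℝ) : ℂ) +
        (-2 : ℤ) * (Complex.I * Real.pi / (2 * Real.log q)) by rw [shiftedRho]; push_cast; ring,
      cpow_add_int_mul_shift hq h1, hI, mul_neg_one]
  -- Here `i ^ (-2 x)` yields the sign `(-1) ^ x` of the limiting weight.
  have e5 : (q : ℂ) ^ (-(x : ℂ) * (2 * shiftedRho ρ q + 1 + x - 2 * N)) =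
      (-1) ^ x * ((q ^ (-(x : ℝ) * (2 * ρ + 1 + x - 2 * N)) : ℝ) : ℂ) := by
    rw [show -(x : ℂ) * (2 * shiftedRho ρ q + 1 + x - 2 * N) =
        ((-(x : ℝ) * (2 * ρ + 1 + x - 2 * N) : ℝ) : ℂ) +
        (-2 * x : ℤ) * (Complex.I * Real.pi / (2 * Real.log q)) by rw [shiftedRho]; push_cast; ring,
      cpow_add_int_mul_shift hq h1, zpow_mul, hI, zpow_natCast, mul_comm]
  rw [WSite, e1, e2, e3, e4, e5]
  simp only [Complex.ofReal_mul, Complex.ofReal_div, Complex.ofReal_sub, Complex.ofReal_one,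
    ofReal_qPoch, ofReal_qBinom, Complex.ofReal_pow, Complex.ofReal_neg, neg_neg, ← sub_eq_add_neg]

/-- The `q`-shifted factorials have total length `x + N` above and `x + n` below, which accounts for
the scaling by `(1 - q^2) ^ (n - N)`. -/
lemma tendsto_pSite {n x N : ℕ} (hx : x ≤ N) {lam ρ v : ℝ}
    (hA : poch ((ρ + lam - N + v + 1) / 2) x ≠ 0)
    (hB : poch (-x + (lam - ρ + N + 1 + v) / 2) (x + n) ≠ 0) :
    Filter.Tendsto (fun q : ℝ => (1 - (q : ℂ) ^ 2) ^ n / (1 - (q : ℂ) ^ 2) ^ N *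
      pSite n x lam (shiftedRho ρ q) (Complex.I * (q : ℂ) ^ (v : ℂ)) N q) (𝓝[≠] 1)
      (𝓝 ((pHat n x lam ρ v N : ℝ) : ℂ)) := by
  have hA' : poch ((ρ + lam - N + v - 1) / 2 + 1) x ≠ 0 := by
    rwa [show (ρ + lam - N + v - 1) / 2 + 1 = (ρ + lam - N + v + 1) / 2 by ring]
  have h := ((tendsto_rpow_nhds_one (n * v - n * (n + ρ + lam - N))).mul
    (((tendsto_qPoch ((ρ + lam - N + v + 1) / 2) x).mul
      (tendsto_qPoch (n + (lam - ρ - N + 1 + v) / 2) N)).div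
      (tendsto_qPoch (-x + (lam - ρ + N + 1 + v) / 2) (x + n)) hB)).mul
    (tendsto_qHahn hx n (β := (ρ - lam - N - v - 1) / 2) hA')
  rw [one_mul] at h
  refine ((Complex.continuous_ofReal.tendsto _).comp h).congr' ?_
  filter_upwards [eventually_pos_ne_one] with q ⟨hq, h1⟩
  have ht := one_sub_sq_ne_zero hq h1
  rw [pSite_shift hq h1, ← Complex.ofReal_pow, ← Complex.ofReal_one, ← Complex.ofReal_sub,
    ← Complex.ofReal_pow, ← Complex.ofReal_pow, ← Complex.ofReal_div, ← Complex.ofReal_mul,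
    Function.comp_apply]
  congr 1
  simp only [Pi.div_apply]
  have e : ∀ a b c d f : ℝ, a * (b / (1 - q ^ 2) ^ x * (c / (1 - q ^ 2) ^ N) /
      (d / (1 - q ^ 2) ^ (x + n))) * f =
      (1 - q ^ 2) ^ n / (1 - q ^ 2) ^ N * (a * (b * c / d) * f) := by
    intro a b c d f
    rw [pow_add]
    field_simp
  exact e _ _ _ _ _

lemma tendsto_WSite {x N : ℕ} (hx : x ≤ N) {ρ : ℝ} (h1 : ρ - N ≠ 0) (h2 : poch (ρ + 1) x ≠ 0)
    (h3 : poch (-ρ) N ≠ 0) :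
    Filter.Tendsto (fun q : ℝ => (1 - (q : ℂ) ^ 2) ^ N * WSite x N (shiftedRho ρ q) q) (𝓝[≠] 1)
      (𝓝 ((WHatSite x N ρ : ℝ) : ℂ)) := by
  have h := ((((tendsto_one_sub_rpow_div (2 * x + ρ - N)).div
    (tendsto_one_sub_rpow_div (ρ - N)) h1).mul
      ((tendsto_qPoch (ρ - N) x).div (tendsto_qPoch (ρ + 1) x) h2)).mul
      (((tendsto_rpow_nhds_one (-(x : ℝ) * (2 * ρ + 1 + x - 2 * N))).const_mul ((-1) ^ x)).div
        (tendsto_qPoch (-ρ) N) h3)).mul (tendsto_qBinom hx)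
  have e : (2 * x + ρ - N) / (ρ - N) * (poch (ρ - N) x / poch (ρ + 1) x) *
      ((-1) ^ x * 1 / poch (-ρ) N) * (N.choose x : ℝ) = WHatSite x N ρ := by
    rw [WHatSite]
    field_simp
  rw [e] at h
  refine ((Complex.continuous_ofReal.tendsto _).comp h).congr' ?_
  filter_upwards [eventually_pos_ne_one] with q ⟨hq, hq1⟩
  have ht := one_sub_sq_ne_zero hq hq1
  rw [WSite_shift hq hq1, ← Complex.ofReal_pow, ← Complex.ofReal_one, ← Complex.ofReal_sub,
    ← Complex.ofReal_pow, ← Complex.ofReal_mul, Function.comp_apply]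
  congr 1
  simp only [Pi.div_apply]
  rw [div_div_div_cancel_right₀ ht, div_div_div_cancel_right₀ (pow_ne_zero x ht), div_div_eq_mul_div]
  ring

section

variable {M : ℕ} {N : Fin M → ℕ}

lemma hPlus_shiftedRho (ρ q : ℝ) (ξ : Conf N) (k : ℕ) :
    hPlus (shiftedRho ρ q) ξ k = shiftedRho (hPlus ρ ξ k) q := by
  simp only [hPlus, shiftedRho, Complex.ofReal_add, Complex.ofReal_sum]
  rw [add_right_comm]
  congr 2
  refine Finset.sum_congr rfl fun j _ => ?_
  split_ifs <;> simp

lemma ofReal_hMinus_zero (η : Conf N) (k : ℕ) :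
    hMinus (0 : ℂ) η k = ((hMinus (0 : ℝ) η k : ℝ) : ℂ) := by
  simp only [hMinus, Complex.ofReal_add, Complex.ofReal_sum, Complex.ofReal_zero]
  congr 1
  refine Finset.sum_congr rfl fun j _ => ?_
  split_ifs <;> simp

/-- The denominators of the one-site Hahn duality functions do not vanish. -/
lemma HahnGeneric.poch_site_ne_zero {ρ v : ℝ} (h : HahnGeneric N ρ v) (η ξ : Conf N) (k : Fin M) :
    poch ((hPlus ρ ξ ((k : ℕ) + 1) + hMinus (0 : ℝ) η k - N k + v + 1) / 2) (ξ k) ≠ 0 ∧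
      poch (-((ξ k : ℕ) : ℝ) + (hMinus (0 : ℝ) η k - hPlus ρ ξ ((k : ℕ) + 1) + N k + 1 + v) / 2)
        ((ξ k : ℕ) + (η k : ℕ)) ≠ 0 := by
  have hS := capacity_split (N := N) k
  have hS' : (capacity N : ℝ) = sumLT N k + N k + sumGE N (k + 1) := by exact_mod_cast hS
  have hh := sumGE_holes ξ (k + 1)
  have hh' : (sumGE ξ.holes (k + 1) : ℝ) + sumGE ξ.val (k + 1) = sumGE N (k + 1) := by
    exact_mod_cast hh
  have l1 := sumLT_mono (f := η.val) (g := N) (fun j => conf_le η j) k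
  have l2 := sumGE_mono (f := ξ.val) (g := N) (fun j => conf_le ξ j) (k + 1)
  have l3 := conf_le ξ k
  have l4 := conf_le η k
  have hA := h.poch_fst_ne_zero (m := sumLT η.val k + sumGE ξ.val (k + 1)) (n := ξ k) (by omega)
  have hB := h.poch_snd_ne_zero k
    (m := sumLT η.val k + sumGE ξ.holes (k + 1) + (N k - ξ k)) (n := ξ k + η k) (by omega)
  constructor
  · convert hA using 2
    rw [hPlus_eq, hMinus_eq, hS']; push_cast; ring
  · convert hB using 2
    rw [hPlus_eq, hMinus_eq, hS', Nat.cast_add, Nat.cast_sub l3]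
    push_cast
    linear_combination -hh'

lemma tendsto_PR {ρ v : ℝ} (h : HahnGeneric N ρ v) (η ξ : Conf N) :
    Filter.Tendsto
      (fun q : ℝ => (1 - (q : ℂ) ^ 2) ^ ((total η : ℤ) - (capacity N : ℤ)) *
        PR N (shiftedRho ρ q) (Complex.I * (q : ℂ) ^ (v : ℂ)) q η ξ)
      (𝓝[≠] 1) (𝓝 ((PHat N ρ v η ξ : ℝ) : ℂ)) := by
  rw [PHat, Complex.ofReal_prod]
  have hs : ∀ k : Fin M, Filter.Tendsto
      (fun q : ℝ => (1 - (q : ℂ) ^ 2) ^ (η k : ℕ) / (1 - (q : ℂ) ^ 2) ^ N k *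
        pSite (η k) (ξ k) (hMinus (0 : ℝ) η k : ℝ) (shiftedRho (hPlus ρ ξ ((k : ℕ) + 1)) q)
          (Complex.I * (q : ℂ) ^ (v : ℂ)) (N k) q)
      (𝓝[≠] 1) (𝓝 ((pHat (η k) (ξ k) (hMinus (0 : ℝ) η k) (hPlus ρ ξ ((k : ℕ) + 1)) v (N k) : ℝ) :
        ℂ)) := by
    intro k
    obtain ⟨hA, hB⟩ := h.poch_site_ne_zero η ξ k
    exact tendsto_pSite (conf_le ξ k) hA hB
  refine (tendsto_finsetProd Finset.univ fun k _ => hs k).congr' ?_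
  filter_upwards [eventually_pos_ne_one] with q ⟨hq, h1⟩
  have ht : (1 : ℂ) - (q : ℂ) ^ 2 ≠ 0 := by exact_mod_cast one_sub_sq_ne_zero hq h1
  rw [zpow_sub₀ ht, zpow_natCast, zpow_natCast, total, capacity, ← Finset.prod_pow_eq_pow_sum,
    ← Finset.prod_pow_eq_pow_sum, ← Finset.prod_div_distrib, PR, ← Finset.prod_mul_distrib]
  simp only [hPlus_shiftedRho, ofReal_hMinus_zero]

lemma tendsto_WR {ρ : ℝ} (hρ : ∀ j : ℤ, |j| ≤ (capacity N : ℤ) → ρ ≠ j) (ξ : Conf N) :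
    Filter.Tendsto (fun q : ℝ => (1 - (q : ℂ) ^ 2) ^ capacity N * WR N (shiftedRho ρ q) q ξ)
      (𝓝[≠] 1) (𝓝 ((WHatR N ρ ξ : ℝ) : ℂ)) := by
  rw [WHatR, Complex.ofReal_prod]
  have hs : ∀ k : Fin M, Filter.Tendsto
      (fun q : ℝ => (1 - (q : ℂ) ^ 2) ^ N k *
        WSite (ξ k) (N k) (shiftedRho (hPlus ρ ξ ((k : ℕ) + 1)) q) q)
      (𝓝[≠] 1) (𝓝 ((WHatSite (ξ k) (N k) (hPlus ρ ξ ((k : ℕ) + 1)) : ℝ) : ℂ)) := by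
    intro k
    have hlt : sumLT N (k + 1) = sumLT N k + N k := sumLT_succ N k
    have hne : ∀ i : ℤ, |i| ≤ N k → hPlus ρ ξ (k + 1) + i ≠ 0 := fun i hi =>
      hPlus_add_ne_zero hρ ξ (k + 1) (by rw [hlt]; push_cast; omega)
    have hx := conf_le ξ k
    refine tendsto_WSite hx ?_ (poch_ne_zero fun i hi => ?_) (poch_ne_zero fun i hi => ?_)
    · have := hne (-(N k : ℤ)) (by simp)
      push_cast at this
      rwa [← sub_eq_add_neg] at this
    · have := hne (1 + i) (by rw [abs_of_nonneg (by positivity)]; omega)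
      push_cast at this
      rwa [← add_assoc] at this
    · have := hne (-(i : ℤ)) (by rw [abs_neg, abs_of_nonneg (by positivity)]; omega)
      contrapose! this
      push_cast
      linarith
  refine (tendsto_finsetProd Finset.univ fun k _ => hs k).congr fun q => ?_
  rw [capacity, ← Finset.prod_pow_eq_pow_sum, WR, ← Finset.prod_mul_distrib]
  simp only [hPlus_shiftedRho]

end

end ExclusionDuality

end

-- The theorem

theorem mainTheorem10 {M : ℕ} (N : Fin M → ℕ) (hN : ∀ k, 1 ≤ N k) :
    -- the dynamic process and Hahn polynomials
    (∀ ρ v : ℝ, HahnGeneric N ρ v →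
      (∀ η ξ : Conf N,
        Filter.Tendsto
          (fun q : ℝ => (1 - (q : ℂ) ^ 2) ^ ((total η : ℤ) - (capacity N : ℤ)) *
            PR N (shiftedRho ρ q) (Complex.I * (q : ℂ) ^ (v : ℂ)) q η ξ)
          (𝓝[≠] 1) (𝓝 ((PHat N ρ v η ξ : ℝ) : ℂ))) ∧
      (DynRatesDefined N ρ → IsDuality (sepGenerator N) (dynGenerator N ρ) (PHat N ρ v)) ∧
      ((∀ j : ℤ, |j| ≤ (capacity N : ℤ) → ρ ≠ j) →
        (∀ ξ : Conf N,
          Filter.Tendsto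
            (fun q : ℝ => (1 - (q : ℂ) ^ 2) ^ capacity N * WR N (shiftedRho ρ q) q ξ)
            (𝓝[≠] 1) (𝓝 ((WHatR N ρ ξ : ℝ) : ℂ))) ∧
        IsReversible (sepGenerator N) (fun η => omegaP (capacity N) ρ v (total η) * wHat N η) ∧
        IsReversible (dynGenerator N ρ)
          (fun ξ => omegaPR (capacity N) ρ v (total ξ) * WHatR N ρ ξ) ∧
        (∀ ξ ξ' : Conf N,
          ∑ η : Conf N, PHat N ρ v η ξ * PHat N ρ v η ξ' *
              (omegaP (capacity N) ρ v (total η) * wHat N η) =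
            (if ξ = ξ' then 1 else 0) /
              (omegaPR (capacity N) ρ v (total ξ) * WHatR N ρ ξ)) ∧
        (∀ η η' : Conf N,
          ∑ ξ : Conf N, PHat N ρ v η ξ * PHat N ρ v η' ξ *
              (omegaPR (capacity N) ρ v (total ξ) * WHatR N ρ ξ) =
            (if η = η' then 1 else 0) /
              (omegaP (capacity N) ρ v (total η) * wHat N η)))) ∧
    -- self-duality and Krawtchouk polynomials
    (∀ v : ℝ, 0 < v →
      (∀ η ξ : Conf N,
        Filter.Tendsto
          (fun q : ℝ => (-1) ^ total η * KR N (Real.logb q v / 2) q η ξ)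
          (𝓝[≠] 1) (𝓝 (KHat N v η ξ))) ∧
      IsDuality (sepGenerator N) (sepGenerator N) (KHat N v) ∧
      IsReversible (sepGenerator N) (wHat N) ∧
      IsReversible (sepGenerator N) (fun ξ => omegaK (capacity N) v (total ξ) * wHat N ξ) ∧
      (∀ ξ ξ' : Conf N,
        ∑ η : Conf N, KHat N v η ξ * KHat N v η ξ' * wHat N η =
          (if ξ = ξ' then 1 else 0) / (omegaK (capacity N) v (total ξ) * wHat N ξ)) ∧
      (∀ η η' : Conf N,
        ∑ ξ : Conf N, KHat N v η ξ * KHat N v η' ξ *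
            (omegaK (capacity N) v (total ξ) * wHat N ξ) =
          (if η = η' then 1 else 0) / wHat N η)) := by
  refine ⟨fun ρ v h => ⟨tendsto_PR h, isDuality_PHat h, fun hρ => ⟨tendsto_WR hρ,
    isReversible_sep _, isReversible_dyn hρ _, PHat_orthogonal h hρ, ?_⟩⟩,
    fun v hv => ⟨tendsto_KR hv, isDuality_KHat hv, ?_, isReversible_sep _, KHat_orthogonal hv, ?_⟩⟩
  · exact dual_orthogonality (fun ξ => mul_ne_zero (omegaPR_ne_zero h ξ) (WHatR_ne_zero hρ ξ))
      (PHat_orthogonal h hρ)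
  · simpa using isReversible_sep (N := N) fun _ => 1
  · exact dual_orthogonality (fun ξ => mul_ne_zero (omegaK_ne_zero hv _ _) (wHat_ne_zero ξ))
      (KHat_orthogonal hv)
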